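/- Let $(M,g)$ be an oriented Riemannian 3-manifold (smooth), let $s>0$, and let $\mathcal S=\{u\in TM:\|u\|=s\}$ be the total space of the tangent sphere bundle of radius $s$, a 5-dimensional submanifold of $TM$. Let $\nabla$ be the Levi-Civita connection, $TTM=H\oplus V\cong\pi^*TM\oplus\pi^*TM$ the induced splitting into horizontal and vertical vectors, with lifts $a\mapsto a^h,\ a\mapsto a^v$ of tangent vectors of $M$, and let $G$ be the Sasaki metric, for which $H\perp V$ and both lifts are isometric. Let $B$ be the mirror endomorphism $Ba^h=a^v$, $Ba^v=0$, let $J=B-B^{t}$, so $Ja^h=a^v$, $Ja^v=-a^h$, let $\theta_u(X)=g(u,d\pi X)$ on $\mathcal S$, and let $I_-$ be the endomorphism which, for $u\in\mathcal S$ and a positively oriented orthonormal basis $a_0=u/s,a_1,a_2$ of $T_{\pi(u)}M$, is given by $$a_0^h,\,a_0^v\mapsto 0,\qquad a_1^h\mapsto a_2^h\mapsto -a_1^h,\qquad a_1^v\mapsto -a_2^v\mapsto -a_1^v .$$ Theorem. $I_-$ does not depend on the choice of $a_1,a_2$; $\theta$ is a contact form on $\mathcal S$, with $d\theta(X,Y)=G(X,JY)$;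 $J$ and $I_-$ preserve the contact distribution $\ker\theta$, are complex structures on it, and anticommute. The triple $(\theta,J,I_-)$ defines an $\mathrm{SU}(2)$-structure on the 5-manifold $\mathcal S$ in the sense of Conti–Salamon. That is: (a) the linear isometries $f:\mathbb R\oplus\mathbb C^2\to T_u\mathcal S$ with $\theta(f(t,z))=st$, $f(0,iz)=Jf(0,z)$ and $f(0,jz)=I_-f(0,z)$, where $j(z_0,z_1)=(-\bar z_1,\bar z_0)$, form a smooth reduction of the frame bundle of $\mathcal S$ to $\mathrm{SU}(2)$, acting in the standard way on $\mathbb C^2$ and trivially on $\mathbb R$; (b) for every constant $c>0$ (so for $\theta$ itself and for the unit form $s^{-1}\theta$), the 1-form $\alpha=c\,\theta$ and the 2-forms $\omega_1=G(J\cdot,\cdot)$, $\omega_2=G(I_-\cdot,\cdot)$, $\omega_3=G(JI_-\cdot,\cdot)$ on $\mathcal S$ are smooth and satisfy $\omega_i\wedge\omega_j=\delta_{ij}v$ for a 4-form $v$ with $v\wedge\alpha$ nowhere zero, and $X\lrcorner\omega_1=Y\lrcorner\omega_2\Rightarrow\omega_3(X,Y)\ge 0$; the frames in which $\alpha,\omega_1,\omega_2,\omega_3$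 take the standard form $dt$, $\langle i\cdot,\cdot\rangle$, $\langle j\cdot,\cdot\rangle$, $\langle ij\cdot,\cdot\rangle$ on $\mathbb R\oplus\mathbb C^2$ form a reduction to $\mathrm{SU}(2)$; for $c=s^{-1}$ it is the reduction in (a). -/

import Mathlib

open Bundle Manifold
open scoped Manifold ContDiff Topology

noncomputable section

/-- Euclidean 3-space, the model of a 3-manifold. -/
abbrev E3 : Type := EuclideanSpace ℝ (Fin 3)

/-- Euclidean 5-space, the model of a 5-manifold. -/
abbrev E5 : Type := EuclideanSpace ℝ (Fin 5)

/-! ### Forms on a 5-manifold -/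

section Wedge

variable {V : Type*}

/-- The wedge product of two 2-forms, evaluated on four vectors. -/
def wedgeTwoTwo (β η : V → V → ℝ) (x : Fin 4 → V) : ℝ :=
  β (x 0) (x 1) * η (x 2) (x 3) - β (x 0) (x 2) * η (x 1) (x 3)
    + β (x 0) (x 3) * η (x 1) (x 2) + β (x 1) (x 2) * η (x 0) (x 3)
    - β (x 1) (x 3) * η (x 0) (x 2) + β (x 2) (x 3) * η (x 0) (x 1)

/-- The wedge product of a 1-form with a 4-form, evaluated on five vectors. -/
def wedgeOneFour (α : V → ℝ) (v : (Fin 4 → V) → ℝ) (x : Fin 5 → V) : ℝ :=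
  ∑ k : Fin 5, (-1) ^ (k : ℕ) * α (x k) * v (fun i => x (k.succAbove i))

end Wedge

section FiveManifold

variable {N : Type*} [TopologicalSpace N] [ChartedSpace E5 N]

/-- The exterior derivative `dα (X, Y)` of a 1-form at `p`, computed in the chart at `p`:
there `α` becomes `a : E5 → (E5 →L[ℝ] ℝ)`, and `da (v, w) = (D_v a) w - (D_w a) v`. -/
def extDerivOneForm (α : ∀ p : N, TangentSpace (𝓡 5) p →L[ℝ] ℝ) (p : N)
    (X Y : TangentSpace (𝓡 5) p) : ℝ :=
  let φ := extChartAt (𝓡 5) p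
  let a : E5 → E5 →L[ℝ] ℝ := fun y =>
    α (φ.symm y) ∘L (mfderiv 𝓘(ℝ, E5) (𝓡 5) φ.symm y ∘L
      (NormedSpace.fromTangentSpace y).symm.toContinuousLinearMap)
  let D : TangentSpace (𝓡 5) p →L[ℝ] E5 := mvfderiv (𝓡 5) φ p
  fderiv ℝ a (φ p) (D X) (D Y) - fderiv ℝ a (φ p) (D Y) (D X)

variable [IsManifold (𝓡 5) ∞ N]

def IsSmoothOneForm (α : ∀ p : N, TangentSpace (𝓡 5) p →L[ℝ] ℝ) : Prop :=
  ContMDiff (𝓡 5) ((𝓡 5).prod 𝓘(ℝ, E5 →L[ℝ] ℝ)) ∞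
    (fun p => TotalSpace.mk' (E5 →L[ℝ] ℝ) (E := fun p : N => TangentSpace (𝓡 5) p →L[ℝ] ℝ)
      p (α p))

/-- A smooth differential 2-form on a 5-manifold. -/
structure IsSmoothTwoForm
    (β : ∀ p : N, TangentSpace (𝓡 5) p →L[ℝ] TangentSpace (𝓡 5) p →L[ℝ] ℝ) : Prop where
  alternating : ∀ p X, β p X X = 0
  contMDiff : ContMDiff (𝓡 5) ((𝓡 5).prod 𝓘(ℝ, E5 →L[ℝ] E5 →L[ℝ] ℝ)) ∞
    (fun p => TotalSpace.mk' (E5 →L[ℝ] E5 →L[ℝ] ℝ)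
      (E := fun p : N => TangentSpace (𝓡 5) p →L[ℝ] TangentSpace (𝓡 5) p →L[ℝ] ℝ) p (β p))

/-- A contact form on a 5-manifold: `α ∧ dα ∧ dα` vanishes nowhere. -/
structure IsContactForm (α : ∀ p : N, TangentSpace (𝓡 5) p →L[ℝ] ℝ) : Prop where
  smooth : IsSmoothOneForm α
  nondegenerate : ∀ p : N, ∃ x : Fin 5 → TangentSpace (𝓡 5) p,
    wedgeOneFour (α p) (wedgeTwoTwo (extDerivOneForm α p) (extDerivOneForm α p)) x ≠ 0

/-! ### SU(2)-structures on a 5-manifold -/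

/-- The model `ℝ ⊕ ℂ²` of the tangent spaces of a 5-manifold. -/
abbrev W5 : Type := ℝ × (Fin 2 → ℂ)

/-- The quaternionic structure `j (z₀, z₁) = (-conj z₁, conj z₀)` of `ℂ²`. It is antilinear,
`j² = -1`, and it commutes with `SU(2)`. -/
def quatJ (z : Fin 2 → ℂ) : Fin 2 → ℂ :=
  ![-(starRingEnd ℂ (z 1)), starRingEnd ℂ (z 0)]

/-- The Euclidean inner product `Re ∑ conj zₖ wₖ` of `ℂ² = ℝ⁴`. -/
def stdInner (z w : Fin 2 → ℂ) : ℝ :=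
  ∑ k, (starRingEnd ℂ (z k) * w k).re

/-- The three standard 2-forms of `ℂ² = ℝ⁴`: `⟨i z, w⟩`, `⟨j z, w⟩`, `⟨i j z, w⟩`, that is
`e¹² + e³⁴`, `e¹³ + e⁴²`, `e¹⁴ + e²³` in the coordinates `z₀ = x₁ + i x₂`, `z₁ = x₃ + i x₄`. -/
def stdTwoForm : Fin 3 → (Fin 2 → ℂ) → (Fin 2 → ℂ) → ℝ :=
  ![fun z w => stdInner (Complex.I • z) w,
    fun z w => stdInner (quatJ z) w,
    fun z w => stdInner (Complex.I • quatJ z) w]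

/-- An `SU(2)`-structure on a 5-manifold: a reduction of the bundle of linear frames
`ℝ ⊕ ℂ² ≃ T_p N` to the group `SU(2)`, acting in the standard way on `ℂ²` and trivially on `ℝ`.
A family `P` of sets of frames is such a reduction if each `P p` is an orbit of `SU(2)`
and `P` has a smooth local section through a neighbourhood of each point. -/
structure IsSU2Structure (P : ∀ p : N, Set (W5 ≃L[ℝ] TangentSpace (𝓡 5) p)) : Prop where
  orbit : ∀ (p : N) (f g : W5 ≃L[ℝ] TangentSpace (𝓡 5) p), f ∈ P p →
    (g ∈ P p ↔ ∃ h ∈ Matrix.specialUnitaryGroup (Fin 2) ℂ,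
      ∀ (t : ℝ) (z : Fin 2 → ℂ), g (t, z) = f (t, h.mulVec z))
  local_section : ∀ p : N, ∃ U : Set N, IsOpen U ∧ p ∈ U ∧
    ∃ f : ∀ q : N, W5 ≃L[ℝ] TangentSpace (𝓡 5) q,
      (∀ q ∈ U, f q ∈ P q) ∧
      ∀ w : W5, ContMDiffOn (𝓡 5) (𝓡 5).tangent ∞
        (fun q => (⟨q, f q w⟩ : TangentBundle (𝓡 5) N)) U

/-- The quadruplets `(α, β₁, β₂, β₃)` of Conti and Salamon: smooth forms with
`βᵢ ∧ βⱼ = δᵢⱼ v` for a 4-form `v` with `v ∧ α` nowhere zero (`α ∧ v = v ∧ α`), such that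
`X ⌟ β₁ = Y ⌟ β₂` implies `β₃(X, Y) ≥ 0`. -/
structure IsContiSalamonQuadruplet (α : ∀ p : N, TangentSpace (𝓡 5) p →L[ℝ] ℝ)
    (β : Fin 3 → ∀ p : N, TangentSpace (𝓡 5) p →L[ℝ] TangentSpace (𝓡 5) p →L[ℝ] ℝ) :
    Prop where
  smooth_one : IsSmoothOneForm α
  smooth_two : ∀ k, IsSmoothTwoForm (β k)
  wedge : ∀ p : N, ∃ v : (Fin 4 → TangentSpace (𝓡 5) p) → ℝ,
    (∀ i j x, wedgeTwoTwo (fun X Y => β i p X Y) (fun X Y => β j p X Y) x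
      = if i = j then v x else 0) ∧
    ∃ x, wedgeOneFour (α p) v x ≠ 0
  nonneg : ∀ (p : N) (X Y : TangentSpace (𝓡 5) p), β 0 p X = β 1 p Y → 0 ≤ β 2 p X Y

/-- The frames in which `α` and `β₁, β₂, β₃` take their standard form. -/
def quadrupletFrames (α : ∀ p : N, TangentSpace (𝓡 5) p →L[ℝ] ℝ)
    (β : Fin 3 → ∀ p : N, TangentSpace (𝓡 5) p →L[ℝ] TangentSpace (𝓡 5) p →L[ℝ] ℝ)
    (p : N) : Set (W5 ≃L[ℝ] TangentSpace (𝓡 5) p) :=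
  {f | (∀ w : W5, α p (f w) = w.1) ∧
    ∀ (k : Fin 3) (w w' : W5), β k p (f w) (f w') = stdTwoForm k w.2 w'.2}

end FiveManifold

/-! ### Cross product of an oriented Euclidean 3-space -/

section Cross

variable {V : Type*} [NormedAddCommGroup V] [InnerProductSpace ℝ V]
  [Fact (Module.finrank ℝ V = 3)]

/-- The bilinear form `(b, c) ↦ vol (a, b, c)`. -/
def volBilin (o : Orientation ℝ V (Fin 3)) (a : V) : V →ₗ[ℝ] V →ₗ[ℝ] ℝ :=
  have h₁ (c y : V) : Function.update ![a, 0, c] 1 y = ![a, y, c] := by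
    ext i; fin_cases i <;> rfl
  have h₂ (b y : V) : Function.update ![a, b, 0] 2 y = ![a, b, y] := by
    ext i; fin_cases i <;> rfl
  LinearMap.mk₂ ℝ (fun b c => o.volumeForm ![a, b, c])
    (fun b b' c => by simpa only [h₁] using o.volumeForm.map_update_add ![a, 0, c] 1 b b')
    (fun r b c => by simpa only [h₁] using o.volumeForm.map_update_smul ![a, 0, c] 1 r b)
    (fun b c c' => by simpa only [h₂] using o.volumeForm.map_update_add ![a, b, 0] 2 c c')
    (fun r b c => by simpa only [h₂] using o.volumeForm.map_update_smul ![a, b, 0] 2 r c)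

/-- The cross product `b ↦ a × b`, characterized by `⟪a × b, c⟫ = vol (a, b, c)`. -/
def cross [FiniteDimensional ℝ V] (o : Orientation ℝ V (Fin 3)) (a : V) : V →L[ℝ] V :=
  LinearMap.toContinuousLinearMap
    (((InnerProductSpace.toDual ℝ V).toLinearEquiv ≪≫ₗ
      LinearMap.toContinuousLinearMap.symm).symm.toLinearMap ∘ₗ volBilin o a)

theorem inner_cross [FiniteDimensional ℝ V] (o : Orientation ℝ V (Fin 3)) (a b c : V) :
    inner ℝ (cross o a b) c = o.volumeForm ![a, b, c] := by
  simp [cross, volBilin]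
  exact InnerProductSpace.toDual_symm_apply

end Cross

/-! ### The splitting of `T(TM)` defined by a connection on a 3-manifold -/

section Connection

variable {M : Type*} [TopologicalSpace M] [ChartedSpace E3 M]

instance factFinrankTangentSpace (x : M) :
    Fact (Module.finrank ℝ (TangentSpace (𝓡 3) x) = 3) :=
  ⟨finrank_euclideanSpace_fin (𝕜 := ℝ) (n := 3)⟩

instance finiteDimensionalTangentSpace (x : M) :
    FiniteDimensional ℝ (TangentSpace (𝓡 3) x) :=
  inferInstanceAs (FiniteDimensional ℝ E3)

variable [IsManifold (𝓡 3) ∞ M]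

/-- An orientation of the manifold `M`: orientations of the tangent spaces which are locally
constant in the local trivializations of the tangent bundle. -/
def IsManifoldOrientation (o : ∀ x : M, Orientation ℝ (TangentSpace (𝓡 3) x) (Fin 3)) : Prop :=
  ∀ x₀ : M, ∃ o₀ : Orientation ℝ E3 (Fin 3), ∀ᶠ x in 𝓝 x₀,
    ∀ hx : x ∈ (trivializationAt E3 (TangentSpace (𝓡 3)) x₀).baseSet,
      Orientation.map (Fin 3)
        ((trivializationAt E3 (TangentSpace (𝓡 3)) x₀).linearEquivAt ℝ x hx) (o x) = o₀

/-- The differential `dπ` of the projection `π : TM → M` at `u`. -/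
def projDeriv (u : TangentBundle (𝓡 3) M) :
    TangentSpace (𝓡 3).tangent u →L[ℝ] TangentSpace (𝓡 3) u.proj :=
  mfderiv (𝓡 3).tangent (𝓡 3) (fun p : TangentBundle (𝓡 3) M => p.proj) u

/-- The connection map `K : T_u(TM) → T_x M` of `∇`, the projection onto the vertical part:
`K(dσ(a)) = ∇_a σ` for local sections `σ` through `u`, and `K(b^v) = b` for vertical lifts.
With `σ` the extension of `u` which is constant in the trivialization `e` of `TM` at `x`, one has
`K X = ∇_{dπ X} σ + (X - dσ(dπ X))`, and the vertical vector `X - dσ(dπ X)` is the derivative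
of the fibre component of `e` in the direction `X`. -/
def connMap (nabla : CovariantDerivative (𝓡 3) E3 (TangentSpace (𝓡 3) : M → Type _))
    (u : TangentBundle (𝓡 3) M) :
    TangentSpace (𝓡 3).tangent u →L[ℝ] TangentSpace (𝓡 3) u.proj :=
  (trivializationAt E3 (TangentSpace (𝓡 3)) u.proj).symmL ℝ u.proj ∘L
      mvfderiv (𝓡 3).tangent
        (fun p : TangentBundle (𝓡 3) M => (trivializationAt E3 (TangentSpace (𝓡 3)) u.proj p).2) u
    + nabla (FiberBundle.extend E3 u.snd) u.proj ∘L projDeriv u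

/-- The isomorphism `T_u(TM) = H_u ⊕ V_u ≅ T_x M × T_x M`, `X ↦ (dπ X, K X)`. -/
def splitting (nabla : CovariantDerivative (𝓡 3) E3 (TangentSpace (𝓡 3) : M → Type _))
    (u : TangentBundle (𝓡 3) M) :
    TangentSpace (𝓡 3).tangent u →L[ℝ]
      TangentSpace (𝓡 3) u.proj × TangentSpace (𝓡 3) u.proj :=
  (projDeriv u).prod (connMap nabla u)

theorem hasMFDerivAt_extChartAt_self {E H N : Type*} [NormedAddCommGroup E] [NormedSpace ℝ E]
    [TopologicalSpace H] (I : ModelWithCorners ℝ E H) [TopologicalSpace N] [ChartedSpace H N]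
    (u : N) :
    HasMFDerivAt I 𝓘(ℝ, E) (extChartAt I u) u (ContinuousLinearMap.id ℝ E) := by
  refine ⟨continuousAt_extChartAt u, ?_⟩
  refine (hasFDerivWithinAt_id _ _).congr_of_eventuallyEq ?_ ?_
  · filter_upwards [extChartAt_target_mem_nhdsWithin (I := I) u] with y hy
    simp only [writtenInExtChartAt, extChartAt_model_space_eq_id]
    exact (extChartAt I u).right_inv hy
  · simp only [writtenInExtChartAt, extChartAt_model_space_eq_id]
    exact congrArg (extChartAt I u) ((extChartAt I u).left_inv (mem_extChartAt_source u))

theorem projDeriv_eq (u : TangentBundle (𝓡 3) M) (X : TangentSpace (𝓡 3).tangent u) :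
    projDeriv u X = (show E3 × E3 from X).1 := by
  have h1 : (extChartAt (𝓡 3) u.proj) ∘ (fun p : TangentBundle (𝓡 3) M => p.proj)
      = (ContinuousLinearMap.fst ℝ E3 E3) ∘ (extChartAt (𝓡 3).tangent u) := by
    ext1 p
    rw [FiberBundle.extChartAt]
    rfl
  have h2 := ((ContinuousLinearMap.fst ℝ E3 E3).hasMFDerivAt
    (x := extChartAt (𝓡 3).tangent u u)).comp u (hasMFDerivAt_extChartAt_self (𝓡 3).tangent u)
  rw [← h1] at h2
  have h3 := (hasMFDerivAt_extChartAt_self (𝓡 3) u.proj).comp u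
    (((contMDiff_proj (n := 1) (IB := 𝓡 3) (F := E3)
      (TangentSpace (𝓡 3) : M → Type _)).mdifferentiable one_ne_zero) u).hasMFDerivAt
  exact congr($(hasMFDerivAt_unique h3 h2) X)

theorem fiberDeriv_eq (u : TangentBundle (𝓡 3) M) (X : TangentSpace (𝓡 3).tangent u) :
    mvfderiv (𝓡 3).tangent (fun p : TangentBundle (𝓡 3) M =>
      (trivializationAt E3 (TangentSpace (𝓡 3)) u.proj p).2) u X = (show E3 × E3 from X).2 := by
  have h1 : (fun p : TangentBundle (𝓡 3) M =>
        (trivializationAt E3 (TangentSpace (𝓡 3)) u.proj p).2)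
      = (ContinuousLinearMap.snd ℝ E3 E3) ∘ (extChartAt (𝓡 3).tangent u) := by
    ext1 p
    rw [FiberBundle.extChartAt]
    rfl
  have h2 := ((ContinuousLinearMap.snd ℝ E3 E3).hasMFDerivAt
    (x := extChartAt (𝓡 3).tangent u u)).comp u (hasMFDerivAt_extChartAt_self (𝓡 3).tangent u)
  rw [← h1] at h2
  unfold mvfderiv
  rw [h2.mfderiv]
  rfl

theorem splitting_isInvertible
    (nabla : CovariantDerivative (𝓡 3) E3 (TangentSpace (𝓡 3) : M → Type _))
    (u : TangentBundle (𝓡 3) M) : (splitting nabla u).IsInvertible := by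
  have hinj : Function.Injective (splitting nabla u) := by
    rw [injective_iff_map_eq_zero]
    intro X hX
    have h1 : projDeriv u X = 0 := congrArg Prod.fst hX
    have h2 : connMap nabla u X = 0 := congrArg Prod.snd hX
    have h4 : (show E3 × E3 from X).1 = 0 := (projDeriv_eq u X).symm.trans h1
    have h3 : (show E3 × E3 from X).2 = 0 := by
      simp only [connMap, add_apply, ContinuousLinearMap.comp_apply, h1,
        map_zero, add_zero, fiberDeriv_eq] at h2
      have := congrArg ((trivializationAt E3 (TangentSpace (𝓡 3)) u.proj).continuousLinearMapAt ℝ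
        u.proj) h2
      rwa [Trivialization.continuousLinearMapAt_symmL _
        (FiberBundle.mem_baseSet_trivializationAt' u.proj), map_zero] at this
    exact Prod.ext h4 h3
  have : FiniteDimensional ℝ (TangentSpace (𝓡 3).tangent u) :=
    inferInstanceAs (FiniteDimensional ℝ (E3 × E3))
  have : T2Space (TangentSpace (𝓡 3).tangent u) := inferInstanceAs (T2Space (E3 × E3))
  have : T2Space (TangentSpace (𝓡 3) u.proj × TangentSpace (𝓡 3) u.proj) :=
    inferInstanceAs (T2Space (E3 × E3))
  let L : TangentSpace (𝓡 3).tangent u ≃ₗ[ℝ]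
      TangentSpace (𝓡 3) u.proj × TangentSpace (𝓡 3) u.proj :=
    LinearEquiv.ofInjectiveOfFinrankEq (splitting nabla u).toLinearMap hinj rfl
  exact ⟨L.toContinuousLinearEquiv, rfl⟩

/-- The lift `(a, b) ↦ a^h + b^v` of tangent vectors of `M` to `T_u(TM)`, the inverse of the
isomorphism `splitting nabla u`. -/
def lift (nabla : CovariantDerivative (𝓡 3) E3 (TangentSpace (𝓡 3) : M → Type _))
    (u : TangentBundle (𝓡 3) M) :
    TangentSpace (𝓡 3) u.proj × TangentSpace (𝓡 3) u.proj →L[ℝ] TangentSpace (𝓡 3).tangent u :=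
  (splitting nabla u).inverse

/-- The mirror endomorphism `B` of `T(TM)`: `B a^h = a^v`, `B a^v = 0`. -/
def mirrorB (nabla : CovariantDerivative (𝓡 3) E3 (TangentSpace (𝓡 3) : M → Type _))
    (u : TangentBundle (𝓡 3) M) :
    TangentSpace (𝓡 3).tangent u →L[ℝ] TangentSpace (𝓡 3).tangent u :=
  lift nabla u ∘L ContinuousLinearMap.prod 0 (projDeriv u)

/-- The transpose `Bᵗ` of the mirror endomorphism: `Bᵗ a^v = a^h`, `Bᵗ a^h = 0`. -/
def mirrorBt (nabla : CovariantDerivative (𝓡 3) E3 (TangentSpace (𝓡 3) : M → Type _))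
    (u : TangentBundle (𝓡 3) M) :
    TangentSpace (𝓡 3).tangent u →L[ℝ] TangentSpace (𝓡 3).tangent u :=
  lift nabla u ∘L ContinuousLinearMap.prod (connMap nabla u) 0

/-- The Sasaki almost complex structure `J = B - Bᵗ` of `TM`. -/
def sasakiJ (nabla : CovariantDerivative (𝓡 3) E3 (TangentSpace (𝓡 3) : M → Type _))
    (u : TangentBundle (𝓡 3) M) :
    TangentSpace (𝓡 3).tangent u →L[ℝ] TangentSpace (𝓡 3).tangent u :=
  mirrorB nabla u - mirrorBt nabla u

end Connection

/-! ### The tangent sphere bundle of an oriented Riemannian 3-manifold -/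

section Riemannian

variable {M : Type*} [TopologicalSpace M] [ChartedSpace E3 M] [IsManifold (𝓡 3) ∞ M]
  [RiemannianBundle (fun x : M => TangentSpace (𝓡 3) x)]

/-- The Sasaki metric `⟪dπ X, dπ Y⟫ + ⟪K X, K Y⟫` of `TM`. -/
def sasakiMetric (nabla : CovariantDerivative (𝓡 3) E3 (TangentSpace (𝓡 3) : M → Type _))
    (u : TangentBundle (𝓡 3) M) :
    TangentSpace (𝓡 3).tangent u →L[ℝ] TangentSpace (𝓡 3).tangent u →L[ℝ] ℝ :=
  let g : TangentSpace (𝓡 3) u.proj →L[ℝ] TangentSpace (𝓡 3) u.proj →L[ℝ] ℝ := innerSL ℝ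
  (projDeriv u).precomp ℝ ∘L g ∘L projDeriv u + (connMap nabla u).precomp ℝ ∘L g ∘L connMap nabla u

/-- The endomorphism `I₋` of `T_u(TM)`, for `‖u‖ = s`: it kills the horizontal and the vertical
lift of `u`, and it rotates the lifts of the oriented plane `u^⊥` by a right angle, in the positive
direction on horizontal lifts and in the negative direction on vertical lifts. The positive
rotation of `u^⊥` is `a ↦ s⁻¹ u × a`. -/
def endoIMinus (nabla : CovariantDerivative (𝓡 3) E3 (TangentSpace (𝓡 3) : M → Type _))
    (o : ∀ x : M, Orientation ℝ (TangentSpace (𝓡 3) x) (Fin 3)) (s : ℝ)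
    (u : TangentBundle (𝓡 3) M) :
    TangentSpace (𝓡 3).tangent u →L[ℝ] TangentSpace (𝓡 3).tangent u :=
  s⁻¹ • (lift nabla u ∘L ContinuousLinearMap.prod
    (cross (o u.proj) u.snd ∘L projDeriv u) (-(cross (o u.proj) u.snd ∘L connMap nabla u)))

variable (M) in
/-- The total space of the tangent sphere bundle of radius `s`, as a subspace of `TM`. -/
abbrev TangentSphere (s : ℝ) : Type _ := {u : TangentBundle (𝓡 3) M // ‖u.snd‖ = s}

variable {s : ℝ}

/-- The manifold structure `cs` makes the tangent sphere bundle a smooth submanifold of `TM`: the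
inclusion, which is a topological embedding, is an immersion. Such a structure is unique. -/
structure IsSubmanifoldStructure (cs : ChartedSpace E5 (TangentSphere M s)) : Prop where
  isManifold : IsManifold (𝓡 5) ∞ (TangentSphere M s)
  contMDiff_val : ContMDiff (𝓡 5) (𝓡 3).tangent ∞
    (Subtype.val : TangentSphere M s → TangentBundle (𝓡 3) M)
  injective_mfderiv : ∀ p : TangentSphere M s, Function.Injective
    (mfderiv (𝓡 5) (𝓡 3).tangent (Subtype.val : TangentSphere M s → TangentBundle (𝓡 3) M) p)

variable [ChartedSpace E5 (TangentSphere M s)]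

/-- The differential of the inclusion of the tangent sphere bundle in `TM`. -/
def inclDeriv (p : TangentSphere M s) :
    TangentSpace (𝓡 5) p →L[ℝ] TangentSpace (𝓡 3).tangent p.val :=
  mfderiv (𝓡 5) (𝓡 3).tangent (Subtype.val : TangentSphere M s → TangentBundle (𝓡 3) M) p

/-- The 1-form `θ = ⟨ξ, B ·⟩` on the tangent sphere bundle, `θ_u(X) = ⟪u, dπ X⟫`. -/
def theta (p : TangentSphere M s) : TangentSpace (𝓡 5) p →L[ℝ] ℝ :=
  innerSL ℝ p.val.snd ∘L projDeriv p.val ∘L inclDeriv p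

/-- The contact distribution `ker θ`, as a subspace of `T(TM)`. -/
def contactDistribution (p : TangentSphere M s) :
    Submodule ℝ (TangentSpace (𝓡 3).tangent p.val) :=
  (theta p).ker.map (inclDeriv p).toLinearMap

/-- The three 2-forms `G(J ·, ·)`, `G(I₋ ·, ·)`, `G(J I₋ ·, ·)` on the tangent sphere bundle,
where `G` is the Sasaki metric. -/
def sphereTwoForm (nabla : CovariantDerivative (𝓡 3) E3 (TangentSpace (𝓡 3) : M → Type _))
    (o : ∀ x : M, Orientation ℝ (TangentSpace (𝓡 3) x) (Fin 3)) (k : Fin 3)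
    (p : TangentSphere M s) : TangentSpace (𝓡 5) p →L[ℝ] TangentSpace (𝓡 5) p →L[ℝ] ℝ :=
  (inclDeriv p).precomp ℝ ∘L sasakiMetric nabla p.val ∘L
    ![sasakiJ nabla p.val, endoIMinus nabla o s p.val,
      sasakiJ nabla p.val ∘L endoIMinus nabla o s p.val] k ∘L inclDeriv p

/-- The frames adapted to `(θ, J, I₋)` and to the Sasaki metric: the isometries
`f : ℝ ⊕ ℂ² → T_p 𝒮` with `θ (f (t, z)) = s t` which on `ker θ` carry multiplication by `i` to
`J` and multiplication by `j` to `I₋`. -/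
def adaptedFrames (nabla : CovariantDerivative (𝓡 3) E3 (TangentSpace (𝓡 3) : M → Type _))
    (o : ∀ x : M, Orientation ℝ (TangentSpace (𝓡 3) x) (Fin 3))
    (p : TangentSphere M s) : Set (W5 ≃L[ℝ] TangentSpace (𝓡 5) p) :=
  {f | (∀ w w' : W5, sasakiMetric nabla p.val (inclDeriv p (f w)) (inclDeriv p (f w'))
        = w.1 * w'.1 + stdInner w.2 w'.2) ∧
    (∀ w : W5, theta p (f w) = s * w.1) ∧
    (∀ z, inclDeriv p (f (0, Complex.I • z)) = sasakiJ nabla p.val (inclDeriv p (f (0, z)))) ∧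
    (∀ z, inclDeriv p (f (0, quatJ z)) = endoIMinus nabla o s p.val (inclDeriv p (f (0, z))))}

end Riemannian

section LeviCivita

variable {M : Type*} [TopologicalSpace M] [ChartedSpace E3 M] [IsManifold (𝓡 3) ∞ M]
  [RiemannianBundle (fun x : M => TangentSpace (𝓡 3) x)]
  [IsContMDiffRiemannianBundle (𝓡 3) ∞ E3 (fun x : M => TangentSpace (𝓡 3) x)]

instance riemannianBundleOne :
    IsContMDiffRiemannianBundle (𝓡 3) 1 E3 (TangentSpace (𝓡 3) : M → Type _) :=
  IsContMDiffRiemannianBundle.of_le (n := ∞) (by norm_cast)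

/-- The Levi-Civita connection: the torsion-free metric connection. -/
structure IsLeviCivita
    (nabla : CovariantDerivative (𝓡 3) E3 (TangentSpace (𝓡 3) : M → Type _)) : Prop where
  metric : nabla.IsMetricCompatible
  torsion_free : nabla.torsion = 0

end LeviCivita

end

/-!
Fix `u` in the sphere bundle `𝒮` and a positively oriented orthonormal basis `(u/s, e₀, e₁)` of the
tangent space of `M`. For a tangent vector `X` of `𝒮` let `modelCoord` be the vector
`(c θ(X), z₀, z₁)` of `ℝ ⊕ ℂ²`, where `zₖ = ⟪eₖ, dπ X⟫ + i ⟪eₖ, K X⟫`, with `K` the connection map.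
The sixth component `⟪u, K X⟫` vanishes: `⟪u, K ·⟫` is half the derivative of `‖u‖²` because `∇` is
metric, and `‖u‖` is constant on `𝒮` (`inner_connMap_inclDeriv`). So `modelCoord` is an isomorphism.
On `ker θ` it turns `J` into multiplication by `i` and `I₋` into `j`. It turns the Sasaki metric
into the Euclidean one (for `c = s⁻¹`), and the 2-forms into the standard ones
(`IsAdaptedPair.inclDeriv_eq_sasakiJ_iff`, `IsAdaptedPair.inclDeriv_eq_endoIMinus_iff`,
`IsAdaptedPair.sasakiMetric_eq`, `IsAdaptedPair.sphereTwoForm_eq`). The pointwise claims are thereby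
reduced to `ℝ ⊕ ℂ²`.

A linear bijection of `ℝ ⊕ ℂ²` lies in `SU(2)` if and only if it is an isometry which preserves `dt`
and commutes with `i` and `j` (`isSU2Map_iff_adapted`), and if and only if it preserves `dt` and the
three standard 2-forms (`isSU2Map_iff_quadruplet`). Hence a frame `g` is adapted, respectively
standard for the forms, exactly when `modelCoord ∘ g` is in `SU(2)`. Both sets of frames are
therefore orbits of `SU(2)`, and for `c = s⁻¹` they agree.

For smoothness, Gram-Schmidt orthogonalization gives smooth local choices of `(e₀, e₁)`, positively
oriented by continuity (`exists_local_isAdaptedPair`). In a chart, `modelCoord` is then a smooth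
function of the metric, its first derivatives and `(e₀, e₁)`, because `K` is the derivative of the
fibre coordinate corrected by a Christoffel symbol (`IsLeviCivita.inner_connMap`). The forms are
smooth functions of `modelCoord`, and its inverse is a local section of the frames.

The formula for `dθ` is a computation in a chart: there `θ = g(v, dx)`, and the terms of `dθ` which
contain derivatives of `g` are the Christoffel terms in `⟪K X, dπ Y⟫ - ⟪dπ X, K Y⟫ = G(X, J Y)`
(`extDerivOneForm_theta`). The contact condition follows, since `dθ` is the opposite of the 2-form
of `J`.

The Levi-Civita connection is constructed pointwise, by Koszul's formula in the chart centred at the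
point (`exists_isLeviCivita`). The charts of `𝒮` are the coordinates `(x, v) ↦ (x, [v])` of rays
(`exists_isSubmanifoldStructure`).
-/

noncomputable section

/-! ### The model `ℝ ⊕ ℂ²` and the group `SU(2)` -/

theorem stdInner_eq (z w : Fin 2 → ℂ) : stdInner z w =
    (z 0).re * (w 0).re + (z 0).im * (w 0).im + ((z 1).re * (w 1).re + (z 1).im * (w 1).im) := by
  simp [stdInner, Fin.sum_univ_two]

theorem stdTwoForm_zero_eq (z w : Fin 2 → ℂ) : stdTwoForm 0 z w =
    (z 0).re * (w 0).im - (z 0).im * (w 0).re + ((z 1).re * (w 1).im - (z 1).im * (w 1).re) := by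
  simp [stdTwoForm, stdInner_eq]; ring

theorem stdTwoForm_one_eq (z w : Fin 2 → ℂ) : stdTwoForm 1 z w =
    (z 0).re * (w 1).re - (z 1).re * (w 0).re + ((z 1).im * (w 0).im - (z 0).im * (w 1).im) := by
  simp [stdTwoForm, stdInner_eq, quatJ]; ring

theorem stdTwoForm_two_eq (z w : Fin 2 → ℂ) : stdTwoForm 2 z w =
    (z 0).re * (w 1).im - (z 1).im * (w 0).re + ((z 0).im * (w 1).re - (z 1).re * (w 0).im) := by
  simp [stdTwoForm, stdInner_eq, quatJ]; ring

theorem mulVec_fin_two (U : Matrix (Fin 2) (Fin 2) ℂ) (z : Fin 2 → ℂ) :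
    U.mulVec z = ![U 0 0 * z 0 + U 0 1 * z 1, U 1 0 * z 0 + U 1 1 * z 1] := by
  ext i; fin_cases i <;> simp [Matrix.mulVec, dotProduct, Fin.sum_univ_two]

/-- The first basis vector of `ℂ²`. Over the quaternions it spans `ℂ²`. -/
def stdE : Fin 2 → ℂ := ![1, 0]

theorem eq_quaternion_smul_stdE (z : Fin 2 → ℂ) :
    z = (z 0).re • stdE + (z 0).im • (Complex.I • stdE) + (z 1).re • quatJ stdE
      + (z 1).im • (Complex.I • quatJ stdE) := by
  ext i; fin_cases i <;> apply Complex.ext <;> simp [quatJ, stdE]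

/-- The matrix of right multiplication by a unit quaternion `a + b j` is in `SU(2)`, where `ℂ²` is
the space of quaternions `z₀ + z₁ j`. -/
theorem mem_specialUnitaryGroup_of_quaternion (a b : ℂ)
    (h : a.re * a.re + a.im * a.im + (b.re * b.re + b.im * b.im) = 1) :
    (!![a, -(starRingEnd ℂ b); b, starRingEnd ℂ a] : Matrix (Fin 2) (Fin 2) ℂ) ∈
      Matrix.specialUnitaryGroup (Fin 2) ℂ := by
  rw [Matrix.mem_specialUnitaryGroup_iff, Matrix.mem_unitaryGroup_iff']
  constructor
  · ext i j
    fin_cases i <;> fin_cases j <;> apply Complex.ext <;>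
      simp [Matrix.mul_apply, Fin.sum_univ_two, Matrix.star_eq_conjTranspose] <;>
      linarith
  · rw [Matrix.det_fin_two_of]
    apply Complex.ext <;> simp <;> linarith

theorem exists_quaternion_of_mem_specialUnitaryGroup {U : Matrix (Fin 2) (Fin 2) ℂ}
    (hU : U ∈ Matrix.specialUnitaryGroup (Fin 2) ℂ) :
    ∃ a b : ℂ, U = !![a, -(starRingEnd ℂ b); b, starRingEnd ℂ a] ∧
      a.re * a.re + a.im * a.im + (b.re * b.re + b.im * b.im) = 1 := by
  rw [Matrix.mem_specialUnitaryGroup_iff, Matrix.mem_unitaryGroup_iff'] at hU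
  obtain ⟨h1, h2⟩ := hU
  -- the inverse of a matrix of determinant one is its adjugate
  have h3 : star U = U.adjugate := by
    have := U.mul_adjugate
    rw [h2, one_smul] at this
    calc star U = star U * (U * U.adjugate) := by rw [this, mul_one]
      _ = U.adjugate := by rw [← mul_assoc, h1, one_mul]
  rw [Matrix.adjugate_fin_two] at h3
  have h00 := congrFun (congrFun h3 0) 0
  have h10 := congrFun (congrFun h3 0) 1
  simp only [Matrix.star_apply, Matrix.of_apply, Matrix.cons_val', Matrix.cons_val_zero,
    Matrix.cons_val_one, Matrix.cons_val_fin_one] at h00 h10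
  have e1 : U 1 1 = starRingEnd ℂ (U 0 0) := h00.symm
  have e2 : U 0 1 = -(starRingEnd ℂ (U 1 0)) := by
    rw [show starRingEnd ℂ (U 1 0) = -U 0 1 from h10, neg_neg]
  refine ⟨U 0 0, U 1 0, ?_, ?_⟩
  · ext i j; fin_cases i <;> fin_cases j <;> simp [e1, e2]
  · rw [Matrix.det_fin_two, e1, e2] at h2
    have := congrArg Complex.re h2
    simp at this
    linarith

section SU2

variable {U : Matrix (Fin 2) (Fin 2) ℂ} (hU : U ∈ Matrix.specialUnitaryGroup (Fin 2) ℂ)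
include hU

theorem quatJ_mulVec (z : Fin 2 → ℂ) : quatJ (U.mulVec z) = U.mulVec (quatJ z) := by
  obtain ⟨a, b, rfl, -⟩ := exists_quaternion_of_mem_specialUnitaryGroup hU
  rw [mulVec_fin_two, mulVec_fin_two]
  ext i; fin_cases i <;> simp [quatJ] <;> ring

theorem stdInner_mulVec (z w : Fin 2 → ℂ) :
    stdInner (U.mulVec z) (U.mulVec w) = stdInner z w := by
  obtain ⟨a, b, rfl, h⟩ := exists_quaternion_of_mem_specialUnitaryGroup hU
  rw [mulVec_fin_two, mulVec_fin_two, stdInner_eq, stdInner_eq]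
  simp
  linear_combination ((z 0).re * (w 0).re + (z 0).im * (w 0).im
    + ((z 1).re * (w 1).re + (z 1).im * (w 1).im)) * h

theorem stdTwoForm_mulVec (k : Fin 3) (z w : Fin 2 → ℂ) :
    stdTwoForm k (U.mulVec z) (U.mulVec w) = stdTwoForm k z w := by
  fin_cases k
  · exact (congrArg (stdInner · _) (Matrix.mulVec_smul U Complex.I z).symm).trans
      (stdInner_mulVec hU _ _)
  · exact (congrArg (stdInner · _) (quatJ_mulVec hU z)).trans (stdInner_mulVec hU _ _)
  · refine (congrArg (stdInner · _) ?_).trans (stdInner_mulVec hU (Complex.I • quatJ z) w)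
    rw [quatJ_mulVec hU, ← Matrix.mulVec_smul]

end SU2

/-- A real linear map of `ℂ²` which commutes with `i` and `j` and preserves the norm of one unit
vector is in `SU(2)`, as right multiplication by a unit quaternion. -/
theorem exists_specialUnitary_of_commute (B : (Fin 2 → ℂ) →ₗ[ℝ] (Fin 2 → ℂ))
    (hI : ∀ z, B (Complex.I • z) = Complex.I • B z) (hJ : ∀ z, B (quatJ z) = quatJ (B z))
    (h : stdInner (B stdE) (B stdE) = 1) :
    ∃ U ∈ Matrix.specialUnitaryGroup (Fin 2) ℂ, ∀ z, B z = U.mulVec z := by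
  rw [stdInner_eq] at h
  refine ⟨_, mem_specialUnitaryGroup_of_quaternion (B stdE 0) (B stdE 1) h, fun z => ?_⟩
  rw [mulVec_fin_two]
  conv_lhs => rw [eq_quaternion_smul_stdE z]
  simp only [map_add, map_smul, hI, hJ]
  ext i; fin_cases i <;> apply Complex.ext <;>
    simp [quatJ, Matrix.vecHead, Matrix.vecTail] <;> ring

/-- The linear maps of `ℝ ⊕ ℂ²` in `SU(2)`. -/
def IsSU2Map (h : W5 → W5) : Prop :=
  ∃ U ∈ Matrix.specialUnitaryGroup (Fin 2) ℂ, ∀ (t : ℝ) (z : Fin 2 → ℂ),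
    h (t, z) = (t, U.mulVec z)

theorem stdInner_self_eq_zero {z : Fin 2 → ℂ} (h : stdInner z z = 0) : z = 0 := by
  rw [stdInner_eq] at h
  have h1 : (z 0).re = 0 := by
    nlinarith [sq_nonneg (z 0).re, sq_nonneg (z 0).im, sq_nonneg (z 1).re, sq_nonneg (z 1).im]
  have h2 : (z 0).im = 0 := by
    nlinarith [sq_nonneg (z 0).re, sq_nonneg (z 0).im, sq_nonneg (z 1).re, sq_nonneg (z 1).im]
  have h3 : (z 1).re = 0 := by
    nlinarith [sq_nonneg (z 0).re, sq_nonneg (z 0).im, sq_nonneg (z 1).re, sq_nonneg (z 1).im]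
  have h4 : (z 1).im = 0 := by
    nlinarith [sq_nonneg (z 0).re, sq_nonneg (z 0).im, sq_nonneg (z 1).re, sq_nonneg (z 1).im]
  ext i; fin_cases i <;> apply Complex.ext <;> simpa

/-- The linear part on `ℂ²` of a linear map of `ℝ ⊕ ℂ²`. -/
def compTwo (h : W5 →ₗ[ℝ] W5) : (Fin 2 → ℂ) →ₗ[ℝ] (Fin 2 → ℂ) :=
  LinearMap.snd ℝ _ _ ∘ₗ h ∘ₗ LinearMap.inr ℝ ℝ (Fin 2 → ℂ)

theorem compTwo_apply (h : W5 →ₗ[ℝ] W5) (z : Fin 2 → ℂ) : compTwo h z = (h (0, z)).2 := rfl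

theorem isSU2Map_of_compTwo {h : W5 →ₗ[ℝ] W5} (hfst : ∀ w, (h w).1 = w.1)
    (h0 : (h (1, 0)).2 = 0) (hI : ∀ z, compTwo h (Complex.I • z) = Complex.I • compTwo h z)
    (hJ : ∀ z, compTwo h (quatJ z) = quatJ (compTwo h z))
    (h1 : stdInner (compTwo h stdE) (compTwo h stdE) = 1) : IsSU2Map h := by
  obtain ⟨U, hU, hB⟩ := exists_specialUnitary_of_commute (compTwo h) hI hJ h1
  refine ⟨U, hU, fun t z => Prod.ext (hfst _) ?_⟩
  have : ((t, z) : W5) = t • ((1, 0) : W5) + (0, z) := by ext <;> simp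
  rw [this, map_add, map_smul, Prod.snd_add, Prod.smul_snd, h0, ← hB, compTwo_apply]
  simp

/-- A linear map of `ℝ ⊕ ℂ²` is in `SU(2)` if and only if it is an isometry which preserves `dt` and
commutes with `i` and `j` on `ℂ²`: this is the condition on the adapted frames of `(θ, J, I₋)`. -/
theorem isSU2Map_iff_adapted (h : W5 →ₗ[ℝ] W5) : IsSU2Map h ↔
    (∀ w w' : W5, (h w).1 * (h w').1 + stdInner (h w).2 (h w').2 =
      w.1 * w'.1 + stdInner w.2 w'.2) ∧
    (∀ w, (h w).1 = w.1) ∧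
    (∀ z, (h (0, Complex.I • z)).2 = Complex.I • (h (0, z)).2) ∧
    (∀ z, (h (0, quatJ z)).2 = quatJ (h (0, z)).2) := by
  constructor
  · rintro ⟨U, hU, hh⟩
    refine ⟨fun ⟨t, z⟩ ⟨t', z'⟩ => ?_, fun ⟨t, z⟩ => ?_, fun z => ?_, fun z => ?_⟩
    · simp only [hh, stdInner_mulVec hU]
    · rw [hh]
    · simp only [hh, Matrix.mulVec_smul]
    · simp only [hh, quatJ_mulVec hU]
  · rintro ⟨h1, h2, h3, h4⟩
    refine isSU2Map_of_compTwo h2 ?_ h3 h4 ?_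
    · have := h1 (1, 0) (1, 0)
      rw [h2] at this
      simp only [stdInner_eq 0 0] at this
      exact stdInner_self_eq_zero (by simpa using this)
    · have := h1 (0, stdE) (0, stdE)
      rw [h2] at this
      rw [stdInner_eq stdE stdE] at this
      rw [compTwo_apply]
      simpa [stdE] using this

theorem quatJ_I_smul (z : Fin 2 → ℂ) : quatJ (Complex.I • z) = -(Complex.I • quatJ z) := by
  ext i; fin_cases i <;> simp [quatJ]

theorem I_smul_I_smul (z : Fin 2 → ℂ) : Complex.I • Complex.I • z = -z := by
  rw [smul_smul, Complex.I_mul_I, neg_one_smul]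

theorem quatJ_quatJ (z : Fin 2 → ℂ) : quatJ (quatJ z) = -z := by
  ext i; fin_cases i <;> simp [quatJ]

theorem eq_of_stdInner_eq {z z' : Fin 2 → ℂ} (h : ∀ w, stdInner z w = stdInner z' w) :
    z = z' := by
  refine sub_eq_zero.1 (stdInner_self_eq_zero ?_)
  have := h (z - z')
  simp only [stdInner_eq, Pi.sub_apply, Complex.sub_re, Complex.sub_im] at this ⊢
  linarith

/-- A linear bijection of `ℝ ⊕ ℂ²` is in `SU(2)` if and only if it preserves `dt` and the three
standard 2-forms: the third form at `(z, w)` is the first at `(jz, w)` and minus the second at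
`(iz, w)`, so that a map which preserves the forms commutes with `i` and `j`, and then preserves
the inner product `ω₁(-iz, w)`. -/
theorem isSU2Map_iff_quadruplet (h : W5 →ₗ[ℝ] W5) (hsurj : Function.Surjective h) : IsSU2Map h ↔
    (∀ w, (h w).1 = w.1) ∧
    ∀ (k : Fin 3) (w w' : W5), stdTwoForm k (h w).2 (h w').2 = stdTwoForm k w.2 w'.2 := by
  constructor
  · rintro ⟨U, hU, hh⟩
    exact ⟨fun ⟨t, z⟩ => by rw [hh], fun k ⟨t, z⟩ ⟨t', z'⟩ => by
      simp only [hh, stdTwoForm_mulVec hU]⟩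
  · rintro ⟨h1, h2⟩
    have hs : ∀ w : Fin 2 → ℂ, ∃ w', (h w').2 = w := fun w => by
      obtain ⟨w', hw'⟩ := hsurj (0, w)
      exact ⟨w', by rw [hw']⟩
    -- `dt` and the kernel of the 2-forms: `h` preserves the line `ℝ`
    have h0 : (h (1, 0)).2 = 0 := by
      have : Complex.I • (h (1, 0)).2 = Complex.I • 0 := eq_of_stdInner_eq fun w => by
        obtain ⟨w', rfl⟩ := hs w
        have := h2 0 (1, 0) w'
        simpa [stdTwoForm, stdInner_eq 0] using this
      have := congrArg (fun z => Complex.I • z) this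
      simpa [I_smul_I_smul] using this
    have hs' : ∀ w : Fin 2 → ℂ, ∃ w', compTwo h w' = w := fun w => by
      obtain ⟨⟨t, z⟩, hw'⟩ := hs w
      refine ⟨z, ?_⟩
      have : ((t, z) : W5) = t • ((1, 0) : W5) + (0, z) := by ext <;> simp
      rw [this, map_add, map_smul, Prod.snd_add, Prod.smul_snd, h0] at hw'
      simpa [compTwo_apply] using hw'
    have f0 : ∀ z w, stdInner (Complex.I • compTwo h z) (compTwo h w) =
        stdInner (Complex.I • z) w :=
      fun z w => h2 0 (0, z) (0, w)
    have f1 : ∀ z w, stdInner (quatJ (compTwo h z)) (compTwo h w) = stdInner (quatJ z) w :=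
      fun z w => h2 1 (0, z) (0, w)
    have f2 : ∀ z w, stdInner (Complex.I • quatJ (compTwo h z)) (compTwo h w) =
        stdInner (Complex.I • quatJ z) w :=
      fun z w => h2 2 (0, z) (0, w)
    have nI : ∀ z : Fin 2 → ℂ, Complex.I • -z = -(Complex.I • z) := fun z => smul_neg _ _
    have nJ : ∀ z : Fin 2 → ℂ, quatJ (-z) = -quatJ z := fun z => by
      ext i; fin_cases i <;> simp [quatJ]
    -- comparing the first form at `jz` with the third form at `z`
    have hJ : ∀ z, compTwo h (quatJ z) = quatJ (compTwo h z) := fun z => by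
      have : Complex.I • compTwo h (quatJ z) = Complex.I • quatJ (compTwo h z) :=
        eq_of_stdInner_eq fun w => by
          obtain ⟨w', rfl⟩ := hs' w
          rw [f0, f2]
      have := congrArg (fun z => Complex.I • z) this
      simpa [I_smul_I_smul] using this
    -- comparing the second form at `iz` with the third form at `z`
    have hI : ∀ z, compTwo h (Complex.I • z) = Complex.I • compTwo h z := fun z => by
      have : quatJ (compTwo h (Complex.I • z)) = quatJ (Complex.I • compTwo h z) :=
        eq_of_stdInner_eq fun w => by
          obtain ⟨w', rfl⟩ := hs' w
          rw [f1, quatJ_I_smul, quatJ_I_smul]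
          have neg : ∀ a b : Fin 2 → ℂ, stdInner (-a) b = -stdInner a b := fun a b => by
            simp [stdInner_eq]; ring
          rw [neg, neg, f2]
      have := congrArg quatJ this
      simpa [quatJ_quatJ] using this
    refine isSU2Map_of_compTwo h1 h0 hI hJ ?_
    have := f0 (Complex.I • stdE) stdE
    rw [hI, I_smul_I_smul, I_smul_I_smul] at this
    simp only [stdInner_eq, Pi.neg_apply, Complex.neg_re, Complex.neg_im] at this ⊢
    simp [stdE] at this ⊢
    linarith

/-! ### The standard 2-forms -/

theorem wedgeTwoTwo_comm {V : Type*} (β η : V → V → ℝ) (x : Fin 4 → V) :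
    wedgeTwoTwo β η x = wedgeTwoTwo η β x := by
  simp only [wedgeTwoTwo]; ring

/-- The standard 2-forms satisfy `ωᵢ ∧ ωⱼ = δᵢⱼ ω₁²`. -/
theorem wedgeTwoTwo_stdTwoForm (i j : Fin 3) (x : Fin 4 → Fin 2 → ℂ) :
    wedgeTwoTwo (stdTwoForm i) (stdTwoForm j) x =
      if i = j then wedgeTwoTwo (stdTwoForm 0) (stdTwoForm 0) x else 0 := by
  have h01 : wedgeTwoTwo (stdTwoForm 0) (stdTwoForm 1) x = 0 := by
    simp only [wedgeTwoTwo, stdTwoForm_zero_eq, stdTwoForm_one_eq]; ring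
  have h02 : wedgeTwoTwo (stdTwoForm 0) (stdTwoForm 2) x = 0 := by
    simp only [wedgeTwoTwo, stdTwoForm_zero_eq, stdTwoForm_two_eq]; ring
  have h12 : wedgeTwoTwo (stdTwoForm 1) (stdTwoForm 2) x = 0 := by
    simp only [wedgeTwoTwo, stdTwoForm_one_eq, stdTwoForm_two_eq]; ring
  have h11 : wedgeTwoTwo (stdTwoForm 1) (stdTwoForm 1) x =
      wedgeTwoTwo (stdTwoForm 0) (stdTwoForm 0) x := by
    simp only [wedgeTwoTwo, stdTwoForm_one_eq, stdTwoForm_zero_eq]; ring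
  have h22 : wedgeTwoTwo (stdTwoForm 2) (stdTwoForm 2) x =
      wedgeTwoTwo (stdTwoForm 0) (stdTwoForm 0) x := by
    simp only [wedgeTwoTwo, stdTwoForm_two_eq, stdTwoForm_zero_eq]; ring
  fin_cases i <;> fin_cases j <;> simp only [Fin.zero_eta, Fin.mk_one, Fin.reduceFinMk] <;>
    simp [h01, h02, h12, h11, h22, wedgeTwoTwo_comm _ (stdTwoForm 0),
      wedgeTwoTwo_comm (stdTwoForm 2) (stdTwoForm 1)]

/-- The real basis of `ℝ ⊕ ℂ²`. -/
def stdBasis : Fin 5 → W5 :=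
  ![(1, 0), (0, ![1, 0]), (0, ![Complex.I, 0]), (0, ![0, 1]), (0, ![0, Complex.I])]

/-- `c dt ∧ ω₁²` does not vanish on the real basis if `c ≠ 0`. -/
theorem wedgeOneFour_stdBasis (c : ℝ) :
    wedgeOneFour (fun w : W5 => c * w.1)
      (wedgeTwoTwo (fun w w' : W5 => stdTwoForm 0 w.2 w'.2) (fun w w' => stdTwoForm 0 w.2 w'.2))
      stdBasis = c * 2 := by
  have h : ∀ k : Fin 4, (stdBasis k.succ).1 = 0 := fun k => by fin_cases k <;> rfl
  have h0 : (stdBasis 0).1 = 1 := rfl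
  rw [wedgeOneFour, Fin.sum_univ_succ]
  simp only [h, h0, Fin.zero_succAbove]
  simp [wedgeTwoTwo, stdTwoForm_zero_eq, stdBasis]
  norm_num

/-- If `X ⌟ ω₁ = Y ⌟ ω₂` then `Y = ij X` up to the line `ℝ`, whence `ω₃(X, Y) = |Y|²`. -/
theorem stdTwoForm_nonneg {z w : Fin 2 → ℂ} (h : ∀ x, stdTwoForm 0 z x = stdTwoForm 1 w x) :
    0 ≤ stdTwoForm 2 z w := by
  have h1 : Complex.I • z = quatJ w := eq_of_stdInner_eq h
  have e0 := congrFun h1 0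
  have e1 := congrFun h1 1
  have a0 := congrArg Complex.re e0
  have a1 := congrArg Complex.im e0
  have a2 := congrArg Complex.re e1
  have a3 := congrArg Complex.im e1
  simp [quatJ] at a0 a1 a2 a3
  rw [stdTwoForm_two_eq, a1, a3, ← a2, ← a0]
  nlinarith [sq_nonneg (z 1).im, sq_nonneg (w 1).im, sq_nonneg (w 0).im, sq_nonneg (z 0).im]

/-! ### The cross product in an oriented orthonormal basis -/

section Cross

variable {V : Type*} [NormedAddCommGroup V] [InnerProductSpace ℝ V]
  [Fact (Module.finrank ℝ V = 3)] [FiniteDimensional ℝ V]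

theorem cross_smul_left (o : Orientation ℝ V (Fin 3)) (s : ℝ) (a b : V) :
    cross o (s • a) b = s • cross o a b := by
  refine ext_inner_right ℝ fun c => ?_
  have h (y : V) : Function.update ![a, b, c] 0 y = ![y, b, c] := by
    ext i; fin_cases i <;> rfl
  have := o.volumeForm.map_update_smul ![a, b, c] 0 s a
  rw [h, h] at this
  rw [inner_smul_left, inner_cross, inner_cross, this]
  rfl

/-- `a₀ × ·` is the rotation `a₁ ↦ a₂ ↦ -a₁` of the plane `a₀^⊥`. -/
theorem cross_orthonormalBasis {o : Orientation ℝ V (Fin 3)} (a : OrthonormalBasis (Fin 3) ℝ V)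
    (ha : a.toBasis.orientation = o) :
    cross o (a 0) (a 0) = 0 ∧ cross o (a 0) (a 1) = a 2 ∧ cross o (a 0) (a 2) = -a 1 := by
  have hdet (i j k : Fin 3) : o.volumeForm ![a i, a j, a k] =
      Matrix.det (.of fun l m : Fin 3 => if l = ![i, j, k] m then (1 : ℝ) else 0) := by
    rw [o.volumeForm_robust a ha, Module.Basis.det_apply]
    congr 1
    ext l m
    have : (![a i, a j, a k] : Fin 3 → V) m = a (![i, j, k] m) := by fin_cases m <;> rfl
    rw [Module.Basis.toMatrix_apply, this]
    simp
  refine ⟨?_, ?_, ?_⟩ <;> refine InnerProductSpace.ext_inner_right_basis a.toBasis fun i => ?_ <;>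
    rw [OrthonormalBasis.coe_toBasis, inner_cross, hdet] <;> fin_cases i <;>
    simp [Matrix.det_fin_three, inner_neg_left, a.inner_eq_ite]

theorem exists_oriented_orthonormalBasis (o : Orientation ℝ V (Fin 3)) {s : ℝ} (hs : 0 < s)
    {u : V} (hu : ‖u‖ = s) :
    ∃ a : OrthonormalBasis (Fin 3) ℝ V, a.toBasis.orientation = o ∧ u = s • a 0 := by
  have h1 : ‖s⁻¹ • u‖ = 1 := by
    rw [norm_smul, hu, norm_inv, Real.norm_of_nonneg hs.le, inv_mul_cancel₀ hs.ne']
  obtain ⟨b, hb⟩ := Orthonormal.exists_orthonormalBasis_extension_of_card_eq (𝕜 := ℝ)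
    (ι := Fin 3) (by simpa using (Fact.out : Module.finrank ℝ V = 3))
    (v := fun _ => s⁻¹ • u) (s := {0}) (by
      constructor
      · rintro ⟨i, hi⟩; simpa using h1
      · rintro ⟨i, hi⟩ ⟨j, hj⟩ hij
        exact absurd (Subtype.ext (hi.trans hj.symm)) hij)
  have hu0 : u = s • b 0 := by rw [hb 0 rfl, smul_smul, mul_inv_cancel₀ hs.ne', one_smul]
  rcases b.toBasis.orientation_eq_or_eq_neg o with h | h
  · exact ⟨b, h.symm, hu0⟩
  -- otherwise the last vector is to be replaced by its opposite
  · let w : Fin 3 → ℝˣ := ![1, 1, -1]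
    have hw : ∀ i, (w i : ℝ) = 1 ∨ (w i : ℝ) = -1 := fun i => by fin_cases i <;> simp [w]
    have horth : Orthonormal ℝ (b.toBasis.unitsSMul w) := by
      rw [orthonormal_iff_ite]
      intro i j
      simp only [Module.Basis.unitsSMul_apply, OrthonormalBasis.coe_toBasis, Units.smul_def,
        inner_smul_left, inner_smul_right, b.inner_eq_ite]
      rcases eq_or_ne i j with rfl | hij
      · rcases hw i with hi | hi <;> simp [hi]
      · simp [hij]
    refine ⟨(b.toBasis.unitsSMul w).toOrthonormalBasis horth, ?_, ?_⟩
    · rw [Module.Basis.toBasis_toOrthonormalBasis, Module.Basis.orientation_unitsSMul, h]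
      have : ∏ i, w i = -1 := by simp [w, Fin.prod_univ_three]
      rw [this]; simp
    · rw [Module.Basis.coe_toOrthonormalBasis, Module.Basis.unitsSMul_apply]
      simpa [w] using hu0

end Cross

section Coordinates

variable {M : Type*} [TopologicalSpace M] [ChartedSpace E3 M] [IsManifold (𝓡 3) ∞ M]

/-! ### Coordinate vector fields -/

/-- The trivialization of `TM` over the chart at `x₀`. -/
abbrev tangentTriv (x₀ : M) : Trivialization E3 (π E3 (TangentSpace (𝓡 3) : M → Type _)) :=
  trivializationAt E3 (TangentSpace (𝓡 3) : M → Type _) x₀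

/-- The vector field which is the constant `w` in the chart at `x₀` (and zero outside). -/
def coordField (x₀ : M) (w : E3) (x : M) : TangentSpace (𝓡 3) x :=
  (tangentTriv x₀).symmL ℝ x w

variable {x₀ x : M}

theorem tangentTriv_coordField (hx : x ∈ (chartAt E3 x₀).source) (w : E3) :
    (tangentTriv x₀ ⟨x, coordField x₀ w x⟩).2 = w := by
  rw [← Trivialization.continuousLinearMapAt_apply_of_mem (R := ℝ) (tangentTriv x₀) hx]
  exact Trivialization.continuousLinearMapAt_symmL _ hx w

theorem coordField_tangentTriv (hx : x ∈ (chartAt E3 x₀).source) (v : TangentSpace (𝓡 3) x) :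
    coordField x₀ (tangentTriv x₀ ⟨x, v⟩).2 x = v := by
  rw [← Trivialization.continuousLinearMapAt_apply_of_mem (R := ℝ) (tangentTriv x₀) hx]
  exact Trivialization.symmL_continuousLinearMapAt _ hx v

theorem extend_eventuallyEq_coordField (v : TangentSpace (𝓡 3) x) :
    ∀ᶠ y in 𝓝 x, (FiberBundle.extend E3 v y : TangentSpace (𝓡 3) y) =
      coordField x (tangentTriv x ⟨x, v⟩).2 y := by
  filter_upwards [(chartAt E3 x).open_source.mem_nhds (mem_chart_source E3 x)] with y hy
  exact (Trivialization.symmL_apply _ hy _).symm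

theorem contMDiffOn_coordField (x₀ : M) (w : E3) :
    ContMDiffOn (𝓡 3) (𝓡 3).tangent ∞
      (fun x => (⟨x, coordField x₀ w x⟩ : TangentBundle (𝓡 3) M)) (chartAt E3 x₀).source := by
  have := ((tangentTriv x₀).contMDiffOn_section_baseSet_iff (IB := 𝓡 3) (n := ∞)
    (s := coordField x₀ w)).2 ((contMDiffOn_const (c := w)).congr fun x hx =>
      tangentTriv_coordField hx w)
  exact this

theorem mdifferentiableAt_coordField (hx : x ∈ (chartAt E3 x₀).source) (w : E3) :
    MDifferentiableAt (𝓡 3) (𝓡 3).tangent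
      (fun x => (⟨x, coordField x₀ w x⟩ : TangentBundle (𝓡 3) M)) x :=
  ((contMDiffOn_coordField x₀ w).contMDiffAt
    ((chartAt E3 x₀).open_source.mem_nhds hx)).mdifferentiableAt (by simp)

/-- Coordinate vector fields commute: they are pulled back from constant vector fields. -/
theorem mlieBracket_coordField (hx : x ∈ (chartAt E3 x₀).source) (a b : E3) :
    VectorField.mlieBracket (𝓡 3) (coordField x₀ a) (coordField x₀ b) x = 0 := by
  let c (a : E3) (y : E3) : TangentSpace 𝓘(ℝ, E3) y := (NormedSpace.fromTangentSpace y).symm a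
  have hc (a : E3) (y : E3) : MDifferentiableAt 𝓘(ℝ, E3) 𝓘(ℝ, E3).tangent
      (fun y => (⟨y, c a y⟩ : TangentBundle 𝓘(ℝ, E3) E3)) y :=
    ((contMDiffAt_vectorSpace_iff_contDiffAt (n := 1) (V := c a)).2
      (contDiffAt_const (c := a))).mdifferentiableAt (by simp)
  -- coordinate vector fields are pullbacks by the chart of constant vector fields
  have key (a : E3) : coordField x₀ a =ᶠ[𝓝 x] VectorField.mpullback (𝓡 3) 𝓘(ℝ, E3)
      (extChartAt (𝓡 3) x₀) (c a) := by
    filter_upwards [(chartAt E3 x₀).open_source.mem_nhds hx] with y hy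
    have h1 := (tangentTriv x₀).coe_continuousLinearEquivAt_eq' (R := ℝ) hy
    have h2 := (tangentTriv x₀).symm_continuousLinearEquivAt_eq' (R := ℝ) hy
    have h3 : mfderiv (𝓡 3) 𝓘(ℝ, E3) (extChartAt (𝓡 3) x₀) y =
        ((tangentTriv x₀).continuousLinearEquivAt ℝ y hy : TangentSpace (𝓡 3) y →L[ℝ] E3) := by
      rw [h1]
      exact (TangentBundle.continuousLinearMapAt_trivializationAt hy).symm
    have h4 : ((mfderiv (𝓡 3) 𝓘(ℝ, E3) (extChartAt (𝓡 3) x₀) y).inverse :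
        E3 →L[ℝ] TangentSpace (𝓡 3) y) = (tangentTriv x₀).symmL ℝ y := by
      rw [← h2, ← ContinuousLinearMap.inverse_equiv]
      exact congrArg ContinuousLinearMap.inverse h3
    exact (DFunLike.congr_fun h4 a).symm
  have : IsManifold (𝓡 3) (minSmoothness ℝ 2) M := by
    rw [minSmoothness_of_isRCLikeNormedField]; infer_instance
  rw [(key a).mlieBracket_vectorField_eq (key b),
    ← VectorField.mpullback_mlieBracket (n := ∞) (hc a _) (hc b _) (contMDiffAt_extChartAt' hx)
      (by rw [minSmoothness_of_isRCLikeNormedField]; exact ENat.LEInfty.out)]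
  have : VectorField.mlieBracket 𝓘(ℝ, E3) (c a) (c b) = 0 := by
    ext1 y
    rw [← VectorField.mlieBracketWithin_univ, VectorField.mlieBracketWithin_eq_lieBracketWithin]
    have h (a : E3) : fderivWithin ℝ (fun _ : E3 => a) Set.univ y = 0 := by simp
    change fderivWithin ℝ (fun _ : E3 => b) Set.univ y a -
      fderivWithin ℝ (fun _ : E3 => a) Set.univ y b = (0 : E3)
    rw [h, h]
    exact sub_self _
  rw [this, VectorField.mpullback_zero]
  rfl

end Coordinates

section Metric

-- Shortcuts for instances whose search is slow in the presence of a Riemannian bundle.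

instance normedAddCommGroupBilinForm : NormedAddCommGroup (E3 →L[ℝ] E3 →L[ℝ] ℝ) := inferInstance
instance normedSpaceBilinForm : NormedSpace ℝ (E3 →L[ℝ] E3 →L[ℝ] ℝ) := inferInstance
instance addCommGroupBilinForm : AddCommGroup (E3 →L[ℝ] E3 →L[ℝ] ℝ) := inferInstance
instance normedAddCommGroupTrilinForm : NormedAddCommGroup (E3 →L[ℝ] E3 →L[ℝ] E3 →L[ℝ] ℝ) :=
  inferInstance
instance normedSpaceTrilinForm : NormedSpace ℝ (E3 →L[ℝ] E3 →L[ℝ] E3 →L[ℝ] ℝ) := inferInstance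

variable {M : Type*} [TopologicalSpace M] [ChartedSpace E3 M] [IsManifold (𝓡 3) ∞ M]
  {x₀ x : M}

theorem mfderiv_extChartAt_apply (hx : x ∈ (chartAt E3 x₀).source) (X : TangentSpace (𝓡 3) x) :
    mfderiv (𝓡 3) 𝓘(ℝ, E3) (extChartAt (𝓡 3) x₀) x X = (tangentTriv x₀ ⟨x, X⟩).2 := by
  rw [← Trivialization.continuousLinearMapAt_apply_of_mem (R := ℝ) (tangentTriv x₀) hx]
  exact (DFunLike.congr_fun (TangentBundle.continuousLinearMapAt_trivializationAt hx) X).symm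

theorem mfderiv_extChartAt_coordField (hx : x ∈ (chartAt E3 x₀).source) (w : E3) :
    mfderiv (𝓡 3) 𝓘(ℝ, E3) (extChartAt (𝓡 3) x₀) x (coordField x₀ w x) = w :=
  (mfderiv_extChartAt_apply hx _).trans (tangentTriv_coordField hx w)

omit [IsManifold (𝓡 3) ∞ M] in
theorem extChartAt_mem_target' (hx : x ∈ (chartAt E3 x₀).source) :
    extChartAt (𝓡 3) x₀ x ∈ (extChartAt (𝓡 3) x₀).target :=
  (extChartAt (𝓡 3) x₀).map_source (by rwa [extChartAt_source])

variable [RiemannianBundle (fun x : M => TangentSpace (𝓡 3) x)]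

/-! ### The metric in coordinates -/

/-- The Riemannian metric in the chart at `x₀`. -/
def metricCoord (x₀ : M) (y : E3) : E3 →L[ℝ] E3 →L[ℝ] ℝ :=
  let x : M := (extChartAt (𝓡 3) x₀).symm y
  let g : TangentSpace (𝓡 3) x →L[ℝ] TangentSpace (𝓡 3) x →L[ℝ] ℝ := innerSL ℝ
  let e : E3 →L[ℝ] TangentSpace (𝓡 3) x := (tangentTriv x₀).symmL ℝ x
  e.precomp ℝ ∘L g ∘L e

theorem metricCoord_apply (x₀ : M) (y v w : E3) : metricCoord x₀ y v w =
    inner ℝ (coordField x₀ v ((extChartAt (𝓡 3) x₀).symm y))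
      (coordField x₀ w ((extChartAt (𝓡 3) x₀).symm y)) := rfl

theorem metricCoord_extChartAt (hx : x ∈ (chartAt E3 x₀).source) (v w : E3) :
    metricCoord x₀ (extChartAt (𝓡 3) x₀ x) v w =
      inner ℝ (coordField x₀ v x) (coordField x₀ w x) := by
  rw [metricCoord_apply, (extChartAt (𝓡 3) x₀).left_inv (by rwa [extChartAt_source])]

theorem metricCoord_tangentTriv (hx : x ∈ (chartAt E3 x₀).source) (X Y : TangentSpace (𝓡 3) x) :
    metricCoord x₀ (extChartAt (𝓡 3) x₀ x) (tangentTriv x₀ ⟨x, X⟩).2 (tangentTriv x₀ ⟨x, Y⟩).2 =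
      inner ℝ X Y := by
  rw [metricCoord_extChartAt hx, coordField_tangentTriv hx, coordField_tangentTriv hx]

theorem metricCoord_symm (x₀ : M) (y v w : E3) :
    metricCoord x₀ y v w = metricCoord x₀ y w v := by
  rw [metricCoord_apply, metricCoord_apply, real_inner_comm]

variable [IsContMDiffRiemannianBundle (𝓡 3) ∞ E3 (fun x : M => TangentSpace (𝓡 3) x)]

theorem contDiffOn_metricCoord (x₀ : M) :
    ContDiffOn ℝ ∞ (metricCoord x₀) (extChartAt (𝓡 3) x₀).target := by
  refine contDiffOn_clm_apply.2 fun v => contDiffOn_clm_apply.2 fun w => ?_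
  have h := (contMDiffOn_coordField x₀ v).inner_bundle (contMDiffOn_coordField x₀ w)
  rw [← contMDiffOn_iff_contDiffOn]
  refine h.comp (contMDiffOn_extChartAt_symm x₀) fun y hy => ?_
  have := (extChartAt (𝓡 3) x₀).map_target hy
  rwa [extChartAt_source] at this

theorem contDiffAt_metricCoord (hx : x ∈ (chartAt E3 x₀).source) :
    ContDiffAt ℝ ∞ (metricCoord x₀) (extChartAt (𝓡 3) x₀ x) :=
  (contDiffOn_metricCoord x₀).contDiffAt
    ((isOpen_extChartAt_target x₀).mem_nhds (extChartAt_mem_target' hx))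

/-- The directional derivatives of the metric in the chart at `x₀`. -/
def derivMetricCoord (x₀ : M) (y : E3) : E3 →L[ℝ] E3 →L[ℝ] E3 →L[ℝ] ℝ :=
  fderiv ℝ (metricCoord x₀) y

theorem hasFDerivAt_metricCoord_apply (hx : x ∈ (chartAt E3 x₀).source) (v w : E3) :
    HasFDerivAt (fun y => metricCoord x₀ y v w)
      (ContinuousLinearMap.apply ℝ ℝ w ∘L ContinuousLinearMap.apply ℝ (E3 →L[ℝ] ℝ) v ∘L
        derivMetricCoord x₀ (extChartAt (𝓡 3) x₀ x))
      (extChartAt (𝓡 3) x₀ x) := by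
  have h := ((contDiffAt_metricCoord hx).differentiableAt (by simp)).hasFDerivAt
  exact (ContinuousLinearMap.apply ℝ ℝ w ∘L
    ContinuousLinearMap.apply ℝ (E3 →L[ℝ] ℝ) v).hasFDerivAt.comp _ h

theorem derivMetricCoord_symm (hx : x ∈ (chartAt E3 x₀).source) (a v w : E3) :
    derivMetricCoord x₀ (extChartAt (𝓡 3) x₀ x) a v w =
      derivMetricCoord x₀ (extChartAt (𝓡 3) x₀ x) a w v := by
  have h1 := hasFDerivAt_metricCoord_apply hx v w
  have h2 := hasFDerivAt_metricCoord_apply hx w v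
  simp only [metricCoord_symm x₀ _ w v] at h2
  exact DFunLike.congr_fun (h1.unique h2) a

theorem mvfderiv_inner_coordField (hx : x ∈ (chartAt E3 x₀).source) (a v w : E3) :
    mvfderiv (𝓡 3) (fun y => inner ℝ (coordField x₀ v y) (coordField x₀ w y)) x
      (coordField x₀ a x) = derivMetricCoord x₀ (extChartAt (𝓡 3) x₀ x) a v w := by
  have h1 := (hasFDerivAt_metricCoord_apply hx v w).hasMFDerivAt.comp x
    (mdifferentiableAt_extChartAt hx).hasMFDerivAt
  have h2 := h1.congr_of_eventuallyEq (f₁ := fun y => inner ℝ (coordField x₀ v y)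
    (coordField x₀ w y)) (by
      filter_upwards [(chartAt E3 x₀).open_source.mem_nhds hx] with y hy
      exact (metricCoord_extChartAt hy v w).symm)
  have h3 : mfderiv (𝓡 3) 𝓘(ℝ, ℝ) (fun y => inner ℝ (coordField x₀ v y) (coordField x₀ w y)) x
      (coordField x₀ a x) = derivMetricCoord x₀ (extChartAt (𝓡 3) x₀ x) a v w := by
    rw [h2.mfderiv]
    refine Eq.trans ?_ (congrArg (fun b => derivMetricCoord x₀ (extChartAt (𝓡 3) x₀ x) b v w)
      (mfderiv_extChartAt_coordField hx a))
    rfl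
  exact h3

/-! ### The Levi-Civita connection in coordinates -/

/-- The Christoffel symbol of the first kind `⟪∇_a v, c⟫` for the constant vector fields `a`, `v`,
`c` in the chart at `x₀`, from Koszul's formula. -/
def christoffel (x₀ : M) (y a v c : E3) : ℝ :=
  (derivMetricCoord x₀ y a v c + derivMetricCoord x₀ y v a c - derivMetricCoord x₀ y c a v) / 2

theorem christoffel_symm (hx : x ∈ (chartAt E3 x₀).source) (a v c : E3) :
    christoffel x₀ (extChartAt (𝓡 3) x₀ x) a v c =
      christoffel x₀ (extChartAt (𝓡 3) x₀ x) v a c := by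
  rw [christoffel, christoffel, derivMetricCoord_symm hx c a v]; ring

theorem christoffel_add_christoffel (hx : x ∈ (chartAt E3 x₀).source) (a v w : E3) :
    christoffel x₀ (extChartAt (𝓡 3) x₀ x) a v w + christoffel x₀ (extChartAt (𝓡 3) x₀ x) a w v =
      derivMetricCoord x₀ (extChartAt (𝓡 3) x₀ x) a v w := by
  rw [christoffel, christoffel, derivMetricCoord_symm hx a w v, derivMetricCoord_symm hx w a v,
    derivMetricCoord_symm hx v a w]
  ring

variable {nabla : CovariantDerivative (𝓡 3) E3 (TangentSpace (𝓡 3) : M → Type _)}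

/-- Koszul's formula for coordinate vector fields, whose brackets vanish. -/
theorem IsLeviCivita.inner_coordField (hn : IsLeviCivita nabla)
    (hx : x ∈ (chartAt E3 x₀).source) (a v c : E3) :
    inner ℝ (nabla (coordField x₀ v) x (coordField x₀ a x)) (coordField x₀ c x) =
      christoffel x₀ (extChartAt (𝓡 3) x₀ x) a v c := by
  have hm (a v c : E3) : derivMetricCoord x₀ (extChartAt (𝓡 3) x₀ x) a v c =
      inner ℝ (nabla (coordField x₀ v) x (coordField x₀ a x)) (coordField x₀ c x) +
      inner ℝ (coordField x₀ v x) (nabla (coordField x₀ c) x (coordField x₀ a x)) := by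
    rw [← mvfderiv_inner_coordField hx a v c]
    exact hn.metric.mvfderiv_inner_eq (coordField x₀ a) (mdifferentiableAt_coordField hx v)
      (mdifferentiableAt_coordField hx c)
  have ht (a v : E3) : nabla (coordField x₀ v) x (coordField x₀ a x) =
      nabla (coordField x₀ a) x (coordField x₀ v x) := by
    have := nabla.torsion_eq_zero_iff.1 hn.torsion_free (mdifferentiableAt_coordField hx a)
      (mdifferentiableAt_coordField hx v)
    rw [mlieBracket_coordField hx] at this
    exact sub_eq_zero.1 this
  rw [christoffel, hm a v c, hm v a c, hm c a v, ht v a, ht c a, ht c v,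
    real_inner_comm _ (coordField x₀ v x), real_inner_comm _ (coordField x₀ a x)]
  ring

end Metric

theorem HasMFDerivAt.prodMk_space {E H M F G : Type*} [NormedAddCommGroup E] [NormedSpace ℝ E]
    [TopologicalSpace H] {I : ModelWithCorners ℝ E H} [TopologicalSpace M] [ChartedSpace H M]
    [NormedAddCommGroup F] [NormedSpace ℝ F] [NormedAddCommGroup G] [NormedSpace ℝ G]
    {f : M → F} {g : M → G} {x : M} {f' : TangentSpace I x →L[ℝ] TangentSpace 𝓘(ℝ, F) (f x)}
    {g' : TangentSpace I x →L[ℝ] TangentSpace 𝓘(ℝ, G) (g x)}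
    (hf : HasMFDerivAt I 𝓘(ℝ, F) f x f') (hg : HasMFDerivAt I 𝓘(ℝ, G) g x g') :
    HasMFDerivAt I 𝓘(ℝ, F × G) (fun y => (f y, g y)) x (f'.prod g') :=
  ⟨hf.1.prodMk hg.1, hf.2.prodMk hg.2⟩

section Flat

variable {M : Type*} [TopologicalSpace M] [ChartedSpace E3 M] [IsManifold (𝓡 3) ∞ M]
  {x₀ x : M}

/-! ### Connections and the connection map in coordinates -/

/-- The flat connection of the chart at `x₀`, for which the coordinate vector fields are
parallel. -/
def flatCov (x₀ : M) (σ : ∀ x : M, TangentSpace (𝓡 3) x) (x : M) :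
    TangentSpace (𝓡 3) x →L[ℝ] TangentSpace (𝓡 3) x :=
  (tangentTriv x₀).symmL ℝ x ∘L mvfderiv (𝓡 3) (fun y => (tangentTriv x₀ ⟨y, σ y⟩).2) x

theorem tangentTriv_snd_eq (hx : x ∈ (chartAt E3 x₀).source) (X : TangentSpace (𝓡 3) x) :
    (tangentTriv x₀ ⟨x, X⟩).2 = (tangentTriv x₀).continuousLinearMapAt ℝ x X :=
  (Trivialization.continuousLinearMapAt_apply_of_mem (R := ℝ) (tangentTriv x₀) hx X).symm

theorem mdifferentiableAt_tangentTriv_section (hx : x ∈ (chartAt E3 x₀).source)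
    {σ : ∀ x : M, TangentSpace (𝓡 3) x} (hσ : MDifferentiableAt (𝓡 3) (𝓡 3).tangent
      (fun x => (⟨x, σ x⟩ : TangentBundle (𝓡 3) M)) x) :
    MDifferentiableAt (𝓡 3) 𝓘(ℝ, E3) (fun y => (tangentTriv x₀ ⟨y, σ y⟩).2) x :=
  ((tangentTriv x₀).mdifferentiableAt_section_iff (IB := 𝓡 3) (s := σ) hx).1 hσ

omit [IsManifold (𝓡 3) ∞ M] in
theorem Filter.EventuallyEq.mvfderiv_eq {f g : M → E3} (h : f =ᶠ[𝓝 x] g) :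
    mvfderiv (𝓡 3) f x = mvfderiv (𝓡 3) g x :=
  ContinuousLinearMap.ext fun X => DFunLike.congr_fun h.mfderiv_eq X

theorem flatCov_isCovariantDerivativeOn (x₀ : M) :
    IsCovariantDerivativeOn E3 (flatCov x₀) (chartAt E3 x₀).source where
  add {σ σ' x} hσ hσ' hx := by
    have h : (fun y => (tangentTriv x₀ ⟨y, (σ + σ') y⟩).2) =ᶠ[𝓝 x]
        fun y => (tangentTriv x₀ ⟨y, σ y⟩).2 + (tangentTriv x₀ ⟨y, σ' y⟩).2 := by
      filter_upwards [(chartAt E3 x₀).open_source.mem_nhds hx] with y hy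
      rw [tangentTriv_snd_eq hy, tangentTriv_snd_eq hy, tangentTriv_snd_eq hy, Pi.add_apply,
        map_add]
    have h2 : mvfderiv (𝓡 3) (fun y => (tangentTriv x₀ ⟨y, (σ + σ') y⟩).2) x =
        mvfderiv (𝓡 3) (fun y => (tangentTriv x₀ ⟨y, σ y⟩).2) x +
        mvfderiv (𝓡 3) (fun y => (tangentTriv x₀ ⟨y, σ' y⟩).2) x := by
      rw [← mvfderiv_add (mdifferentiableAt_tangentTriv_section hx hσ)
        (mdifferentiableAt_tangentTriv_section hx hσ')]
      exact h.mvfderiv_eq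
    rw [flatCov, h2, ContinuousLinearMap.comp_add]
    rfl
  leibniz {σ g x} hσ hg hx := by
    have h : (fun y => (tangentTriv x₀ ⟨y, (g • σ) y⟩).2) =ᶠ[𝓝 x]
        g • fun y => (tangentTriv x₀ ⟨y, σ y⟩).2 := by
      filter_upwards [(chartAt E3 x₀).open_source.mem_nhds hx] with y hy
      rw [tangentTriv_snd_eq hy, Pi.smul_apply', Pi.smul_apply', map_smul, tangentTriv_snd_eq hy]
    have h2 : mvfderiv (𝓡 3) (fun y => (tangentTriv x₀ ⟨y, (g • σ) y⟩).2) x =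
        mvfderiv (𝓡 3) (g • fun y => (tangentTriv x₀ ⟨y, σ y⟩).2) x := h.mvfderiv_eq
    have h3 : (tangentTriv x₀).symmL ℝ x (tangentTriv x₀ ⟨x, σ x⟩).2 = σ x :=
      coordField_tangentTriv hx (σ x)
    rw [flatCov, h2, mvfderiv_smul hg (mdifferentiableAt_tangentTriv_section hx hσ)]
    ext X
    simp [flatCov, h3]

theorem flatCov_coordField (hx : x ∈ (chartAt E3 x₀).source) (v : E3) :
    flatCov x₀ (coordField x₀ v) x = 0 := by
  have h : (fun y => (tangentTriv x₀ ⟨y, coordField x₀ v y⟩).2) =ᶠ[𝓝 x] fun _ => v := by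
    filter_upwards [(chartAt E3 x₀).open_source.mem_nhds hx] with y hy
    exact tangentTriv_coordField hy v
  have h2 : mvfderiv (𝓡 3) (fun y => (tangentTriv x₀ ⟨y, coordField x₀ v y⟩).2) x = 0 :=
    h.mvfderiv_eq.trans (mvfderiv_const v)
  rw [flatCov, h2, ContinuousLinearMap.comp_zero]

variable (nabla : CovariantDerivative (𝓡 3) E3 (TangentSpace (𝓡 3) : M → Type _))

/-- A connection is the flat connection of a chart plus a tensor, which is read off from the
derivatives of the coordinate vector fields. -/
theorem CovariantDerivative.eq_flatCov_add (hx : x ∈ (chartAt E3 x₀).source)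
    {σ : ∀ x : M, TangentSpace (𝓡 3) x} (hσ : MDifferentiableAt (𝓡 3) (𝓡 3).tangent
      (fun x => (⟨x, σ x⟩ : TangentBundle (𝓡 3) M)) x) :
    nabla σ x = flatCov x₀ σ x + nabla (coordField x₀ (tangentTriv x₀ ⟨x, σ x⟩).2) x := by
  have hn : IsCovariantDerivativeOn E3 nabla (chartAt E3 x₀).source := nabla.isCovariantDerivativeOn
  have h1 := IsCovariantDerivativeOn.difference_apply hn (flatCov_isCovariantDerivativeOn x₀) hx hσ
  have h2 := IsCovariantDerivativeOn.difference_apply hn (flatCov_isCovariantDerivativeOn x₀) hx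
    (mdifferentiableAt_coordField hx (tangentTriv x₀ ⟨x, σ x⟩).2)
  rw [coordField_tangentTriv hx, h1, flatCov_coordField hx, sub_zero] at h2
  rw [← h2, add_sub_cancel]

theorem CovariantDerivative.extend_eq_coordField (v : TangentSpace (𝓡 3) x) :
    nabla (FiberBundle.extend E3 v) x = nabla (coordField x (tangentTriv x ⟨x, v⟩).2) x :=
  nabla.isCovariantDerivativeOnUniv.congr_of_eventuallyEq
    (FiberBundle.mdifferentiableAt_extend _ _ v)
    (mdifferentiableAt_coordField (mem_chart_source E3 x) _) Filter.univ_mem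
    (extend_eventuallyEq_coordField v)

/-- The derivative of the fibre component of `TM` in the chart at `x₀`. -/
def fiberDeriv (x₀ : M) (u : TangentBundle (𝓡 3) M) : TangentSpace (𝓡 3).tangent u →L[ℝ] E3 :=
  mvfderiv (𝓡 3).tangent (fun p : TangentBundle (𝓡 3) M => (tangentTriv x₀ p).2) u

theorem hasMFDerivAt_proj (u : TangentBundle (𝓡 3) M) :
    HasMFDerivAt (𝓡 3).tangent (𝓡 3) (fun p : TangentBundle (𝓡 3) M => p.proj) u (projDeriv u) :=
  (((contMDiff_proj (n := 1) (IB := 𝓡 3) (F := E3)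
      (TangentSpace (𝓡 3) : M → Type _)).mdifferentiable one_ne_zero) u).hasMFDerivAt

theorem contMDiffOn_tangentTriv_snd (x₀ : M) :
    ContMDiffOn (𝓡 3).tangent 𝓘(ℝ, E3) ∞ (fun p : TangentBundle (𝓡 3) M => (tangentTriv x₀ p).2)
      (tangentTriv x₀).source :=
  contMDiff_snd.comp_contMDiffOn (Trivialization.contMDiffOn (IB := 𝓡 3) (n := ∞) (tangentTriv x₀))

theorem hasMFDerivAt_tangentTriv_snd {u : TangentBundle (𝓡 3) M}
    (hu : u.proj ∈ (chartAt E3 x₀).source) :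
    HasMFDerivAt (𝓡 3).tangent 𝓘(ℝ, E3) (fun p : TangentBundle (𝓡 3) M => (tangentTriv x₀ p).2) u
      (fiberDeriv x₀ u) := by
  have hu' : u ∈ (tangentTriv x₀).source := (tangentTriv x₀).mem_source.2 hu
  exact (((contMDiffOn_tangentTriv_snd x₀).contMDiffAt
    ((tangentTriv x₀).open_source.mem_nhds hu')).mdifferentiableAt (by simp)).hasMFDerivAt

/-- The connection map in the chart at a point `x₀` other than the base point: it does not depend
on the trivialization which is used to define it. -/
theorem connMap_eq {u : TangentBundle (𝓡 3) M} (hu : u.proj ∈ (chartAt E3 x₀).source)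
    (X : TangentSpace (𝓡 3).tangent u) :
    connMap nabla u X = coordField x₀ (fiberDeriv x₀ u X) u.proj +
      nabla (coordField x₀ (tangentTriv x₀ u).2) u.proj (projDeriv u X) := by
  obtain ⟨x, w⟩ := u
  have hx : x ∈ (chartAt E3 x₀).source := hu
  have hxx : x ∈ (chartAt E3 x).source := mem_chart_source E3 x
  set v := (tangentTriv x₀ ⟨x, w⟩).2 with hv
  -- the transition function of the trivializations
  let c (y : M) : E3 →L[ℝ] E3 := (tangentTriv x₀).coordChangeL ℝ (tangentTriv x) y
  have hc : MDifferentiableAt (𝓡 3) 𝓘(ℝ, E3 →L[ℝ] E3) c x :=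
    mdifferentiableAt_coordChangeL (IB := 𝓡 3) hx hxx
  have hcapp {y : M} (h0 : y ∈ (chartAt E3 x₀).source) (h1 : y ∈ (chartAt E3 x).source) (b : E3) :
      c y b = (tangentTriv x ⟨y, coordField x₀ b y⟩).2 := by
    refine ((tangentTriv x₀).coordChangeL_apply _ ⟨h0, h1⟩ b).trans ?_
    rw [← Trivialization.symmL_apply (R := ℝ) _ h0]
    rfl
  have happ (q : (E3 →L[ℝ] E3) × E3) := (isBoundedBilinearMap_apply (𝕜 := ℝ) (E := E3)
    (F := E3)).hasFDerivAt q
  have h1 : mvfderiv (𝓡 3).tangent (fun p : TangentBundle (𝓡 3) M => (tangentTriv x p).2) ⟨x, w⟩ X =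
      c x (fiberDeriv x₀ ⟨x, w⟩ X) + mvfderiv (𝓡 3) c x (projDeriv ⟨x, w⟩ X) v := by
    have hp := HasMFDerivAt.prodMk_space
      (HasMFDerivAt.comp (⟨x, w⟩ : TangentBundle (𝓡 3) M) (g := c) hc.hasMFDerivAt
        (hasMFDerivAt_proj _)) (hasMFDerivAt_tangentTriv_snd (u := ⟨x, w⟩) hu)
    have h := HasMFDerivAt.comp (⟨x, w⟩ : TangentBundle (𝓡 3) M)
      (happ (c x, v)).hasMFDerivAt hp
    have h' := h.congr_of_eventuallyEq
      (f₁ := fun p : TangentBundle (𝓡 3) M => (tangentTriv x p).2) (by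
        have hmem : (fun p : TangentBundle (𝓡 3) M => p.proj) ⁻¹'
            ((chartAt E3 x₀).source ∩ (chartAt E3 x).source) ∈ 𝓝 (⟨x, w⟩ : TangentBundle (𝓡 3) M) :=
          (hasMFDerivAt_proj _).continuousAt.preimage_mem_nhds
            (((chartAt E3 x₀).open_source.inter (chartAt E3 x).open_source).mem_nhds ⟨hx, hxx⟩)
        filter_upwards [hmem] with p hp
        change _ = c p.proj (tangentTriv x₀ p).2
        rw [hcapp hp.1 hp.2, coordField_tangentTriv hp.1])
    have := DFunLike.congr_fun h'.mfderiv X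
    exact this
  have h2 : mvfderiv (𝓡 3) (fun y => (tangentTriv x ⟨y, coordField x₀ v y⟩).2) x
      (projDeriv ⟨x, w⟩ X) = mvfderiv (𝓡 3) c x (projDeriv ⟨x, w⟩ X) v := by
    have h := (ContinuousLinearMap.apply ℝ E3 v).hasFDerivAt.hasMFDerivAt.comp x hc.hasMFDerivAt
    have h' := h.congr_of_eventuallyEq
      (f₁ := fun y => (tangentTriv x ⟨y, coordField x₀ v y⟩).2) (by
        filter_upwards [((chartAt E3 x₀).open_source.inter (chartAt E3 x).open_source).mem_nhds
          ⟨hx, hxx⟩] with y hy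
        exact (hcapp hy.1 hy.2 v).symm)
    exact DFunLike.congr_fun h'.mfderiv (projDeriv ⟨x, w⟩ X)
  have h3 := nabla.eq_flatCov_add hxx (mdifferentiableAt_coordField hx v)
  have h4 : coordField x₀ v x = w := coordField_tangentTriv hx w
  have h5 : (tangentTriv x).symmL ℝ x (c x (fiberDeriv x₀ ⟨x, w⟩ X)) =
      coordField x₀ (fiberDeriv x₀ ⟨x, w⟩ X) x := by
    rw [hcapp hx hxx]
    exact coordField_tangentTriv hxx _
  rw [h4, ← nabla.extend_eq_coordField] at h3
  change (tangentTriv x).symmL ℝ x (mvfderiv (𝓡 3).tangent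
    (fun p : TangentBundle (𝓡 3) M => (tangentTriv x p).2) ⟨x, w⟩ X) +
    nabla (FiberBundle.extend E3 w) x (projDeriv ⟨x, w⟩ X) = _
  rw [h1, map_add, h5, h3]
  change _ = _ + ((tangentTriv x).symmL ℝ x (mvfderiv (𝓡 3)
    (fun y => (tangentTriv x ⟨y, coordField x₀ v y⟩).2) x (projDeriv ⟨x, w⟩ X)) + _)
  rw [h2, add_assoc]
  rfl

end Flat

section Existence

/-! ### Existence of the Levi-Civita connection -/

/-- A trilinear form on a Euclidean space is the inner product with a bilinear map. -/
theorem exists_bilin_inner_eq {V : Type*} [NormedAddCommGroup V] [InnerProductSpace ℝ V]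
    [FiniteDimensional ℝ V] (T : V → V → V → ℝ) (h₁ : ∀ a c, IsLinearMap ℝ fun w => T w a c)
    (h₂ : ∀ w c, IsLinearMap ℝ fun a => T w a c) (h₃ : ∀ w a, IsLinearMap ℝ (T w a)) :
    ∃ C : V →L[ℝ] V →L[ℝ] V, ∀ w a c, inner ℝ (C w a) c = T w a c := by
  have := FiniteDimensional.complete ℝ V
  let C₀ (w a : V) : V :=
    (InnerProductSpace.toDual ℝ V).symm (LinearMap.toContinuousLinearMap ((h₃ w a).mk' _))
  have hC (w a c : V) : inner ℝ (C₀ w a) c = T w a c := InnerProductSpace.toDual_symm_apply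
  let C₁ : V →ₗ[ℝ] V →ₗ[ℝ] V := LinearMap.mk₂ ℝ C₀
    (fun w w' a => ext_inner_right ℝ fun c => by
      rw [inner_add_left, hC, hC, hC, (h₁ a c).map_add])
    (fun r w a => ext_inner_right ℝ fun c => by
      rw [real_inner_smul_left, hC, hC, (h₁ a c).map_smul, smul_eq_mul])
    (fun w a a' => ext_inner_right ℝ fun c => by
      rw [inner_add_left, hC, hC, hC, (h₂ w c).map_add])
    (fun r w a => ext_inner_right ℝ fun c => by
      rw [real_inner_smul_left, hC, hC, (h₂ w c).map_smul, smul_eq_mul])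
  exact ⟨LinearMap.toContinuousLinearMap
    (LinearMap.toContinuousLinearMap.toLinearMap ∘ₗ C₁), hC⟩

variable {M : Type*} [TopologicalSpace M] [ChartedSpace E3 M] [IsManifold (𝓡 3) ∞ M]
  [RiemannianBundle (fun x : M => TangentSpace (𝓡 3) x)]
  [IsContMDiffRiemannianBundle (𝓡 3) ∞ E3 (fun x : M => TangentSpace (𝓡 3) x)]

/-- The Christoffel symbols at the centre of a chart, as a tensor: the index is raised with the
metric. -/
theorem exists_christoffel_bilin (x : M) :
    ∃ C : TangentSpace (𝓡 3) x →L[ℝ] TangentSpace (𝓡 3) x →L[ℝ] TangentSpace (𝓡 3) x,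
      ∀ w a c, inner ℝ (C w a) c = christoffel x (extChartAt (𝓡 3) x x)
        (tangentTriv x ⟨x, a⟩).2 (tangentTriv x ⟨x, w⟩).2 (tangentTriv x ⟨x, c⟩).2 := by
  have hx := mem_chart_source E3 x
  refine exists_bilin_inner_eq (V := TangentSpace (𝓡 3) x) _ (fun a c => ⟨?_, ?_⟩)
    (fun a c => ⟨?_, ?_⟩) (fun a c => ⟨?_, ?_⟩) <;> intros <;>
    simp only [tangentTriv_snd_eq hx, map_add, map_smul, christoffel, add_apply,
      smul_apply, smul_eq_mul] <;> ring

/-- The Levi-Civita connection exists: at each point it is determined by Koszul's formula in the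
chart at this point, so that no gluing is required. -/
theorem exists_isLeviCivita :
    ∃ nabla : CovariantDerivative (𝓡 3) E3 (TangentSpace (𝓡 3) : M → Type _),
      IsLeviCivita nabla := by
  choose C hC using exists_christoffel_bilin (M := M)
  let nabla : CovariantDerivative (𝓡 3) E3 (TangentSpace (𝓡 3) : M → Type _) :=
    { toFun := fun σ x => flatCov x σ x + C x (σ x)
      isCovariantDerivativeOnUniv :=
        { add := fun {σ σ' x} hσ hσ' _ =>
            ((flatCov_isCovariantDerivativeOn x).add_one_form C).add hσ hσ' (mem_chart_source E3 x)
          leibniz := fun {σ g x} hσ hg _ =>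
            ((flatCov_isCovariantDerivativeOn x).add_one_form C).leibniz hσ hg
              (mem_chart_source E3 x) } }
  have hn (x : M) (v : TangentSpace (𝓡 3) x) : nabla (FiberBundle.extend E3 v) x = C x v := by
    have hx := mem_chart_source E3 x
    rw [nabla.extend_eq_coordField]
    change flatCov x (coordField x (tangentTriv x ⟨x, v⟩).2) x +
      C x (coordField x (tangentTriv x ⟨x, v⟩).2 x) = _
    rw [flatCov_coordField hx, zero_add, coordField_tangentTriv hx]
  refine ⟨nabla, ?_, ?_⟩
  · unfold CovariantDerivative.IsMetricCompatible
    ext x σ₀ τ₀ X₀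
    have hx := mem_chart_source E3 x
    have h : (fun y => inner ℝ (FiberBundle.extend E3 σ₀ y : TangentSpace (𝓡 3) y)
        (FiberBundle.extend E3 τ₀ y)) =ᶠ[𝓝 x]
        fun y => inner ℝ (coordField x (tangentTriv x ⟨x, σ₀⟩).2 y)
          (coordField x (tangentTriv x ⟨x, τ₀⟩).2 y) := by
      filter_upwards [extend_eventuallyEq_coordField σ₀, extend_eventuallyEq_coordField τ₀]
        with y h1 h2
      rw [h1, h2]
    have h1 : mvfderiv (𝓡 3) (fun y => inner ℝ (FiberBundle.extend E3 σ₀ y : TangentSpace (𝓡 3) y)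
        (FiberBundle.extend E3 τ₀ y)) x X₀ = derivMetricCoord x (extChartAt (𝓡 3) x x)
        (tangentTriv x ⟨x, X₀⟩).2 (tangentTriv x ⟨x, σ₀⟩).2 (tangentTriv x ⟨x, τ₀⟩).2 := by
      rw [← mvfderiv_inner_coordField hx, coordField_tangentTriv hx]
      exact DFunLike.congr_fun h.mfderiv_eq X₀
    rw [nabla.derivMetricTensor_apply_eq_extend, h1, hn, hn, real_inner_comm _ σ₀, hC, hC,
      ← christoffel_add_christoffel hx]
    simp only [Pi.zero_apply, zero_apply]
    ring
  · ext1 x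
    refine ContinuousLinearMap.ext fun X₀ => ContinuousLinearMap.ext fun Y₀ => ?_
    have hx := mem_chart_source E3 x
    have hb : VectorField.mlieBracket (𝓡 3) (FiberBundle.extend E3 X₀)
        (FiberBundle.extend E3 Y₀ : ∀ y : M, TangentSpace (𝓡 3) y) x = 0 :=
      (Filter.EventuallyEq.mlieBracket_vectorField_eq (extend_eventuallyEq_coordField X₀)
        (extend_eventuallyEq_coordField Y₀)).trans (mlieBracket_coordField hx _ _)
    rw [nabla.torsion_apply_eq_extend, hb, hn, hn, FiberBundle.extend_apply_self,
      FiberBundle.extend_apply_self, sub_zero]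
    refine ext_inner_right ℝ fun c => ?_
    rw [inner_sub_left, hC, hC, christoffel_symm hx, sub_self]
    exact (inner_zero_left _).symm

end Existence

/-! ### The tangent sphere bundle as a manifold -/

section Sphere

/-- The Euclidean plane. -/
abbrev E2 : Type := EuclideanSpace ℝ (Fin 2)

theorem exists_equiv_prod_of_ne_zero {v : E3} (hv : v ≠ 0) :
    ∃ A : E3 ≃L[ℝ] ℝ × E2, A v = (1, 0) := by
  have hf : Module.finrank ℝ E3 = Module.finrank ℝ (ℝ × E2) := by simp
  let A₀ : E3 ≃L[ℝ] ℝ × E2 := ContinuousLinearEquiv.ofFinrankEq hf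
  obtain ⟨A₁, h⟩ := SeparatingDual.exists_continuousLinearEquiv_apply_eq (R := ℝ)
    (x := A₀ v) (y := (1, 0)) (by simpa using hv) (by simp)
  exact ⟨A₀.trans A₁, h⟩

variable {M : Type*} [TopologicalSpace M] [ChartedSpace E3 M] [IsManifold (𝓡 3) ∞ M]

/-- The coordinates `(x, v) ↦ (x, [v])` of nonzero tangent vectors in the chart at `x₀`: the base
point, and the ray of `v` in affine coordinates, where `A` splits off the coordinate of `v` which is
to be normalized. -/
def rayCoord (x₀ : M) (A : E3 ≃L[ℝ] ℝ × E2) (L : E5 ≃L[ℝ] E3 × E2) (u : TangentBundle (𝓡 3) M) :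
    E5 :=
  L.symm (extChartAt (𝓡 3) x₀ u.proj,
    (A (tangentTriv x₀ u).2).1⁻¹ • (A (tangentTriv x₀ u).2).2)

/-- The domain of `rayCoord`. -/
def rayDomain (x₀ : M) (A : E3 ≃L[ℝ] ℝ × E2) : Set (TangentBundle (𝓡 3) M) :=
  (tangentTriv x₀).source ∩ (fun u => (A (tangentTriv x₀ u).2).1) ⁻¹' Set.Ioi 0

theorem isOpen_rayDomain (x₀ : M) (A : E3 ≃L[ℝ] ℝ × E2) : IsOpen (rayDomain x₀ A) := by
  refine ContinuousOn.isOpen_inter_preimage ?_ (tangentTriv x₀).open_source isOpen_Ioi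
  exact (continuous_fst.comp A.continuous).comp_continuousOn
    (contMDiffOn_tangentTriv_snd x₀).continuousOn

theorem contMDiffOn_rayCoord (x₀ : M) (A : E3 ≃L[ℝ] ℝ × E2) (L : E5 ≃L[ℝ] E3 × E2) :
    ContMDiffOn (𝓡 3).tangent (𝓡 5) ∞ (rayCoord x₀ A L) (rayDomain x₀ A) := by
  have h1 : ContMDiffOn (𝓡 3).tangent 𝓘(ℝ, E3) ∞
      (fun u : TangentBundle (𝓡 3) M => extChartAt (𝓡 3) x₀ u.proj) (rayDomain x₀ A) :=
    (contMDiffOn_extChartAt (I := 𝓡 3) (n := ∞) (x := x₀)).comp (contMDiffOn_proj _)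
      fun u hu => (tangentTriv x₀).mem_source.1 hu.1
  have h2 : ContMDiffOn (𝓡 3).tangent 𝓘(ℝ, E3) ∞
      (fun u : TangentBundle (𝓡 3) M => (tangentTriv x₀ u).2) (rayDomain x₀ A) :=
    (contMDiffOn_tangentTriv_snd x₀).mono Set.inter_subset_left
  have h3 : ContDiffOn ℝ ∞
      (fun q : E3 × E3 => L.symm (q.1, (A q.2).1⁻¹ • (A q.2).2)) {q | 0 < (A q.2).1} := by
    refine L.symm.contDiff.comp_contDiffOn (contDiffOn_fst.prodMk ?_)
    have h1 : ContDiffOn ℝ ∞ (fun q : E3 × E3 => (A q.2).1⁻¹) {q | 0 < (A q.2).1} :=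
      (contDiff_fst.comp (A.contDiff.comp contDiff_snd)).contDiffOn.inv fun q hq => ne_of_gt hq
    have h2 : ContDiffOn ℝ ∞ (fun q : E3 × E3 => (A q.2).2) {q | 0 < (A q.2).1} :=
      (contDiff_snd.comp (A.contDiff.comp contDiff_snd)).contDiffOn
    exact h1.smul h2
  exact h3.contMDiffOn.comp (h1.prodMk_space h2) fun u hu => hu.2

omit [IsManifold (𝓡 3) ∞ M] in
theorem symm_mem_source (x₀ : M) {y : E3} (hy : y ∈ (extChartAt (𝓡 3) x₀).target) :
    (extChartAt (𝓡 3) x₀).symm y ∈ (chartAt E3 x₀).source := by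
  have := (extChartAt (𝓡 3) x₀).map_target hy
  rwa [extChartAt_source] at this

variable [RiemannianBundle (fun x : M => TangentSpace (𝓡 3) x)]

/-- The tangent vectors of length `s` with given `rayCoord`. -/
def rayParam (s : ℝ) (x₀ : M) (A : E3 ≃L[ℝ] ℝ × E2) (L : E5 ≃L[ℝ] E3 × E2) (y : E5) :
    TangentBundle (𝓡 3) M :=
  ⟨(extChartAt (𝓡 3) x₀).symm (L y).1, coordField x₀
    ((s / √(metricCoord x₀ (L y).1 (A.symm (1, (L y).2)) (A.symm (1, (L y).2)))) •
      A.symm (1, (L y).2)) ((extChartAt (𝓡 3) x₀).symm (L y).1)⟩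

theorem metricCoord_smul_smul (x₀ : M) (y : E3) (r : ℝ) (w : E3) :
    metricCoord x₀ y (r • w) (r • w) = r ^ 2 * metricCoord x₀ y w w := by
  rw [map_smul, map_smul]
  change r • (r • metricCoord x₀ y w w) = _
  rw [smul_eq_mul, smul_eq_mul]
  ring

theorem metricCoord_pos {x₀ : M} {y : E3} (hy : y ∈ (extChartAt (𝓡 3) x₀).target) {w : E3}
    (hw : w ≠ 0) : 0 < metricCoord x₀ y w w := by
  rw [metricCoord_apply]
  refine real_inner_self_pos.2 fun h => hw ?_
  rw [← tangentTriv_coordField (symm_mem_source x₀ hy) w, h,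
    tangentTriv_snd_eq (symm_mem_source x₀ hy), map_zero]

theorem symm_one_ne_zero (A : E3 ≃L[ℝ] ℝ × E2) (z : E2) : A.symm (1, z) ≠ 0 := fun h => by
  have := congrArg A h
  simp at this

variable {s : ℝ} {x₀ : M} {A : E3 ≃L[ℝ] ℝ × E2} {L : E5 ≃L[ℝ] E3 × E2}

theorem tangentTriv_rayParam {y : E5} (hy : (L y).1 ∈ (extChartAt (𝓡 3) x₀).target) :
    (tangentTriv x₀ (rayParam s x₀ A L y)).2 =
      (s / √(metricCoord x₀ (L y).1 (A.symm (1, (L y).2)) (A.symm (1, (L y).2)))) •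
        A.symm (1, (L y).2) :=
  tangentTriv_coordField (symm_mem_source x₀ hy) _

theorem norm_rayParam (hs : 0 < s) {y : E5} (hy : (L y).1 ∈ (extChartAt (𝓡 3) x₀).target) :
    ‖(rayParam s x₀ A L y).snd‖ = s := by
  have hw := metricCoord_pos hy (symm_one_ne_zero A (L y).2)
  set w := A.symm (1, (L y).2)
  have h : inner ℝ (rayParam s x₀ A L y).snd (rayParam s x₀ A L y).snd = s ^ 2 := by
    change metricCoord x₀ (L y).1 (_ • w) (_ • w) = _
    rw [metricCoord_smul_smul, div_pow, Real.sq_sqrt hw.le, div_mul_cancel₀ _ hw.ne']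
  rw [← Real.sqrt_sq (norm_nonneg _), ← real_inner_self_eq_norm_sq, h, Real.sqrt_sq hs.le]

theorem rayParam_mem_rayDomain (hs : 0 < s) {y : E5}
    (hy : (L y).1 ∈ (extChartAt (𝓡 3) x₀).target) : rayParam s x₀ A L y ∈ rayDomain x₀ A := by
  refine ⟨(tangentTriv x₀).mem_source.2 (symm_mem_source x₀ hy), ?_⟩
  have hw := metricCoord_pos hy (symm_one_ne_zero A (L y).2)
  rw [Set.mem_preimage, tangentTriv_rayParam hy]
  simpa using div_pos hs (Real.sqrt_pos.2 hw)

theorem rayCoord_rayParam (hs : 0 < s) {y : E5} (hy : (L y).1 ∈ (extChartAt (𝓡 3) x₀).target) :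
    rayCoord x₀ A L (rayParam s x₀ A L y) = y := by
  have hw := div_pos hs (Real.sqrt_pos.2 (metricCoord_pos hy (symm_one_ne_zero A (L y).2)))
  rw [rayCoord, tangentTriv_rayParam hy]
  have h1 : extChartAt (𝓡 3) x₀ (rayParam s x₀ A L y).proj = (L y).1 :=
    (extChartAt (𝓡 3) x₀).right_inv hy
  rw [h1, map_smul, A.apply_symm_apply, Prod.smul_fst, Prod.smul_snd, smul_smul, smul_eq_mul,
    mul_one, inv_mul_cancel₀ hw.ne', one_smul]
  exact L.symm_apply_apply y

theorem rayParam_rayCoord (hs : 0 < s) {u : TangentBundle (𝓡 3) M} (hu : u ∈ rayDomain x₀ A)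
    (hn : ‖u.snd‖ = s) : rayParam s x₀ A L (rayCoord x₀ A L u) = u := by
  obtain ⟨x, v⟩ := u
  have hx : x ∈ (chartAt E3 x₀).source := (tangentTriv x₀).mem_source.1 hu.1
  have h1 : (0 : ℝ) < (A (tangentTriv x₀ ⟨x, v⟩).2).1 := hu.2
  set b := (tangentTriv x₀ ⟨x, v⟩).2 with hb
  have hL : L (rayCoord x₀ A L ⟨x, v⟩) = (extChartAt (𝓡 3) x₀ x, (A b).1⁻¹ • (A b).2) :=
    L.apply_symm_apply _
  have hA : A.symm (1, (A b).1⁻¹ • (A b).2) = (A b).1⁻¹ • b := by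
    rw [A.symm_apply_eq, map_smul]
    exact Prod.ext (inv_mul_cancel₀ h1.ne').symm rfl
  have hm : metricCoord x₀ (extChartAt (𝓡 3) x₀ x) b b = s ^ 2 := by
    rw [hb, metricCoord_tangentTriv hx, real_inner_self_eq_norm_sq]
    exact congrArg (· ^ 2) hn
  have hc : (s / √(metricCoord x₀ (extChartAt (𝓡 3) x₀ x) ((A b).1⁻¹ • b) ((A b).1⁻¹ • b))) •
      (A b).1⁻¹ • b = b := by
    rw [metricCoord_smul_smul, hm, smul_smul, ← mul_pow, Real.sqrt_sq (by positivity)]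
    have : s / ((A b).1⁻¹ * s) * (A b).1⁻¹ = 1 := by field_simp
    rw [this, one_smul]
  have hxx : (extChartAt (𝓡 3) x₀).symm (extChartAt (𝓡 3) x₀ x) = x :=
    (extChartAt (𝓡 3) x₀).left_inv (by rwa [extChartAt_source])
  rw [rayParam, hL]
  dsimp only
  rw [hA, hc, hxx, hb, coordField_tangentTriv hx]

variable [IsContMDiffRiemannianBundle (𝓡 3) ∞ E3 (fun x : M => TangentSpace (𝓡 3) x)]

theorem contMDiffOn_rayParam (s : ℝ) (x₀ : M) (A : E3 ≃L[ℝ] ℝ × E2) (L : E5 ≃L[ℝ] E3 × E2) :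
    ContMDiffOn (𝓡 5) (𝓡 3).tangent ∞ (rayParam s x₀ A L)
      ((fun y => (L y).1) ⁻¹' (extChartAt (𝓡 3) x₀).target) := by
  set T := (fun y => (L y).1) ⁻¹' (extChartAt (𝓡 3) x₀).target with hT
  have hL1 : ContDiff ℝ ∞ fun y => (L y).1 := contDiff_fst.comp L.contDiff
  have hw : ContDiff ℝ ∞ fun y => A.symm (1, (L y).2) :=
    A.symm.contDiff.comp (contDiff_const.prodMk (contDiff_snd.comp L.contDiff))
  have hG : ContDiffOn ℝ ∞ (fun y => metricCoord x₀ (L y).1) T :=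
    (contDiffOn_metricCoord x₀).comp hL1.contDiffOn fun y hy => hy
  have hm : ContDiffOn ℝ ∞ (fun y => (s / √(metricCoord x₀ (L y).1 (A.symm (1, (L y).2))
      (A.symm (1, (L y).2)))) • A.symm (1, (L y).2)) T := by
    refine ContDiffOn.smul (contDiffOn_const.div (ContDiffOn.sqrt
      ((hG.clm_apply hw.contDiffOn).clm_apply hw.contDiffOn) fun y hy => ?_) fun y hy => ?_)
      hw.contDiffOn
    · exact (metricCoord_pos hy (symm_one_ne_zero A _)).ne'
    · exact (Real.sqrt_pos.2 (metricCoord_pos hy (symm_one_ne_zero A _))).ne'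
  have h1 : ContMDiffOn (𝓡 5) (𝓡 3) ∞ (fun y => (extChartAt (𝓡 3) x₀).symm (L y).1) T :=
    (contMDiffOn_extChartAt_symm x₀).comp hL1.contMDiff.contMDiffOn fun y hy => hy
  refine ((Trivialization.contMDiffOn_symm (IB := 𝓡 3) (n := ∞) (tangentTriv x₀)).comp
    (h1.prodMk hm.contMDiffOn) fun y hy => ?_).congr fun y hy => ?_
  · exact (tangentTriv x₀).mem_target.2 (symm_mem_source x₀ hy)
  · have hx := symm_mem_source x₀ (y := (L y).1) hy
    rw [Function.comp_apply, ← Trivialization.mk_symm _ hx, rayParam, coordField,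
      Trivialization.symmL_apply _ hx]

/-- The chart of the sphere bundle of radius `s` given by `rayCoord`. -/
def sphereChart (hs : 0 < s) (x₀ : M) (A : E3 ≃L[ℝ] ℝ × E2) (L : E5 ≃L[ℝ] E3 × E2)
    (u₀ : TangentSphere M s) : OpenPartialHomeomorph (TangentSphere M s) E5 where
  toFun u := rayCoord x₀ A L u.val
  -- outside of the target the value is of no importance
  invFun y := open Classical in
    if h : ‖(rayParam s x₀ A L y).snd‖ = s then ⟨rayParam s x₀ A L y, h⟩ else u₀
  source := Subtype.val ⁻¹' rayDomain x₀ A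
  target := (fun y => (L y).1) ⁻¹' (extChartAt (𝓡 3) x₀).target
  map_source' u hu := by
    have : L (rayCoord x₀ A L u.val) = _ := L.apply_symm_apply _
    rw [Set.mem_preimage, this]
    exact extChartAt_mem_target' ((tangentTriv x₀).mem_source.1 hu.1)
  map_target' y hy := by
    rw [Set.mem_preimage, dif_pos (norm_rayParam hs hy)]
    exact rayParam_mem_rayDomain hs hy
  left_inv' u hu := by
    have h := rayParam_rayCoord (L := L) hs hu u.2
    have h' : ‖(rayParam s x₀ A L (rayCoord x₀ A L u.val)).snd‖ = s := by rw [h]; exact u.2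
    rw [dif_pos h']
    exact Subtype.ext h
  right_inv' y hy := by
    rw [dif_pos (norm_rayParam hs hy)]
    exact rayCoord_rayParam hs hy
  open_source := (isOpen_rayDomain x₀ A).preimage continuous_subtype_val
  open_target := (isOpen_extChartAt_target x₀).preimage (continuous_fst.comp L.continuous)
  continuousOn_toFun := (contMDiffOn_rayCoord x₀ A L).continuousOn.comp
    continuous_subtype_val.continuousOn fun u hu => hu
  continuousOn_invFun := by
    refine Topology.IsInducing.subtypeVal.continuousOn_iff.2 ?_
    refine (contMDiffOn_rayParam s x₀ A L).continuousOn.congr fun y hy => ?_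
    rw [Function.comp_apply, dif_pos (norm_rayParam hs hy)]

theorem val_sphereChart_symm (hs : 0 < s) (u₀ : TangentSphere M s) {y : E5}
    (hy : y ∈ (sphereChart hs x₀ A L u₀).target) :
    ((sphereChart hs x₀ A L u₀).symm y).val = rayParam s x₀ A L y := by
  change Subtype.val (dite _ _ _) = _
  rw [dif_pos (norm_rayParam hs hy)]

/-- The charts `sphereChart` cover the sphere bundle, since `s ≠ 0`. -/
theorem exists_sphereChart (hs : 0 < s) (u₀ : TangentSphere M s) :
    ∃ (x₀ : M) (A : E3 ≃L[ℝ] ℝ × E2), u₀.val ∈ rayDomain x₀ A := by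
  have hx := mem_chart_source E3 u₀.val.proj
  have hv : (tangentTriv u₀.val.proj u₀.val).2 ≠ 0 := fun h => by
    have h1 := coordField_tangentTriv hx u₀.val.snd
    have h2 : coordField u₀.val.proj (tangentTriv u₀.val.proj u₀.val).2 u₀.val.proj = 0 := by
      rw [h, coordField, map_zero]
    have h3 : u₀.val.snd = 0 := h1.symm.trans h2
    have := u₀.2
    rw [h3, norm_zero] at this
    exact hs.ne this
  obtain ⟨A, hA⟩ := exists_equiv_prod_of_ne_zero hv
  refine ⟨u₀.val.proj, A, (tangentTriv _).mem_source.2 hx, ?_⟩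
  rw [Set.mem_preimage, hA]
  exact (one_pos : (0 : ℝ) < 1)

/-- The sphere bundle is a submanifold of `TM`: the charts `sphereChart` are restrictions of smooth
maps on open sets of `TM`, and their inverses are smooth maps to `TM`. -/
theorem exists_isSubmanifoldStructure (hs : 0 < s) :
    ∃ cs : ChartedSpace E5 (TangentSphere M s), IsSubmanifoldStructure cs := by
  let L : E5 ≃L[ℝ] E3 × E2 := ContinuousLinearEquiv.ofFinrankEq (by simp)
  choose x₀ A h using exists_sphereChart (M := M) hs
  let χ (u : TangentSphere M s) := sphereChart hs (x₀ u) (A u) L u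
  let cs : ChartedSpace E5 (TangentSphere M s) :=
    { atlas := Set.range χ
      chartAt := χ
      mem_chart_source := h
      chart_mem_atlas := fun u => ⟨u, rfl⟩ }
  have hparam (u : TangentSphere M s) : ContMDiffOn (𝓡 5) (𝓡 3).tangent ∞
      (fun y => ((χ u).symm y).val) (χ u).target :=
    (contMDiffOn_rayParam s (x₀ u) (A u) L).congr fun y hy => val_sphereChart_symm hs u hy
  have hm : IsManifold (𝓡 5) ∞ (TangentSphere M s) := by
    refine isManifold_of_contDiffOn _ _ _ ?_
    rintro _ _ ⟨u, rfl⟩ ⟨u', rfl⟩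
    rw [← contMDiffOn_iff_contDiffOn]
    refine (contMDiffOn_rayCoord (x₀ u') (A u') L).comp ((hparam u).mono fun y hy => ?_)
      fun y hy => ?_
    · exact hy.1.1
    · exact hy.1.2
  have hval : ContMDiff (𝓡 5) (𝓡 3).tangent ∞
      (Subtype.val : TangentSphere M s → TangentBundle (𝓡 3) M) := fun u => by
    have hχ : ContMDiffAt (𝓡 5) (𝓡 5) ∞ (χ u) u :=
      contMDiffAt_of_mem_maximalAtlas (IsManifold.chart_mem_maximalAtlas u) (h u)
    refine (((hparam u).contMDiffAt ((χ u).open_target.mem_nhds ((χ u).map_source (h u)))).comp u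
      hχ).congr_of_eventuallyEq ?_
    filter_upwards [(χ u).open_source.mem_nhds (h u)] with u' hu'
    exact congrArg Subtype.val ((χ u).left_inv hu').symm
  refine ⟨cs, hm, hval, fun u => ?_⟩
  have h1 : MDifferentiableAt (𝓡 3).tangent (𝓡 5) (rayCoord (x₀ u) (A u) L) u.val :=
    ((contMDiffOn_rayCoord (x₀ u) (A u) L).contMDiffAt
      ((isOpen_rayDomain _ _).mem_nhds (h u))).mdifferentiableAt (by simp)
  have h2 := mfderiv_comp u h1 ((hval u).mdifferentiableAt (by simp))
  have h3 : Function.Injective (mfderiv (𝓡 5) (𝓡 5) (χ u) u) :=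
    (mdifferentiable_chart (I := 𝓡 5) u).mfderiv_injective (h u)
  have h4 : (χ u : TangentSphere M s → E5) = rayCoord (x₀ u) (A u) L ∘ Subtype.val := rfl
  rw [h4, h2] at h3
  exact fun X Y hXY =>
    h3 (congrArg (mfderiv (𝓡 3).tangent (𝓡 5) (rayCoord (x₀ u) (A u) L) u.val) hXY)

end Sphere

/-! ### The splitting of `T(TM)` -/

section Splitting

variable {M : Type*} [TopologicalSpace M] [ChartedSpace E3 M] [IsManifold (𝓡 3) ∞ M]
  {nabla : CovariantDerivative (𝓡 3) E3 (TangentSpace (𝓡 3) : M → Type _)}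
  {u : TangentBundle (𝓡 3) M}

theorem splitting_lift (ab : TangentSpace (𝓡 3) u.proj × TangentSpace (𝓡 3) u.proj) :
    splitting nabla u (lift nabla u ab) = ab :=
  (splitting_isInvertible nabla u).self_apply_inverse ab

theorem lift_splitting (X : TangentSpace (𝓡 3).tangent u) :
    lift nabla u (splitting nabla u X) = X :=
  (splitting_isInvertible nabla u).inverse_apply_self X

theorem projDeriv_lift (ab : TangentSpace (𝓡 3) u.proj × TangentSpace (𝓡 3) u.proj) :
    projDeriv u (lift nabla u ab) = ab.1 := congrArg Prod.fst (splitting_lift ab)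

theorem connMap_lift (ab : TangentSpace (𝓡 3) u.proj × TangentSpace (𝓡 3) u.proj) :
    connMap nabla u (lift nabla u ab) = ab.2 := congrArg Prod.snd (splitting_lift ab)

variable (nabla) in
theorem splitting_ext {X Y : TangentSpace (𝓡 3).tangent u} (h1 : projDeriv u X = projDeriv u Y)
    (h2 : connMap nabla u X = connMap nabla u Y) : X = Y := by
  rw [← lift_splitting (nabla := nabla) X, ← lift_splitting (nabla := nabla) Y]
  exact congrArg _ (Prod.ext h1 h2)

theorem projDeriv_sasakiJ (X : TangentSpace (𝓡 3).tangent u) :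
    projDeriv u (sasakiJ nabla u X) = -connMap nabla u X := by
  have : sasakiJ nabla u X =
    lift nabla u (0, projDeriv u X) - lift nabla u (connMap nabla u X, 0) := rfl
  rw [this, map_sub, projDeriv_lift, projDeriv_lift, zero_sub]

theorem connMap_sasakiJ (X : TangentSpace (𝓡 3).tangent u) :
    connMap nabla u (sasakiJ nabla u X) = projDeriv u X := by
  have : sasakiJ nabla u X =
    lift nabla u (0, projDeriv u X) - lift nabla u (connMap nabla u X, 0) := rfl
  rw [this, map_sub, connMap_lift, connMap_lift, sub_zero]

theorem sasakiJ_sasakiJ (X : TangentSpace (𝓡 3).tangent u) :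
    sasakiJ nabla u (sasakiJ nabla u X) = -X := by
  apply splitting_ext nabla
  · rw [projDeriv_sasakiJ, connMap_sasakiJ, map_neg]
  · rw [connMap_sasakiJ, projDeriv_sasakiJ, map_neg]

variable [RiemannianBundle (fun x : M => TangentSpace (𝓡 3) x)]
  {o : ∀ x : M, Orientation ℝ (TangentSpace (𝓡 3) x) (Fin 3)} {s : ℝ}

theorem projDeriv_endoIMinus (X : TangentSpace (𝓡 3).tangent u) :
    projDeriv u (endoIMinus nabla o s u X) = s⁻¹ • cross (o u.proj) u.snd (projDeriv u X) := by
  have : endoIMinus nabla o s u X = s⁻¹ • lift nabla u (cross (o u.proj) u.snd (projDeriv u X),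
    -cross (o u.proj) u.snd (connMap nabla u X)) := rfl
  rw [this, map_smul, projDeriv_lift]

theorem connMap_endoIMinus (X : TangentSpace (𝓡 3).tangent u) :
    connMap nabla u (endoIMinus nabla o s u X) =
      -(s⁻¹ • cross (o u.proj) u.snd (connMap nabla u X)) := by
  have : endoIMinus nabla o s u X = s⁻¹ • lift nabla u (cross (o u.proj) u.snd (projDeriv u X),
    -cross (o u.proj) u.snd (connMap nabla u X)) := rfl
  rw [this, map_smul, connMap_lift, smul_neg]

theorem sasakiJ_endoIMinus (X : TangentSpace (𝓡 3).tangent u) :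
    sasakiJ nabla u (endoIMinus nabla o s u X) = -endoIMinus nabla o s u (sasakiJ nabla u X) := by
  apply splitting_ext nabla
  · rw [projDeriv_sasakiJ, connMap_endoIMinus, map_neg, projDeriv_endoIMinus, projDeriv_sasakiJ,
      map_neg, smul_neg]
  · rw [connMap_sasakiJ, projDeriv_endoIMinus, map_neg, connMap_endoIMinus, connMap_sasakiJ,
      neg_neg]

theorem sasakiMetric_apply (X Y : TangentSpace (𝓡 3).tangent u) : sasakiMetric nabla u X Y =
    inner ℝ (projDeriv u X) (projDeriv u Y) + inner ℝ (connMap nabla u X) (connMap nabla u Y) :=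
  rfl

variable [IsContMDiffRiemannianBundle (𝓡 3) ∞ E3 (fun x : M => TangentSpace (𝓡 3) x)] {x₀ : M}

/-- The connection map of the Levi-Civita connection in coordinates: the fibre derivative corrected
by a Christoffel symbol. -/
theorem IsLeviCivita.inner_connMap (hn : IsLeviCivita nabla)
    (hu : u.proj ∈ (chartAt E3 x₀).source) (X : TangentSpace (𝓡 3).tangent u) (c : E3) :
    inner ℝ (connMap nabla u X) (coordField x₀ c u.proj) =
      metricCoord x₀ (extChartAt (𝓡 3) x₀ u.proj) (fiberDeriv x₀ u X) c +
      christoffel x₀ (extChartAt (𝓡 3) x₀ u.proj)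
        (tangentTriv x₀ ⟨u.proj, projDeriv u X⟩).2 (tangentTriv x₀ u).2 c := by
  rw [connMap_eq nabla hu, inner_add_left, metricCoord_extChartAt hu,
    ← hn.inner_coordField hu, coordField_tangentTriv hu]

omit [RiemannianBundle (fun x : M => TangentSpace (𝓡 3) x)]
  [IsContMDiffRiemannianBundle (𝓡 3) ∞ E3 (fun x : M => TangentSpace (𝓡 3) x)] in
theorem hasMFDerivAt_extChartAt_proj (hu : u.proj ∈ (chartAt E3 x₀).source) :
    HasMFDerivAt (𝓡 3).tangent 𝓘(ℝ, E3)
      (fun p : TangentBundle (𝓡 3) M => extChartAt (𝓡 3) x₀ p.proj) u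
      ((tangentTriv x₀).continuousLinearMapAt ℝ u.proj ∘L projDeriv u) := by
  have h := HasMFDerivAt.comp u (g := extChartAt (𝓡 3) x₀)
    (mdifferentiableAt_extChartAt (I := 𝓡 3) hu).hasMFDerivAt (hasMFDerivAt_proj u)
  exact h.congr_mfderiv (ContinuousLinearMap.ext fun X =>
    (mfderiv_extChartAt_apply hu _).trans (tangentTriv_snd_eq hu _))

theorem hasFDerivAt_metricCoord_self {x : M} (hx : x ∈ (chartAt E3 x₀).source) (v : E3) :
    HasFDerivAt (fun q : E3 × E3 => metricCoord x₀ q.1 q.2 q.2)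
      (ContinuousLinearMap.apply ℝ ℝ v ∘L ContinuousLinearMap.apply ℝ (E3 →L[ℝ] ℝ) v ∘L
        derivMetricCoord x₀ (extChartAt (𝓡 3) x₀ x) ∘L ContinuousLinearMap.fst ℝ E3 E3 +
        (2 : ℝ) • (metricCoord x₀ (extChartAt (𝓡 3) x₀ x) v ∘L ContinuousLinearMap.snd ℝ E3 E3))
      (extChartAt (𝓡 3) x₀ x, v) := by
  have h1 := ((contDiffAt_metricCoord hx).differentiableAt (by simp)).hasFDerivAt
  have h1' : HasFDerivAt (fun q : E3 × E3 => metricCoord x₀ q.1)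
      (derivMetricCoord x₀ (extChartAt (𝓡 3) x₀ x) ∘L ContinuousLinearMap.fst ℝ E3 E3)
      (extChartAt (𝓡 3) x₀ x, v) :=
    HasFDerivAt.comp (g := metricCoord x₀) (extChartAt (𝓡 3) x₀ x, v) h1 hasFDerivAt_fst
  have h2 := (h1'.clm_apply hasFDerivAt_snd).clm_apply (hasFDerivAt_snd (𝕜 := ℝ))
  refine h2.congr_fderiv (ContinuousLinearMap.ext fun q => ?_)
  simp [metricCoord_symm x₀ _ q.2 v]
  ring

/-- The derivative of `‖u‖²` on `TM` is `2 ⟪u, K ·⟫`. The Christoffel symbols account for the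
derivative of the metric, as the connection is metric. -/
theorem IsLeviCivita.hasMFDerivAt_inner_self (hn : IsLeviCivita nabla)
    (u : TangentBundle (𝓡 3) M) :
    HasMFDerivAt (𝓡 3).tangent 𝓘(ℝ, ℝ) (fun p : TangentBundle (𝓡 3) M => inner ℝ p.snd p.snd) u
      ((2 : ℝ) • (innerSL ℝ u.snd ∘L connMap nabla u)) := by
  have hu : u.proj ∈ (chartAt E3 u.proj).source := mem_chart_source E3 u.proj
  have h3 := HasMFDerivAt.comp u (g := fun q : E3 × E3 => metricCoord u.proj q.1 q.2 q.2)
    (f := fun p : TangentBundle (𝓡 3) M =>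
      (extChartAt (𝓡 3) u.proj p.proj, (tangentTriv u.proj p).2))
    (hasFDerivAt_metricCoord_self hu (tangentTriv u.proj u).2).hasMFDerivAt
    ((hasMFDerivAt_extChartAt_proj hu).prodMk_space (hasMFDerivAt_tangentTriv_snd hu))
  have h4 := h3.congr_of_eventuallyEq
    (f₁ := fun p : TangentBundle (𝓡 3) M => inner ℝ p.snd p.snd) (by
      filter_upwards [(hasMFDerivAt_proj u).continuousAt.preimage_mem_nhds
        ((chartAt E3 u.proj).open_source.mem_nhds hu)] with p hp
      exact (metricCoord_tangentTriv (x := p.proj) hp p.snd p.snd).symm)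
  refine h4.congr_mfderiv (ContinuousLinearMap.ext fun X => ?_)
  have h5 := hn.inner_connMap hu X (tangentTriv u.proj u).2
  have h6 : coordField u.proj (tangentTriv u.proj u).2 u.proj = u.snd :=
    coordField_tangentTriv hu u.snd
  rw [h6, real_inner_comm, tangentTriv_snd_eq hu (projDeriv u X)] at h5
  have h7 := christoffel_add_christoffel hu
    ((tangentTriv u.proj).continuousLinearMapAt ℝ u.proj (projDeriv u X))
    (tangentTriv u.proj u).2 (tangentTriv u.proj u).2
  have h8 := metricCoord_symm u.proj (extChartAt (𝓡 3) u.proj u.proj) (tangentTriv u.proj u).2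
    (fiberDeriv u.proj u X)
  have h9 : derivMetricCoord u.proj (extChartAt (𝓡 3) u.proj u.proj)
      ((tangentTriv u.proj).continuousLinearMapAt ℝ u.proj (projDeriv u X))
      (tangentTriv u.proj u).2 (tangentTriv u.proj u).2 +
      2 * metricCoord u.proj (extChartAt (𝓡 3) u.proj u.proj) (tangentTriv u.proj u).2
    (fiberDeriv u.proj u X) = 2 * inner ℝ u.snd (connMap nabla u X) := by
    rw [h5, ← h7, h8]
    ring
  exact h9

end Splitting

/-! ### The pointwise geometry of the tangent sphere bundle -/

section SphereGeometry

variable {M : Type*} [TopologicalSpace M] [ChartedSpace E3 M] [IsManifold (𝓡 3) ∞ M]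
  [RiemannianBundle (fun x : M => TangentSpace (𝓡 3) x)]
  {nabla : CovariantDerivative (𝓡 3) E3 (TangentSpace (𝓡 3) : M → Type _)}
  {o : ∀ x : M, Orientation ℝ (TangentSpace (𝓡 3) x) (Fin 3)} {s c : ℝ}
  [ChartedSpace E5 (TangentSphere M s)] {p : TangentSphere M s}

theorem theta_apply (X : TangentSpace (𝓡 5) p) :
    theta p X = inner ℝ p.val.snd (projDeriv p.val (inclDeriv p X)) := rfl

variable (o p) in
/-- `(e₀, e₁)` is a positively oriented orthonormal basis of the plane `u^⊥`, for `u = p`. -/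
def IsAdaptedPair (e : Fin 2 → TangentSpace (𝓡 3) p.val.proj) : Prop :=
  ∃ a : OrthonormalBasis (Fin 3) ℝ (TangentSpace (𝓡 3) p.val.proj),
    a.toBasis.orientation = o p.val.proj ∧ p.val.snd = s • a 0 ∧ a 1 = e 0 ∧ a 2 = e 1

variable (nabla c p) in
/-- The components `(c θ(X), z)` of a tangent vector of the sphere bundle, where `zₖ` has the real
part `⟪eₖ, dπ X⟫` and the imaginary part `⟪eₖ, K X⟫`. -/
def modelCoord (e : Fin 2 → TangentSpace (𝓡 3) p.val.proj) : TangentSpace (𝓡 5) p →L[ℝ] W5 :=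
  (c • theta p).prod (ContinuousLinearMap.pi fun k =>
    Complex.equivRealProdCLM.symm.toContinuousLinearMap ∘L
      ((innerSL ℝ (e k) ∘L projDeriv p.val).prod (innerSL ℝ (e k) ∘L connMap nabla p.val)) ∘L
      inclDeriv p)

section Components

variable (e : Fin 2 → TangentSpace (𝓡 3) p.val.proj) (X : TangentSpace (𝓡 5) p)

theorem modelCoord_fst : (modelCoord nabla c p e X).1 = c * theta p X := rfl

end Components

/-- The components of `s⁻¹ u × x`, for `u = s a₀`. -/
theorem inner_inv_smul_cross {V : Type*} [NormedAddCommGroup V] [InnerProductSpace ℝ V]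
    [Fact (Module.finrank ℝ V = 3)] [FiniteDimensional ℝ V] {o : Orientation ℝ V (Fin 3)}
    {a : OrthonormalBasis (Fin 3) ℝ V} (ha : a.toBasis.orientation = o) (hs : 0 < s) {u : V}
    (hu : u = s • a 0) (x : V) :
    inner ℝ (a 0) (s⁻¹ • cross o u x) = 0 ∧
      inner ℝ (a 1) (s⁻¹ • cross o u x) = -inner ℝ (a 2) x ∧
      inner ℝ (a 2) (s⁻¹ • cross o u x) = inner ℝ (a 1) x := by
  obtain ⟨h0, h1, h2⟩ := cross_orthonormalBasis a ha
  have hx := a.sum_repr' x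
  rw [Fin.sum_univ_three] at hx
  have h : s⁻¹ • cross o u x = inner ℝ (a 1) x • a 2 - inner ℝ (a 2) x • a 1 := by
    rw [hu, cross_smul_left, smul_smul, inv_mul_cancel₀ hs.ne', one_smul]
    conv_lhs => rw [← hx]
    rw [map_add, map_add, map_smul, map_smul, map_smul, h0, h1, h2, smul_zero, zero_add, smul_neg,
      sub_eq_add_neg]
  rw [h]
  simp [inner_sub_right, real_inner_smul_right, a.inner_eq_ite]

theorem eq_of_inner_basis {V : Type*} [NormedAddCommGroup V] [InnerProductSpace ℝ V]
    (a : OrthonormalBasis (Fin 3) ℝ V) {x y : V} (h0 : inner ℝ (a 0) x = inner ℝ (a 0) y)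
    (h1 : inner ℝ (a 1) x = inner ℝ (a 1) y) (h2 : inner ℝ (a 2) x = inner ℝ (a 2) y) : x = y := by
  rw [← a.sum_repr' x, ← a.sum_repr' y, Fin.sum_univ_three, Fin.sum_univ_three, h0, h1, h2]

theorem inner_eq_sum_three {V : Type*} [NormedAddCommGroup V] [InnerProductSpace ℝ V]
    (a : OrthonormalBasis (Fin 3) ℝ V) (x y : V) : inner ℝ x y =
    inner ℝ (a 0) x * inner ℝ (a 0) y + inner ℝ (a 1) x * inner ℝ (a 1) y +
      inner ℝ (a 2) x * inner ℝ (a 2) y := by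
  rw [← a.sum_inner_mul_inner x y, Fin.sum_univ_three, real_inner_comm x, real_inner_comm x,
    real_inner_comm x]

theorem sasakiMetric_eq_sum {u : TangentBundle (𝓡 3) M}
    (a : OrthonormalBasis (Fin 3) ℝ (TangentSpace (𝓡 3) u.proj))
    (X Y : TangentSpace (𝓡 3).tangent u) : sasakiMetric nabla u X Y =
      (inner ℝ (a 0) (projDeriv u X) * inner ℝ (a 0) (projDeriv u Y) +
        inner ℝ (a 1) (projDeriv u X) * inner ℝ (a 1) (projDeriv u Y) +
        inner ℝ (a 2) (projDeriv u X) * inner ℝ (a 2) (projDeriv u Y)) +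
      (inner ℝ (a 0) (connMap nabla u X) * inner ℝ (a 0) (connMap nabla u Y) +
        inner ℝ (a 1) (connMap nabla u X) * inner ℝ (a 1) (connMap nabla u Y) +
        inner ℝ (a 2) (connMap nabla u X) * inner ℝ (a 2) (connMap nabla u Y)) := by
  rw [sasakiMetric_apply, inner_eq_sum_three a (projDeriv u X),
    inner_eq_sum_three a (connMap nabla u X)]

variable [IsContMDiffRiemannianBundle (𝓡 3) ∞ E3 (fun x : M => TangentSpace (𝓡 3) x)]

/-- The vertical part of a vector tangent to the sphere bundle is orthogonal to the position. -/
theorem inner_connMap_inclDeriv (hcs : IsSubmanifoldStructure (M := M) (s := s) inferInstance)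
    (hn : IsLeviCivita nabla) (X : TangentSpace (𝓡 5) p) :
    inner ℝ p.val.snd (connMap nabla p.val (inclDeriv p X)) = 0 := by
  have h1 : HasMFDerivAt (𝓡 5) (𝓡 3).tangent (Subtype.val : TangentSphere M s → _) p
      (inclDeriv p) := ((hcs.contMDiff_val p).mdifferentiableAt (by simp)).hasMFDerivAt
  have h2 := HasMFDerivAt.comp p (g := fun p : TangentBundle (𝓡 3) M => (inner ℝ p.snd p.snd : ℝ))
    (hn.hasMFDerivAt_inner_self p.val) h1
  have h3 : (fun p : TangentBundle (𝓡 3) M => (inner ℝ p.snd p.snd : ℝ)) ∘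
      (Subtype.val : TangentSphere M s → _) = fun _ => s * s := by
    ext q
    exact (real_inner_self_eq_norm_mul_norm q.val.snd).trans (by rw [q.property])
  rw [h3] at h2
  have h4 := DFunLike.congr_fun (hasMFDerivAt_unique h2 (hasMFDerivAt_const (s * s) p)) X
  have h5 : 2 * inner ℝ p.val.snd (connMap nabla p.val (inclDeriv p X)) = 0 := h4
  linarith

variable (o p) in
theorem exists_isAdaptedPair (hs : 0 < s) : ∃ e, IsAdaptedPair o p e := by
  obtain ⟨a, ha, hu⟩ := exists_oriented_orthonormalBasis (o p.val.proj) hs p.property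
  exact ⟨![a 1, a 2], a, ha, hu, rfl, rfl⟩

section Adapted

variable (hcs : IsSubmanifoldStructure (M := M) (s := s) inferInstance)
  (hn : IsLeviCivita nabla) (hs : 0 < s)
  {e : Fin 2 → TangentSpace (𝓡 3) p.val.proj} (he : IsAdaptedPair o p e)
include hcs hn hs he

/-- The components of the horizontal and the vertical part of `X` in an oriented orthonormal
basis. -/
theorem IsAdaptedPair.exists_basis (hc : c ≠ 0) :
    ∃ a : OrthonormalBasis (Fin 3) ℝ (TangentSpace (𝓡 3) p.val.proj),
      (∀ X, inner ℝ (a 0) (projDeriv p.val (inclDeriv p X)) =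
        (c * s)⁻¹ * (modelCoord nabla c p e X).1) ∧
      (∀ X, inner ℝ (a 1) (projDeriv p.val (inclDeriv p X)) = ((modelCoord nabla c p e X).2 0).re) ∧
      (∀ X, inner ℝ (a 2) (projDeriv p.val (inclDeriv p X)) = ((modelCoord nabla c p e X).2 1).re) ∧
      (∀ X, inner ℝ (a 0) (connMap nabla p.val (inclDeriv p X)) = 0) ∧
      (∀ X, inner ℝ (a 1) (connMap nabla p.val (inclDeriv p X)) =
        ((modelCoord nabla c p e X).2 0).im) ∧
      (∀ X, inner ℝ (a 2) (connMap nabla p.val (inclDeriv p X)) =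
        ((modelCoord nabla c p e X).2 1).im) ∧
      (∀ Z, inner ℝ (a 0) (projDeriv p.val (endoIMinus nabla o s p.val Z)) = 0) ∧
      (∀ Z, inner ℝ (a 1) (projDeriv p.val (endoIMinus nabla o s p.val Z)) =
        -inner ℝ (a 2) (projDeriv p.val Z)) ∧
      (∀ Z, inner ℝ (a 2) (projDeriv p.val (endoIMinus nabla o s p.val Z)) =
        inner ℝ (a 1) (projDeriv p.val Z)) ∧
      (∀ Z, inner ℝ (a 0) (connMap nabla p.val (endoIMinus nabla o s p.val Z)) = 0) ∧
      (∀ Z, inner ℝ (a 1) (connMap nabla p.val (endoIMinus nabla o s p.val Z)) =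
        inner ℝ (a 2) (connMap nabla p.val Z)) ∧
      ∀ Z, inner ℝ (a 2) (connMap nabla p.val (endoIMinus nabla o s p.val Z)) =
        -inner ℝ (a 1) (connMap nabla p.val Z) := by
  obtain ⟨a, ha, hu, h1, h2⟩ := he
  have h0 : a 0 = s⁻¹ • p.val.snd := by
    rw [hu, smul_smul, inv_mul_cancel₀ hs.ne', one_smul]
  refine ⟨a, fun X => ?_, fun X => ?_, fun X => ?_, fun X => ?_, fun X => ?_, fun X => ?_,
    fun Z => ?_, fun Z => ?_, fun Z => ?_, fun Z => ?_, fun Z => ?_, fun Z => ?_⟩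
  · rw [h0, real_inner_smul_left, ← theta_apply, modelCoord_fst]
    field_simp
  · rw [h1]; rfl
  · rw [h2]; rfl
  · rw [h0, real_inner_smul_left, inner_connMap_inclDeriv hcs hn, mul_zero]
  · rw [h1]; rfl
  · rw [h2]; rfl
  · rw [projDeriv_endoIMinus, (inner_inv_smul_cross ha hs hu _).1]
  · rw [projDeriv_endoIMinus, (inner_inv_smul_cross ha hs hu _).2.1]
  · rw [projDeriv_endoIMinus, (inner_inv_smul_cross ha hs hu _).2.2]
  · rw [connMap_endoIMinus, inner_neg_right, (inner_inv_smul_cross ha hs hu _).1, neg_zero]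
  · rw [connMap_endoIMinus, inner_neg_right, (inner_inv_smul_cross ha hs hu _).2.1, neg_neg]
  · rw [connMap_endoIMinus, inner_neg_right, (inner_inv_smul_cross ha hs hu _).2.2]

theorem IsAdaptedPair.injective_modelCoord (hc : c ≠ 0) :
    Function.Injective (modelCoord nabla c p e) := by
  obtain ⟨a, h0, h1, h2, k0, k1, k2, -⟩ := he.exists_basis hcs hn hs hc
  intro X Y hXY
  refine hcs.injective_mfderiv p (splitting_ext nabla (eq_of_inner_basis a ?_ ?_ ?_)
    (eq_of_inner_basis a ?_ ?_ ?_))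
  · exact (h0 X).trans ((congrArg (fun w => (c * s)⁻¹ * w.1) hXY).trans (h0 Y).symm)
  · exact (h1 X).trans ((congrArg (fun w : W5 => (w.2 0).re) hXY).trans (h1 Y).symm)
  · exact (h2 X).trans ((congrArg (fun w : W5 => (w.2 1).re) hXY).trans (h2 Y).symm)
  · exact (k0 X).trans (k0 Y).symm
  · exact (k1 X).trans ((congrArg (fun w : W5 => (w.2 0).im) hXY).trans (k1 Y).symm)
  · exact (k2 X).trans ((congrArg (fun w : W5 => (w.2 1).im) hXY).trans (k2 Y).symm)

/-- The components are an isomorphism onto `ℝ ⊕ ℂ²`: they are injective, and both spaces have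
dimension five. -/
theorem IsAdaptedPair.exists_equiv (hc : c ≠ 0) :
    ∃ A : TangentSpace (𝓡 5) p ≃L[ℝ] W5, ∀ X, A X = modelCoord nabla c p e X := by
  have : FiniteDimensional ℝ (TangentSpace (𝓡 5) p) := inferInstanceAs (FiniteDimensional ℝ E5)
  have : T2Space (TangentSpace (𝓡 5) p) := inferInstanceAs (T2Space E5)
  have hd : Module.finrank ℝ E5 = Module.finrank ℝ W5 := by
    simp [Module.finrank_pi_fintype, Complex.finrank_real_complex]
  let L : TangentSpace (𝓡 5) p ≃ₗ[ℝ] W5 :=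
    LinearEquiv.ofInjectiveOfFinrankEq (modelCoord nabla c p e).toLinearMap
      (he.injective_modelCoord hcs hn hs hc) hd
  exact ⟨L.toContinuousLinearEquiv, fun X => rfl⟩

set_option maxHeartbeats 2000000 in
/-- The Sasaki metric in components. For `c = s⁻¹` it is the Euclidean metric of `ℝ ⊕ ℂ²`. -/
theorem IsAdaptedPair.sasakiMetric_eq (hc : c ≠ 0) (X Y : TangentSpace (𝓡 5) p) :
    sasakiMetric nabla p.val (inclDeriv p X) (inclDeriv p Y) =
      (c * s)⁻¹ * (modelCoord nabla c p e X).1 * ((c * s)⁻¹ * (modelCoord nabla c p e Y).1) +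
      stdInner (modelCoord nabla c p e X).2 (modelCoord nabla c p e Y).2 := by
  obtain ⟨a, h0, h1, h2, k0, k1, k2, -⟩ := he.exists_basis hcs hn hs hc
  rw [sasakiMetric_eq_sum a, h0 X, h1 X, h2 X, k0 X, k1 X, k2 X, h0 Y, h1 Y, h2 Y, k0 Y, k1 Y,
    k2 Y, stdInner_eq]
  generalize modelCoord nabla c p e X = x
  generalize modelCoord nabla c p e Y = y
  ring

set_option maxHeartbeats 2000000 in
/-- The 2-forms of `J`, `I₋`, `J I₋` are the standard 2-forms in components, whatever `c` is. -/
theorem IsAdaptedPair.sphereTwoForm_eq (hc : c ≠ 0) (k : Fin 3) (X Y : TangentSpace (𝓡 5) p) :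
    sphereTwoForm nabla o k p X Y =
      stdTwoForm k (modelCoord nabla c p e X).2 (modelCoord nabla c p e Y).2 := by
  obtain ⟨a, h0, h1, h2, k0, k1, k2, x0, x1, x2, y0, y1, y2⟩ := he.exists_basis hcs hn hs hc
  have hX (Z : TangentSpace (𝓡 3).tangent p.val) : sasakiMetric nabla p.val Z (inclDeriv p Y) =
      inner ℝ (a 0) (projDeriv p.val Z) * ((c * s)⁻¹ * (modelCoord nabla c p e Y).1) +
      (inner ℝ (a 1) (projDeriv p.val Z) * ((modelCoord nabla c p e Y).2 0).re +
      inner ℝ (a 2) (projDeriv p.val Z) * ((modelCoord nabla c p e Y).2 1).re +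
      (inner ℝ (a 1) (connMap nabla p.val Z) * ((modelCoord nabla c p e Y).2 0).im +
      inner ℝ (a 2) (connMap nabla p.val Z) * ((modelCoord nabla c p e Y).2 1).im)) := by
    rw [sasakiMetric_eq_sum a, h0 Y, h1 Y, h2 Y, k0 Y, k1 Y, k2 Y, mul_zero, zero_add, add_assoc,
      add_assoc, add_assoc]
  fin_cases k
  · refine (hX (sasakiJ nabla p.val (inclDeriv p X))).trans ?_
    rw [projDeriv_sasakiJ, connMap_sasakiJ, inner_neg_right, inner_neg_right, inner_neg_right,
      h1 X, h2 X, k0 X, k1 X, k2 X]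
    refine Eq.trans ?_ (stdTwoForm_zero_eq _ _).symm
    generalize modelCoord nabla c p e X = x
    generalize modelCoord nabla c p e Y = y
    ring
  · refine (hX (endoIMinus nabla o s p.val (inclDeriv p X))).trans ?_
    rw [x0, x1, x2, y1, y2, h1 X, h2 X, k1 X, k2 X]
    refine Eq.trans ?_ (stdTwoForm_one_eq _ _).symm
    generalize modelCoord nabla c p e X = x
    generalize modelCoord nabla c p e Y = y
    ring
  · refine (hX (sasakiJ nabla p.val (endoIMinus nabla o s p.val (inclDeriv p X)))).trans ?_
    rw [projDeriv_sasakiJ, connMap_sasakiJ, inner_neg_right, inner_neg_right, inner_neg_right,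
      y0, x1, x2, y1, y2, h1 X, h2 X, k1 X, k2 X]
    refine Eq.trans ?_ (stdTwoForm_two_eq _ _).symm
    generalize modelCoord nabla c p e X = x
    generalize modelCoord nabla c p e Y = y
    ring

/-- On the contact distribution `J` is multiplication by `i` in components. -/
theorem IsAdaptedPair.inclDeriv_eq_sasakiJ_iff (hc : c ≠ 0) {X Y : TangentSpace (𝓡 5) p}
    (hX : (modelCoord nabla c p e X).1 = 0) (hY : (modelCoord nabla c p e Y).1 = 0) :
    inclDeriv p Y = sasakiJ nabla p.val (inclDeriv p X) ↔
      (modelCoord nabla c p e Y).2 = Complex.I • (modelCoord nabla c p e X).2 := by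
  obtain ⟨a, h0, h1, h2, k0, k1, k2, -⟩ := he.exists_basis hcs hn hs hc
  constructor
  · intro h
    ext k
    fin_cases k <;> apply Complex.ext <;>
      simp [← h1, ← h2, ← k1, ← k2, h, projDeriv_sasakiJ, connMap_sasakiJ, inner_neg_right]
  · intro h
    refine splitting_ext nabla (eq_of_inner_basis a ?_ ?_ ?_) (eq_of_inner_basis a ?_ ?_ ?_) <;>
      simp [projDeriv_sasakiJ, connMap_sasakiJ, inner_neg_right, h0, h1, h2, k0, k1, k2, h, hX, hY]

/-- `I₋` is multiplication by `j` in components. Since `I₋` kills the lift of `u`, the component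
`θ(X)` of the argument need not vanish. -/
theorem IsAdaptedPair.inclDeriv_eq_endoIMinus_iff (hc : c ≠ 0) {X Y : TangentSpace (𝓡 5) p}
    (hY : (modelCoord nabla c p e Y).1 = 0) :
    inclDeriv p Y = endoIMinus nabla o s p.val (inclDeriv p X) ↔
      (modelCoord nabla c p e Y).2 = quatJ (modelCoord nabla c p e X).2 := by
  obtain ⟨a, h0, h1, h2, k0, k1, k2, x0, x1, x2, y0, y1, y2⟩ := he.exists_basis hcs hn hs hc
  constructor
  · intro h
    ext k
    fin_cases k <;> apply Complex.ext <;>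
      simp [quatJ, ← h1, ← h2, ← k1, ← k2, h, x1, x2, y1, y2]
  · intro h
    refine splitting_ext nabla (eq_of_inner_basis a ?_ ?_ ?_) (eq_of_inner_basis a ?_ ?_ ?_) <;>
      simp [x0, x1, x2, y0, y1, y2, h0, h1, h2, k0, k1, k2, h, hY, quatJ]

end Adapted

end SphereGeometry

/-! ### Frames and reductions to `SU(2)` -/

/-- The sets of frames which a coordinate system identifies with `SU(2)` are orbits of `SU(2)`. -/
theorem isSU2Map_orbit {V : Type*} [AddCommGroup V] [Module ℝ V] [TopologicalSpace V]
    (A : V ≃L[ℝ] W5) {f g : W5 → V} (hf : IsSU2Map (fun w => A (f w))) :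
    IsSU2Map (fun w => A (g w)) ↔ ∃ h ∈ Matrix.specialUnitaryGroup (Fin 2) ℂ,
      ∀ (t : ℝ) (z : Fin 2 → ℂ), g (t, z) = f (t, h.mulVec z) := by
  obtain ⟨U, hU, hf⟩ := hf
  replace hf : ∀ (t : ℝ) (z : Fin 2 → ℂ), A (f (t, z)) = (t, U.mulVec z) := hf
  constructor
  · rintro ⟨U', hU', hg⟩
    replace hg : ∀ (t : ℝ) (z : Fin 2 → ℂ), A (g (t, z)) = (t, U'.mulVec z) := hg
    have hU1 : star U ∈ Matrix.specialUnitaryGroup (Fin 2) ℂ :=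
      (star (⟨U, hU⟩ : Matrix.specialUnitaryGroup (Fin 2) ℂ)).2
    refine ⟨star U * U', mul_mem hU1 hU', fun t z => A.injective ?_⟩
    rw [hf, hg, Matrix.mulVec_mulVec, ← mul_assoc,
      (Matrix.mem_unitaryGroup_iff.1 (Matrix.mem_specialUnitaryGroup_iff.1 hU).1), one_mul]
  · rintro ⟨h, hh, hg⟩
    exact ⟨U * h, mul_mem hU hh, fun t z => (congrArg A (hg t z)).trans (by
      rw [hf, Matrix.mulVec_mulVec])⟩

theorem isSU2Map_id : IsSU2Map (fun w => w) := ⟨1, one_mem _, fun t z => by simp⟩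

section SphereFrames

variable {M : Type*} [TopologicalSpace M] [ChartedSpace E3 M] [IsManifold (𝓡 3) ∞ M]
  [RiemannianBundle (fun x : M => TangentSpace (𝓡 3) x)]
  [IsContMDiffRiemannianBundle (𝓡 3) ∞ E3 (fun x : M => TangentSpace (𝓡 3) x)]
  {nabla : CovariantDerivative (𝓡 3) E3 (TangentSpace (𝓡 3) : M → Type _)}
  {o : ∀ x : M, Orientation ℝ (TangentSpace (𝓡 3) x) (Fin 3)} {s c : ℝ}
  [ChartedSpace E5 (TangentSphere M s)] {p : TangentSphere M s}

section Adapted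

variable (hcs : IsSubmanifoldStructure (M := M) (s := s) inferInstance)
  (hn : IsLeviCivita nabla) (hs : 0 < s)
  {e : Fin 2 → TangentSpace (𝓡 3) p.val.proj} (he : IsAdaptedPair o p e)
include hcs hn hs he

/-- The frames standard for `c θ` and the 2-forms are those whose components are in `SU(2)`. -/
theorem IsAdaptedPair.mem_quadrupletFrames_iff [IsManifold (𝓡 5) ∞ (TangentSphere M s)]
    (hc : c ≠ 0) (g : W5 ≃L[ℝ] TangentSpace (𝓡 5) p) :
    g ∈ quadrupletFrames (fun q : TangentSphere M s => c • theta q) (sphereTwoForm nabla o) p ↔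
      IsSU2Map (fun w => modelCoord nabla c p e (g w)) := by
  obtain ⟨A, hA⟩ := he.exists_equiv hcs hn hs hc
  have hsurj : Function.Surjective (modelCoord nabla c p e ∘L g.toContinuousLinearMap) := by
    intro w
    exact ⟨g.symm (A.symm w), by simp [← hA]⟩
  refine Iff.trans ?_ (isSU2Map_iff_quadruplet
    (modelCoord nabla c p e ∘L g.toContinuousLinearMap).toLinearMap hsurj).symm
  refine and_congr Iff.rfl
    (forall_congr' fun k => forall_congr' fun w => forall_congr' fun w' => ?_)
  rw [he.sphereTwoForm_eq hcs hn hs hc]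
  rfl

/-- The frames adapted to `(θ, J, I₋)` are those whose components, for `c = s⁻¹`, are in `SU(2)`. -/
theorem IsAdaptedPair.mem_adaptedFrames_iff (g : W5 ≃L[ℝ] TangentSpace (𝓡 5) p) :
    g ∈ adaptedFrames nabla o p ↔ IsSU2Map (fun w => modelCoord nabla s⁻¹ p e (g w)) := by
  have hc : s⁻¹ ≠ 0 := inv_ne_zero hs.ne'
  have hcs1 : (s⁻¹ * s)⁻¹ = 1 := by rw [inv_mul_cancel₀ hs.ne', inv_one]
  refine Iff.trans ?_ (isSU2Map_iff_adapted
    (modelCoord nabla s⁻¹ p e ∘L g.toContinuousLinearMap).toLinearMap).symm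
  have h1 (w w' : W5) : sasakiMetric nabla p.val (inclDeriv p (g w)) (inclDeriv p (g w')) =
      (modelCoord nabla s⁻¹ p e (g w)).1 * (modelCoord nabla s⁻¹ p e (g w')).1 +
        stdInner (modelCoord nabla s⁻¹ p e (g w)).2 (modelCoord nabla s⁻¹ p e (g w')).2 := by
    rw [he.sasakiMetric_eq hcs hn hs hc, hcs1, one_mul, one_mul]
  have h2 (w : W5) : theta p (g w) = s * w.1 ↔ (modelCoord nabla s⁻¹ p e (g w)).1 = w.1 := by
    rw [modelCoord_fst, inv_mul_eq_iff_eq_mul₀ hs.ne']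
  constructor
  · rintro ⟨g1, g2, g3, g4⟩
    have g2' := fun w => (h2 w).1 (g2 w)
    exact ⟨fun w w' => (h1 w w').symm.trans (g1 w w'), g2',
      fun z => (he.inclDeriv_eq_sasakiJ_iff hcs hn hs hc (g2' _) (g2' _)).1 (g3 z),
      fun z => (he.inclDeriv_eq_endoIMinus_iff hcs hn hs hc (g2' _)).1 (g4 z)⟩
  · rintro ⟨g1, g2, g3, g4⟩
    exact ⟨fun w w' => (h1 w w').trans (g1 w w'), fun w => (h2 w).2 (g2 w),
      fun z => (he.inclDeriv_eq_sasakiJ_iff hcs hn hs hc (g2 _) (g2 _)).2 (g3 z),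
      fun z => (he.inclDeriv_eq_endoIMinus_iff hcs hn hs hc (g2 _)).2 (g4 z)⟩

end Adapted

variable (hcs : IsSubmanifoldStructure (M := M) (s := s) inferInstance)
  (hn : IsLeviCivita nabla) (hs : 0 < s)
include hcs hn hs

variable (o p) in
theorem adaptedFrames_eq_quadrupletFrames [IsManifold (𝓡 5) ∞ (TangentSphere M s)] :
    adaptedFrames nabla o p = quadrupletFrames (fun q : TangentSphere M s => s⁻¹ • theta q)
      (sphereTwoForm nabla o) p := by
  obtain ⟨e, he⟩ := exists_isAdaptedPair o p hs
  ext g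
  rw [he.mem_adaptedFrames_iff hcs hn hs,
    he.mem_quadrupletFrames_iff hcs hn hs (inv_ne_zero hs.ne')]

theorem quadrupletFrames_orbit [IsManifold (𝓡 5) ∞ (TangentSphere M s)] (hc : c ≠ 0)
    (p : TangentSphere M s) (f g : W5 ≃L[ℝ] TangentSpace (𝓡 5) p)
    (hf : f ∈ quadrupletFrames (fun q : TangentSphere M s => c • theta q)
      (sphereTwoForm nabla o) p) :
    g ∈ quadrupletFrames (fun q : TangentSphere M s => c • theta q) (sphereTwoForm nabla o) p ↔
      ∃ h ∈ Matrix.specialUnitaryGroup (Fin 2) ℂ,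
        ∀ (t : ℝ) (z : Fin 2 → ℂ), g (t, z) = f (t, h.mulVec z) := by
  obtain ⟨e, he⟩ := exists_isAdaptedPair o p hs
  obtain ⟨A, hA⟩ := he.exists_equiv hcs hn hs hc
  rw [he.mem_quadrupletFrames_iff hcs hn hs hc] at hf ⊢
  simp only [← hA] at hf ⊢
  exact isSU2Map_orbit A hf

/-- `J` and `I₋` are complex structures on the contact distribution. -/
theorem contactDistribution_invariant (o : ∀ x : M, Orientation ℝ (TangentSpace (𝓡 3) x) (Fin 3))
    (X : TangentSpace (𝓡 3).tangent p.val) (hX : X ∈ contactDistribution p) :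
    sasakiJ nabla p.val X ∈ contactDistribution p ∧
    endoIMinus nabla o s p.val X ∈ contactDistribution p ∧
    endoIMinus nabla o s p.val (endoIMinus nabla o s p.val X) = -X := by
  obtain ⟨X, hX, rfl⟩ := hX
  obtain ⟨e, he⟩ := exists_isAdaptedPair o p hs
  obtain ⟨A, hA⟩ := he.exists_equiv hcs hn hs one_ne_zero
  have hX0 : (modelCoord nabla 1 p e X).1 = 0 := by
    rw [modelCoord_fst, one_mul]; exact hX
  have hth (z : Fin 2 → ℂ) : A.symm (0, z) ∈ (theta p).ker := by
    have : (modelCoord nabla 1 p e (A.symm (0, z))).1 = 0 := by rw [← hA, A.apply_symm_apply]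
    rw [modelCoord_fst, one_mul] at this
    exact this
  have hAz (z : Fin 2 → ℂ) : modelCoord nabla 1 p e (A.symm (0, z)) = (0, z) := by
    rw [← hA, A.apply_symm_apply]
  have hJ : inclDeriv p (A.symm (0, Complex.I • (modelCoord nabla 1 p e X).2)) =
      sasakiJ nabla p.val (inclDeriv p X) :=
    (he.inclDeriv_eq_sasakiJ_iff hcs hn hs one_ne_zero hX0 (by rw [hAz])).2 (by rw [hAz])
  have hI : inclDeriv p (A.symm (0, quatJ (modelCoord nabla 1 p e X).2)) =
      endoIMinus nabla o s p.val (inclDeriv p X) :=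
    (he.inclDeriv_eq_endoIMinus_iff hcs hn hs one_ne_zero (by rw [hAz])).2 (by rw [hAz])
  refine ⟨⟨_, hth _, hJ⟩, ⟨_, hth _, hI⟩, ?_⟩
  have hII : inclDeriv p (-X) = endoIMinus nabla o s p.val (inclDeriv p
      (A.symm (0, quatJ (modelCoord nabla 1 p e X).2))) := by
    refine (he.inclDeriv_eq_endoIMinus_iff hcs hn hs one_ne_zero ?_).2 ?_
    · rw [map_neg, Prod.fst_neg, hX0, neg_zero]
    · rw [hAz, quatJ_quatJ, map_neg, Prod.snd_neg]
  rw [hI, map_neg] at hII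
  exact hII.symm

/-- The wedge products of the 2-forms of `J`, `I₋`, `J I₋`, and the sign condition. -/
theorem sphereTwoForm_wedge (hc : c ≠ 0) (o : ∀ x : M, Orientation ℝ (TangentSpace (𝓡 3) x) (Fin 3))
    (p : TangentSphere M s) :
    (∀ i j x, wedgeTwoTwo (fun X Y => sphereTwoForm nabla o i p X Y)
      (fun X Y => sphereTwoForm nabla o j p X Y) x =
      if i = j then wedgeTwoTwo (fun X Y => sphereTwoForm nabla o 0 p X Y)
        (fun X Y => sphereTwoForm nabla o 0 p X Y) x else 0) ∧
    ∃ x, wedgeOneFour (c • theta p) (wedgeTwoTwo (fun X Y => sphereTwoForm nabla o 0 p X Y)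
        (fun X Y => sphereTwoForm nabla o 0 p X Y)) x ≠ 0 := by
  obtain ⟨e, he⟩ := exists_isAdaptedPair o p hs
  obtain ⟨A, hA⟩ := he.exists_equiv hcs hn hs hc
  constructor
  · intro i j x
    simp only [he.sphereTwoForm_eq hcs hn hs hc]
    exact wedgeTwoTwo_stdTwoForm i j fun k => (modelCoord nabla c p e (x k)).2
  · refine ⟨fun k => A.symm (stdBasis k), ?_⟩
    have h (w : W5) : modelCoord nabla c p e (A.symm w) = w := by rw [← hA, A.apply_symm_apply]
    have hth (w : W5) : (c • theta p) (A.symm w) = 1 * w.1 := by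
      rw [one_mul]
      exact congrArg Prod.fst (h w)
    have := wedgeOneFour_stdBasis 1
    simp only [he.sphereTwoForm_eq hcs hn hs hc]
    intro h0
    simp only [wedgeOneFour, wedgeTwoTwo, hth, h] at this h0
    linarith

theorem sphereTwoForm_nonneg (o : ∀ x : M, Orientation ℝ (TangentSpace (𝓡 3) x) (Fin 3))
    (p : TangentSphere M s) (X Y : TangentSpace (𝓡 5) p)
    (h : sphereTwoForm nabla o 0 p X = sphereTwoForm nabla o 1 p Y) :
    0 ≤ sphereTwoForm nabla o 2 p X Y := by
  obtain ⟨e, he⟩ := exists_isAdaptedPair o p hs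
  obtain ⟨A, hA⟩ := he.exists_equiv hcs hn hs one_ne_zero
  rw [he.sphereTwoForm_eq hcs hn hs one_ne_zero]
  refine stdTwoForm_nonneg fun z => ?_
  have := DFunLike.congr_fun h (A.symm (0, z))
  rw [he.sphereTwoForm_eq hcs hn hs one_ne_zero, he.sphereTwoForm_eq hcs hn hs one_ne_zero,
    ← hA (A.symm _), A.apply_symm_apply] at this
  exact this

theorem sphereTwoForm_self (o : ∀ x : M, Orientation ℝ (TangentSpace (𝓡 3) x) (Fin 3)) (k : Fin 3)
    (p : TangentSphere M s) (X : TangentSpace (𝓡 5) p) : sphereTwoForm nabla o k p X X = 0 := by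
  obtain ⟨e, he⟩ := exists_isAdaptedPair o p hs
  rw [he.sphereTwoForm_eq hcs hn hs one_ne_zero]
  generalize (modelCoord nabla 1 p e X).2 = z
  fin_cases k
  · exact (stdTwoForm_zero_eq z z).trans (by ring)
  · exact (stdTwoForm_one_eq z z).trans (by ring)
  · exact (stdTwoForm_two_eq z z).trans (by ring)

omit hcs hn in
/-- `I₋` in an oriented orthonormal basis `(u / s, a₁, a₂)`. -/
theorem endoIMinus_lift (p : TangentSphere M s)
    (a : OrthonormalBasis (Fin 3) ℝ (TangentSpace (𝓡 3) p.val.proj))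
    (ha : a.toBasis.orientation = o p.val.proj) (hu : p.val.snd = s • a 0) :
    endoIMinus nabla o s p.val (lift nabla p.val (a 0, 0)) = 0 ∧
    endoIMinus nabla o s p.val (lift nabla p.val (a 1, 0)) = lift nabla p.val (a 2, 0) ∧
    endoIMinus nabla o s p.val (lift nabla p.val (a 2, 0)) = -lift nabla p.val (a 1, 0) ∧
    endoIMinus nabla o s p.val (lift nabla p.val (0, a 1)) = -lift nabla p.val (0, a 2) ∧
    endoIMinus nabla o s p.val (lift nabla p.val (0, a 2)) = lift nabla p.val (0, a 1) := by
  obtain ⟨h0, h1, h2⟩ := cross_orthonormalBasis a ha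
  have hx (x : TangentSpace (𝓡 3) p.val.proj) :
      s⁻¹ • cross (o p.val.proj) p.val.snd x = cross (o p.val.proj) (a 0) x := by
    rw [hu, cross_smul_left, smul_smul, inv_mul_cancel₀ hs.ne', one_smul]
  refine ⟨?_, ?_, ?_, ?_, ?_⟩ <;> apply splitting_ext nabla <;>
    simp only [projDeriv_endoIMinus, connMap_endoIMinus, projDeriv_lift, connMap_lift, hx, h0, h1,
      h2, map_zero, map_neg, smul_zero, neg_zero, neg_neg]

end SphereFrames

/-! ### Smoothness in the frames of the charts of a 5-manifold -/

section FiveManifold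

variable {N : Type*} [TopologicalSpace N] [ChartedSpace E5 N]
  {F G : Type*} [NormedAddCommGroup F] [NormedSpace ℝ F] [NormedAddCommGroup G] [NormedSpace ℝ G]
  {q₀ : N}

theorem contMDiffAt_clm_of_apply [FiniteDimensional ℝ F] {T : N → F →L[ℝ] G}
    (h : ∀ w, ContMDiffAt (𝓡 5) 𝓘(ℝ, G) ∞ (fun q => T q w) q₀) :
    ContMDiffAt (𝓡 5) 𝓘(ℝ, F →L[ℝ] G) ∞ T q₀ := by
  let d := Module.finrank ℝ F
  have hd : d = Module.finrank ℝ (Fin d → ℝ) := (Module.finrank_fin_fun ℝ).symm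
  let e₁ := ContinuousLinearEquiv.ofFinrankEq hd
  let e₂ := (e₁.arrowCongr (1 : G ≃L[ℝ] G)).trans (ContinuousLinearEquiv.piRing (Fin d))
  have h2 : ContMDiffAt (𝓡 5) 𝓘(ℝ, Fin d → G) ∞ (fun q => e₂ (T q)) q₀ :=
    contMDiffAt_pi_space.2 fun i => h _
  have h3 := e₂.symm.contDiff.contMDiff.contMDiffAt.comp q₀ h2
  refine h3.congr_of_eventuallyEq (Filter.Eventually.of_forall fun q => ?_)
  exact (e₂.symm_apply_apply (T q)).symm

variable [IsManifold (𝓡 5) ∞ N]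

/-- The frame of the tangent bundle of `N` in the chart at `q₀`. -/
def chartFrame (q₀ q : N) : E5 →L[ℝ] TangentSpace (𝓡 5) q :=
  (trivializationAt E5 (TangentSpace (𝓡 5) : N → Type _) q₀).symmL ℝ q

theorem contMDiffAt_mfderiv_chartFrame {f : N → F} (hf : ContMDiffAt (𝓡 5) 𝓘(ℝ, F) ∞ f q₀)
    (w : E5) :
    ContMDiffAt (𝓡 5) 𝓘(ℝ, F) ∞
      (fun q => (mfderiv (𝓡 5) 𝓘(ℝ, F) f q (chartFrame q₀ q w) : F)) q₀ := by
  have h := hf.mfderiv_const (m := ∞) le_rfl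
  have h2 := h.clm_apply (contMDiffAt_const (c := w))
  refine h2.congr_of_eventuallyEq (Filter.Eventually.of_forall fun q => ?_)
  simp [inTangentCoordinates, ContinuousLinearMap.inCoordinates, chartFrame]
  rfl

theorem isSmoothOneForm_of_apply {α : ∀ p : N, TangentSpace (𝓡 5) p →L[ℝ] ℝ}
    (h : ∀ (q₀ : N) (w : E5), ContMDiffAt (𝓡 5) 𝓘(ℝ, ℝ) ∞ (fun q => α q (chartFrame q₀ q w)) q₀) :
    IsSmoothOneForm α := fun q₀ => by
  refine (contMDiffAt_hom_bundle (E₁ := (TangentSpace (𝓡 5) : N → Type _))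
    (E₂ := Bundle.Trivial N ℝ) _).2 ⟨contMDiffAt_id, contMDiffAt_clm_of_apply fun w => ?_⟩
  refine (h q₀ w).congr_of_eventuallyEq (Filter.Eventually.of_forall fun q => ?_)
  simp [ContinuousLinearMap.inCoordinates, chartFrame]

theorem contMDiff_twoForm_of_apply
    {β : ∀ p : N, TangentSpace (𝓡 5) p →L[ℝ] TangentSpace (𝓡 5) p →L[ℝ] ℝ}
    (h : ∀ (q₀ : N) (w w' : E5), ContMDiffAt (𝓡 5) 𝓘(ℝ, ℝ) ∞
      (fun q => β q (chartFrame q₀ q w) (chartFrame q₀ q w')) q₀) :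
    ContMDiff (𝓡 5) ((𝓡 5).prod 𝓘(ℝ, E5 →L[ℝ] E5 →L[ℝ] ℝ)) ∞
    (fun p => TotalSpace.mk' (E5 →L[ℝ] E5 →L[ℝ] ℝ)
      (E := fun p : N => TangentSpace (𝓡 5) p →L[ℝ] TangentSpace (𝓡 5) p →L[ℝ] ℝ) p (β p)) :=
  fun q₀ => by
  refine (contMDiffAt_hom_bundle (E₁ := (TangentSpace (𝓡 5) : N → Type _))
    (E₂ := fun p : N => TangentSpace (𝓡 5) p →L[ℝ] Bundle.Trivial N ℝ p) _).2
      ⟨contMDiffAt_id, contMDiffAt_clm_of_apply fun w => contMDiffAt_clm_of_apply fun w' => ?_⟩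
  refine (h q₀ w w').congr_of_eventuallyEq ?_
  filter_upwards [(chartAt E5 q₀).open_source.mem_nhds (mem_chart_source E5 q₀)] with q hq
  have hb : q ∈ (trivializationAt (E5 →L[ℝ] ℝ)
    (fun p : N => TangentSpace (𝓡 5) p →L[ℝ] Bundle.Trivial N ℝ p) q₀).baseSet := ⟨hq, trivial⟩
  simp only [ContinuousLinearMap.inCoordinates, ContinuousLinearMap.comp_apply]
  erw [Trivialization.continuousLinearMapAt_apply_of_mem (R := ℝ) _ hb]
  erw [hom_trivializationAt_apply]
  simp [ContinuousLinearMap.inCoordinates]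
  rfl

/-- The inverse of a smooth family of isomorphisms to `ℝ ⊕ ℂ²` is smooth, as inversion of linear
maps is. -/
theorem contMDiffAt_section_of_chartFrame_comp {A : ∀ q : N, TangentSpace (𝓡 5) q ≃L[ℝ] W5}
    (h : ContMDiffAt (𝓡 5) 𝓘(ℝ, E5 →L[ℝ] W5) ∞
      (fun q => (A q).toContinuousLinearMap ∘L chartFrame q₀ q) q₀) (w : W5) :
    ContMDiffAt (𝓡 5) (𝓡 5).tangent ∞
      (fun q => (⟨q, (A q).symm w⟩ : TangentBundle (𝓡 5) N)) q₀ := by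
  have hmem : ∀ᶠ q in 𝓝 q₀,
      q ∈ (trivializationAt E5 (TangentSpace (𝓡 5) : N → Type _) q₀).baseSet :=
    (chartAt E5 q₀).open_source.mem_nhds (mem_chart_source E5 q₀)
  -- the components of `A` in the frame of the chart form an invertible matrix
  have hE (q : N) (hq : q ∈ (trivializationAt E5 (TangentSpace (𝓡 5) : N → Type _) q₀).baseSet) :
      ∃ E : E5 ≃L[ℝ] W5, (A q).toContinuousLinearMap ∘L chartFrame q₀ q = E ∧
        E.symm w = (trivializationAt E5 (TangentSpace (𝓡 5) : N → Type _) q₀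
          ⟨q, (A q).symm w⟩).2 := by
    refine ⟨((trivializationAt E5 (TangentSpace (𝓡 5) : N → Type _)
      q₀).continuousLinearEquivAt ℝ q hq).symm.trans (A q), ?_, ?_⟩
    · ext1 v
      exact congrArg (A q) (Trivialization.symmL_apply _ hq v)
    · rfl
  refine (contMDiffAt_section q₀).2 ?_
  obtain ⟨E, hE1, -⟩ := hE q₀ hmem.self_of_nhds
  have hinv : ContDiffAt ℝ ∞ (ContinuousLinearMap.inverse : (E5 →L[ℝ] W5) → (W5 →L[ℝ] E5))
      ((A q₀).toContinuousLinearMap ∘L chartFrame q₀ q₀) := by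
    rw [hE1]; exact contDiffAt_map_inverse E
  refine ((hinv.contMDiffAt.comp q₀ h).clm_apply
    (contMDiffAt_const (c := w))).congr_of_eventuallyEq ?_
  filter_upwards [hmem] with q hq
  obtain ⟨E', hE1, hE2⟩ := hE q hq
  simp only [Function.comp_apply]
  rw [hE1, ContinuousLinearMap.inverse_equiv]
  exact hE2.symm

end FiveManifold

/-! ### Local frames of the planes `u^⊥` -/

section GramSchmidt

variable {G : E3 → E3 →L[ℝ] E3 →L[ℝ] ℝ} {Ω : Set (E3 × E3)} {z₀ : E3 × E3}

theorem contDiffOn_bilin_apply {a b : E3 × E3 → E3}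
    (hG : ContDiffOn ℝ ∞ (fun z : E3 × E3 => G z.1) Ω) (ha : ContDiffOn ℝ ∞ a Ω)
    (hb : ContDiffOn ℝ ∞ b Ω) : ContDiffOn ℝ ∞ (fun z => G z.1 (a z) (b z)) Ω :=
  (hG.clm_apply ha).clm_apply hb

/-- A vector field of unit length at one point can be normalized in a neighbourhood. -/
theorem exists_normalized {w : E3 × E3 → E3} (hΩ : IsOpen Ω) (hz : z₀ ∈ Ω)
    (hG : ContDiffOn ℝ ∞ (fun z : E3 × E3 => G z.1) Ω) (hw : ContDiffOn ℝ ∞ w Ω)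
    (h1 : G z₀.1 (w z₀) (w z₀) = 1) :
    ∃ Ω' ⊆ Ω, IsOpen Ω' ∧ z₀ ∈ Ω' ∧ ∃ ε : E3 × E3 → E3, ContDiffOn ℝ ∞ ε Ω' ∧ ε z₀ = w z₀ ∧
      ∀ z ∈ Ω', G z.1 (ε z) (ε z) = 1 ∧ ∃ r : ℝ, ε z = r • w z := by
  have hn : ContDiffOn ℝ ∞ (fun z => G z.1 (w z) (w z)) Ω := contDiffOn_bilin_apply hG hw hw
  refine ⟨Ω ∩ (fun z => G z.1 (w z) (w z)) ⁻¹' Set.Ioi 0, Set.inter_subset_left,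
    hn.continuousOn.isOpen_inter_preimage hΩ isOpen_Ioi, ⟨hz, by simp [h1]⟩,
    fun z => (√(G z.1 (w z) (w z)))⁻¹ • w z, ?_, by simp [h1], fun z hz => ⟨?_, _, rfl⟩⟩
  · have hs : ContDiffOn ℝ ∞ (fun z => (√(G z.1 (w z) (w z)))⁻¹)
        (Ω ∩ (fun z => G z.1 (w z) (w z)) ⁻¹' Set.Ioi 0) :=
      ((hn.mono Set.inter_subset_left).sqrt fun z hz => (ne_of_gt hz.2)).inv
        fun z hz => (Real.sqrt_pos.2 hz.2).ne'
    exact hs.smul (hw.mono Set.inter_subset_left)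
  · have h0 : 0 < G z.1 (w z) (w z) := hz.2
    simp only [map_smul, smul_apply, smul_eq_mul]
    have := Real.mul_self_sqrt h0.le
    have h2 := (Real.sqrt_pos.2 h0).ne'
    field_simp
    rw [sq, this]

/-- Gram-Schmidt orthogonalization of `(v / s, b₁, b₂)` for the metric `G`, near the point
`(y₀, s b₀)` at which this triple is the orthonormal basis `b`. -/
theorem exists_localFrame {T : Set E3} (hT : IsOpen T) (hG : ContDiffOn ℝ ∞ G T)
    (hsymm : ∀ y a b, G y a b = G y b a) {s : ℝ} (hs : 0 < s) {y₀ : E3} (hy : y₀ ∈ T)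
    (b : Module.Basis (Fin 3) ℝ E3) (hb : ∀ i j, G y₀ (b i) (b j) = if i = j then 1 else 0) :
    ∃ Ω : Set (E3 × E3), IsOpen Ω ∧ (y₀, s • b 0) ∈ Ω ∧ (∀ z ∈ Ω, z.1 ∈ T) ∧
      ∃ ε : Fin 2 → E3 × E3 → E3, (∀ k, ContDiffOn ℝ ∞ (ε k) Ω) ∧
      ∀ z ∈ Ω, G z.1 z.2 z.2 = s * s →
        0 < b.det ![s⁻¹ • z.2, ε 0 z, ε 1 z] ∧
        ∀ i j, G z.1 (![s⁻¹ • z.2, ε 0 z, ε 1 z] i) (![s⁻¹ • z.2, ε 0 z, ε 1 z] j) =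
          if i = j then 1 else 0 := by
  have b00 : G y₀ (b 0) (b 0) = 1 := by simp [hb]
  have b01 : G y₀ (b 0) (b 1) = 0 := by simp [hb]
  have b02 : G y₀ (b 0) (b 2) = 0 := by simp [hb]
  have b11 : G y₀ (b 1) (b 1) = 1 := by simp [hb]
  have b12 : G y₀ (b 1) (b 2) = 0 := by simp [hb]
  have b22 : G y₀ (b 2) (b 2) = 1 := by simp [hb]
  let z₀ : E3 × E3 := (y₀, s • b 0)
  -- Gram-Schmidt orthogonalization of `b 1` and `b 2`
  let n (z : E3 × E3) : E3 := s⁻¹ • z.2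
  have hn {Ω : Set (E3 × E3)} : ContDiffOn ℝ ∞ n Ω :=
    (contDiff_snd.const_smul s⁻¹).contDiffOn
  have hn0 : n z₀ = b 0 := by simp [n, z₀, smul_smul, hs.ne']
  let w₁ (z : E3 × E3) : E3 := b 1 - G z.1 (n z) (b 1) • n z
  let Ω₀ : Set (E3 × E3) := Prod.fst ⁻¹' T
  have hG₀ : ContDiffOn ℝ ∞ (fun z : E3 × E3 => G z.1) Ω₀ :=
    hG.comp contDiffOn_fst fun z hz => hz
  have hw₁ : ContDiffOn ℝ ∞ w₁ Ω₀ := contDiffOn_const.sub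
    ((contDiffOn_bilin_apply hG₀ hn contDiffOn_const).smul hn)
  have hw₁0 : w₁ z₀ = b 1 := by
    simp only [w₁, hn0]; simp [z₀, b01]
  obtain ⟨Ω₁, hΩ₁, hΩ₁o, hz₁, ε₁, hε₁, hε₁0, h₁⟩ := exists_normalized (G := G) (w := w₁)
    (z₀ := z₀) (hT.preimage continuous_fst) hy hG₀ hw₁ (by rw [hw₁0]; exact b11)
  have hG₁ := hG₀.mono hΩ₁
  let w₂ (z : E3 × E3) : E3 := b 2 - G z.1 (n z) (b 2) • n z - G z.1 (ε₁ z) (b 2) • ε₁ z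
  have hw₂ : ContDiffOn ℝ ∞ w₂ Ω₁ := (contDiffOn_const.sub
    ((contDiffOn_bilin_apply hG₁ hn contDiffOn_const).smul hn)).sub
    ((contDiffOn_bilin_apply hG₁ hε₁ contDiffOn_const).smul hε₁)
  have hw₂0 : w₂ z₀ = b 2 := by
    simp only [w₂, hn0, hε₁0, hw₁0]; simp [z₀, b02, b12]
  obtain ⟨Ω₂, hΩ₂, hΩ₂o, hz₂, ε₂, hε₂, hε₂0, h₂⟩ := exists_normalized (G := G) (w := w₂)
    (z₀ := z₀) hΩ₁o hz₁ hG₁ hw₂ (by rw [hw₂0]; exact b22)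
  let d (z : E3 × E3) : ℝ := b.det ![n z, ε₁ z, ε₂ z]
  have hd : ContinuousOn d Ω₂ := by
    have hc (i j : Fin 3) : ContinuousOn
        (fun z => b.toMatrix ![n z, ε₁ z, ε₂ z] i j) Ω₂ := by
      have hr (f : E3 × E3 → E3) (hf : ContinuousOn f Ω₂) :
          ContinuousOn (fun z => b.repr (f z) i) Ω₂ :=
        (LinearMap.continuous_of_finiteDimensional (b.coord i)).comp_continuousOn hf
      fin_cases j
      · exact hr n hn.continuousOn
      · exact hr ε₁ (hε₁.mono hΩ₂).continuousOn
      · exact hr ε₂ hε₂.continuousOn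
    have : d = fun z => Matrix.det (b.toMatrix ![n z, ε₁ z, ε₂ z]) := rfl
    rw [this]
    simp only [Matrix.det_fin_three]
    fun_prop
  have hd0 : d z₀ = 1 := by
    have : (![b 0, b 1, b 2] : Fin 3 → E3) = b := by ext1 i; fin_cases i <;> rfl
    simp only [d, hn0, hε₁0, hε₂0, hw₁0, hw₂0, this, b.det_self]
  refine ⟨Ω₂ ∩ d ⁻¹' Set.Ioi 0, hd.isOpen_inter_preimage hΩ₂o isOpen_Ioi,
    ⟨hz₂, by simp [z₀, hd0]⟩, fun z hz => hΩ₁ (hΩ₂ hz.1), ![ε₁, ε₂], fun k => ?_,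
    fun z hz hzs => ⟨hz.2, ?_⟩⟩
  · fin_cases k
    · exact hε₁.mono (Set.inter_subset_left.trans hΩ₂)
    · exact hε₂.mono Set.inter_subset_left
  · obtain ⟨e11, r₁, hr₁⟩ := h₁ z (hΩ₂ hz.1)
    obtain ⟨e22, r₂, hr₂⟩ := h₂ z hz.1
    have nn : G z.1 (n z) (n z) = 1 := by
      simp only [n, map_smul, smul_apply, smul_eq_mul, hzs]
      field_simp
    have n1 : G z.1 (n z) (ε₁ z) = 0 := by
      rw [hr₁]
      simp [w₁, nn]
    have n2 : G z.1 (n z) (ε₂ z) = 0 := by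
      rw [hr₂]
      simp [w₂, nn, n1]
    have e12 : G z.1 (ε₁ z) (ε₂ z) = 0 := by
      rw [hr₂]
      simp [w₂, e11, hsymm _ (ε₁ z) (n z), n1]
    intro i j
    fin_cases i <;> fin_cases j
    · exact nn
    · exact n1
    · exact n2
    · exact (hsymm _ _ _).trans n1
    · exact e11
    · exact e12
    · exact (hsymm _ _ _).trans n2
    · exact (hsymm _ _ _).trans e12
    · exact e22

end GramSchmidt

section LocalPair

variable {M : Type*} [TopologicalSpace M] [ChartedSpace E3 M] [IsManifold (𝓡 3) ∞ M]

/-- The coordinates `(x, v)` of tangent vectors in the chart at `x₀`. -/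
def bundleCoord (x₀ : M) (u : TangentBundle (𝓡 3) M) : E3 × E3 :=
  (extChartAt (𝓡 3) x₀ u.proj, (tangentTriv x₀ u).2)

variable [RiemannianBundle (fun x : M => TangentSpace (𝓡 3) x)]
  [IsContMDiffRiemannianBundle (𝓡 3) ∞ E3 (fun x : M => TangentSpace (𝓡 3) x)]
  {o : ∀ x : M, Orientation ℝ (TangentSpace (𝓡 3) x) (Fin 3)} {s : ℝ}

/-- The tangent sphere bundle has local frames of the planes `u^⊥` which are smooth, orthonormal
and positively oriented: Gram-Schmidt orthogonalization preserves the orientation locally. -/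
theorem exists_local_isAdaptedPair (ho : IsManifoldOrientation o) (hs : 0 < s)
    (p₀ : TangentSphere M s) :
    ∃ Ω : Set (E3 × E3), IsOpen Ω ∧ bundleCoord p₀.val.proj p₀.val ∈ Ω ∧
      ∃ ε : Fin 2 → E3 × E3 → E3, (∀ k, ContDiffOn ℝ ∞ (ε k) Ω) ∧
      ∀ᶠ p : TangentSphere M s in 𝓝 p₀, bundleCoord p₀.val.proj p.val ∈ Ω →
        IsAdaptedPair o p (fun k =>
          coordField p₀.val.proj (ε k (bundleCoord p₀.val.proj p.val)) p.val.proj) := by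
  obtain ⟨a, ha, hu⟩ := exists_oriented_orthonormalBasis (o p₀.val.proj) hs p₀.property
  have hx₀ : p₀.val.proj ∈ (chartAt E3 p₀.val.proj).source := mem_chart_source E3 _
  generalize hL₀ : (tangentTriv p₀.val.proj).linearEquivAt ℝ p₀.val.proj hx₀ = L₀
  have hL₀' (v : TangentSpace (𝓡 3) p₀.val.proj) :
      L₀ v = (tangentTriv p₀.val.proj ⟨p₀.val.proj, v⟩).2 := by rw [← hL₀]; rfl
  obtain ⟨o₀, ho₀⟩ := ho p₀.val.proj
  have ho₁ := ho₀.self_of_nhds hx₀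
  have hbo : (a.toBasis.map L₀).orientation = o₀ := by
    rw [Module.Basis.orientation_map, ha, ← ho₁, ← hL₀]
  have hb (i j : Fin 3) : metricCoord p₀.val.proj (extChartAt (𝓡 3) p₀.val.proj p₀.val.proj)
      (a.toBasis.map L₀ i) (a.toBasis.map L₀ j) = if i = j then 1 else 0 := by
    rw [Module.Basis.map_apply, Module.Basis.map_apply, hL₀', hL₀', metricCoord_tangentTriv hx₀,
      OrthonormalBasis.coe_toBasis, a.inner_eq_ite]
  obtain ⟨Ω, hΩ, hz, hT, ε, hε, h⟩ := exists_localFrame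
    (isOpen_extChartAt_target (I := 𝓡 3) p₀.val.proj)
    (contDiffOn_metricCoord p₀.val.proj) (metricCoord_symm p₀.val.proj) hs
    (extChartAt_mem_target' hx₀) (a.toBasis.map L₀) hb
  have hsb : s • (a.toBasis.map L₀) 0 = (tangentTriv p₀.val.proj p₀.val).2 := by
    rw [Module.Basis.map_apply, ← map_smul, OrthonormalBasis.coe_toBasis, ← hu, hL₀']
  rw [hsb] at hz
  refine ⟨Ω, hΩ, hz, ε, hε, ?_⟩
  have hcont : Continuous (fun p : TangentSphere M s => p.val.proj) :=
    (FiberBundle.continuous_proj E3 (TangentSpace (𝓡 3) : M → Type _)).comp continuous_subtype_val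
  filter_upwards [hcont.continuousAt.eventually ho₀, hcont.continuousAt.preimage_mem_nhds
    ((chartAt E3 p₀.val.proj).open_source.mem_nhds hx₀)] with p hop hx hpΩ
  replace hop := hop hx
  generalize hL : (tangentTriv p₀.val.proj).linearEquivAt ℝ p.val.proj hx = L at hop
  have hL' (v : TangentSpace (𝓡 3) p.val.proj) :
      L v = (tangentTriv p₀.val.proj ⟨p.val.proj, v⟩).2 := by rw [← hL]; rfl
  -- on the sphere bundle the hypothesis `G(v, v) = s²` of the local frame holds
  have hnorm : metricCoord p₀.val.proj (bundleCoord p₀.val.proj p.val).1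
      (bundleCoord p₀.val.proj p.val).2 (bundleCoord p₀.val.proj p.val).2 = s * s := by
    refine (metricCoord_tangentTriv hx p.val.snd p.val.snd).trans ?_
    rw [real_inner_self_eq_norm_mul_norm, p.property]
  obtain ⟨hdet, hG⟩ := h _ hpΩ hnorm
  generalize hw : ![s⁻¹ • (bundleCoord p₀.val.proj p.val).2, ε 0 (bundleCoord p₀.val.proj p.val),
    ε 1 (bundleCoord p₀.val.proj p.val)] = w at hdet hG
  have horth : Orthonormal ℝ (fun i => coordField p₀.val.proj (w i) p.val.proj) := by
    rw [orthonormal_iff_ite]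
    intro i j
    rw [← metricCoord_extChartAt hx]
    exact hG i j
  obtain ⟨a', ha'⟩ := Orthonormal.exists_orthonormalBasis_extension_of_card_eq (𝕜 := ℝ)
    (ι := Fin 3) (E := TangentSpace (𝓡 3) p.val.proj)
    (by simpa using (Fact.out : Module.finrank ℝ (TangentSpace (𝓡 3) p.val.proj) = 3))
    (v := fun i => coordField p₀.val.proj (w i) p.val.proj) (s := Set.univ)
    (horth.comp _ Subtype.val_injective)
  have hLw (i : Fin 3) : L (coordField p₀.val.proj (w i) p.val.proj) = w i :=
    (hL' _).trans (tangentTriv_coordField hx (w i))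
  have hb' : (a'.toBasis.map L : Fin 3 → E3) = w := by
    ext1 i
    rw [Module.Basis.map_apply, OrthonormalBasis.coe_toBasis, ha' i trivial, hLw]
  refine ⟨a', ?_, ?_, ?_, ?_⟩
  · apply (Orientation.map (Fin 3) L).injective
    rw [hop, ← Module.Basis.orientation_map, ← hbo, eq_comm,
      Module.Basis.orientation_eq_iff_det_pos, hb']
    exact hdet
  · rw [ha' 0 trivial, ← hw]
    have h1 : coordField p₀.val.proj (s⁻¹ • (bundleCoord p₀.val.proj p.val).2) p.val.proj =
        s⁻¹ • p.val.snd := (map_smul _ _ _).trans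
      (congrArg (fun v => s⁻¹ • v) (coordField_tangentTriv hx p.val.snd))
    refine Eq.trans ?_ (congrArg (fun v => s • v) h1.symm)
    rw [smul_smul, mul_inv_cancel₀ hs.ne', one_smul]
  · rw [ha' 1 trivial, ← hw]; rfl
  · rw [ha' 2 trivial, ← hw]; rfl

end LocalPair

/-! ### Smoothness of the components -/

section Smooth

variable {M : Type*} [TopologicalSpace M] [ChartedSpace E3 M] [IsManifold (𝓡 3) ∞ M]
  [RiemannianBundle (fun x : M => TangentSpace (𝓡 3) x)]
  {s : ℝ} [ChartedSpace E5 (TangentSphere M s)] {x₀ : M} {q : TangentSphere M s}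

/-- The base point in the chart at `x₀`, as a function on the tangent sphere bundle. -/
def sphereBase (x₀ : M) (q : TangentSphere M s) : E3 := extChartAt (𝓡 3) x₀ q.val.proj

/-- The components in the chart at `x₀`, as a function on the tangent sphere bundle. -/
def sphereFiber (x₀ : M) (q : TangentSphere M s) : E3 := (tangentTriv x₀ q.val).2

section Derivatives

variable (hcs : IsSubmanifoldStructure (M := M) (s := s) inferInstance)
  (hq : q.val.proj ∈ (chartAt E3 x₀).source)
include hcs hq

theorem contMDiffAt_sphereBase : ContMDiffAt (𝓡 5) 𝓘(ℝ, E3) ∞ (sphereBase (s := s) x₀) q := by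
  have h1 : ContMDiffAt (𝓡 3) 𝓘(ℝ, E3) ∞ (extChartAt (𝓡 3) x₀) q.val.proj :=
    contMDiffAt_extChartAt' hq
  exact h1.comp q ((contMDiff_proj (TangentSpace (𝓡 3) : M → Type _)).comp
    hcs.contMDiff_val).contMDiffAt

theorem contMDiffAt_sphereFiber : ContMDiffAt (𝓡 5) 𝓘(ℝ, E3) ∞ (sphereFiber (s := s) x₀) q := by
  have h1 : ContMDiffAt (𝓡 3).tangent 𝓘(ℝ, E3) ∞
      (fun p : TangentBundle (𝓡 3) M => (tangentTriv x₀ p).2) q.val :=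
    (contMDiffOn_tangentTriv_snd x₀).contMDiffAt
      ((tangentTriv x₀).open_source.mem_nhds ((tangentTriv x₀).mem_source.2 hq))
  exact h1.comp q hcs.contMDiff_val.contMDiffAt

theorem mfderiv_sphereBase (X : TangentSpace (𝓡 5) q) :
    mfderiv (𝓡 5) 𝓘(ℝ, E3) (sphereBase (s := s) x₀) q X =
      (tangentTriv x₀ ⟨q.val.proj, projDeriv q.val (inclDeriv q X)⟩).2 := by
  have h1 : HasMFDerivAt (𝓡 5) (𝓡 3).tangent (Subtype.val : TangentSphere M s → _) q
      (inclDeriv q) := ((hcs.contMDiff_val q).mdifferentiableAt (by simp)).hasMFDerivAt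
  have h2 := HasMFDerivAt.comp q
    (g := fun p : TangentBundle (𝓡 3) M => extChartAt (𝓡 3) x₀ p.proj)
    (hasMFDerivAt_extChartAt_proj hq) h1
  exact (DFunLike.congr_fun h2.mfderiv X).trans (tangentTriv_snd_eq hq _).symm

theorem mfderiv_sphereFiber (X : TangentSpace (𝓡 5) q) :
    mfderiv (𝓡 5) 𝓘(ℝ, E3) (sphereFiber (s := s) x₀) q X =
      fiberDeriv x₀ q.val (inclDeriv q X) := by
  have h1 : HasMFDerivAt (𝓡 5) (𝓡 3).tangent (Subtype.val : TangentSphere M s → _) q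
      (inclDeriv q) := ((hcs.contMDiff_val q).mdifferentiableAt (by simp)).hasMFDerivAt
  have h2 := HasMFDerivAt.comp q (g := fun p : TangentBundle (𝓡 3) M => (tangentTriv x₀ p).2)
    (hasMFDerivAt_tangentTriv_snd hq) h1
  exact DFunLike.congr_fun h2.mfderiv X

theorem inner_coordField_projDeriv (b : E3) (X : TangentSpace (𝓡 5) q) :
    inner ℝ (coordField x₀ b q.val.proj) (projDeriv q.val (inclDeriv q X)) =
      metricCoord x₀ (sphereBase x₀ q) b (mfderiv (𝓡 5) 𝓘(ℝ, E3) (sphereBase (s := s) x₀) q X) := by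
  rw [mfderiv_sphereBase hcs hq]
  have h := metricCoord_tangentTriv hq (coordField x₀ b q.val.proj)
    (projDeriv q.val (inclDeriv q X))
  rw [tangentTriv_coordField hq] at h
  exact h.symm

/-- In a chart `θ` is the 1-form `g(v, dx)`. -/
theorem theta_eq_metricCoord (X : TangentSpace (𝓡 5) q) :
    theta q X = metricCoord x₀ (sphereBase x₀ q) (sphereFiber x₀ q)
      (mfderiv (𝓡 5) 𝓘(ℝ, E3) (sphereBase (s := s) x₀) q X) := by
  rw [← inner_coordField_projDeriv hcs hq]
  refine (theta_apply X).trans ?_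
  congr 1
  exact (coordField_tangentTriv hq q.val.snd).symm

/-- In a chart `⟪b, K ·⟫` is the 1-form `g(dv, b) + Γ(dx, v, b)`. -/
theorem inner_coordField_connMap
    [IsContMDiffRiemannianBundle (𝓡 3) ∞ E3 (fun x : M => TangentSpace (𝓡 3) x)]
    {nabla : CovariantDerivative (𝓡 3) E3 (TangentSpace (𝓡 3) : M → Type _)}
    (hn : IsLeviCivita nabla) (b : E3) (X : TangentSpace (𝓡 5) q) :
    inner ℝ (coordField x₀ b q.val.proj) (connMap nabla q.val (inclDeriv q X)) =
      metricCoord x₀ (sphereBase x₀ q) (mfderiv (𝓡 5) 𝓘(ℝ, E3) (sphereFiber (s := s) x₀) q X) b +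
      christoffel x₀ (sphereBase x₀ q) (mfderiv (𝓡 5) 𝓘(ℝ, E3) (sphereBase (s := s) x₀) q X)
        (sphereFiber x₀ q) b := by
  rw [mfderiv_sphereBase hcs hq, mfderiv_sphereFiber hcs hq, real_inner_comm]
  exact hn.inner_connMap hq _ _

end Derivatives

variable [IsContMDiffRiemannianBundle (𝓡 3) ∞ E3 (fun x : M => TangentSpace (𝓡 3) x)]
  {nabla : CovariantDerivative (𝓡 3) E3 (TangentSpace (𝓡 3) : M → Type _)}
  [IsManifold (𝓡 5) ∞ (TangentSphere M s)]

/-- The components are smooth: in a chart they are polynomials in the metric, its derivatives, the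
vectors `e₀`, `e₁`, and the differentials of the coordinates `x` and `v`. -/
theorem contMDiffAt_modelCoord (hcs : IsSubmanifoldStructure (M := M) (s := s) inferInstance)
    (hn : IsLeviCivita nabla) (c : ℝ) {Ω : Set (E3 × E3)} (hΩ : IsOpen Ω)
    {ε : Fin 2 → E3 × E3 → E3} (hε : ∀ k, ContDiffOn ℝ ∞ (ε k) Ω)
    (hq : q.val.proj ∈ (chartAt E3 x₀).source) (hqΩ : bundleCoord x₀ q.val ∈ Ω) :
    ContMDiffAt (𝓡 5) 𝓘(ℝ, E5 →L[ℝ] W5) ∞ (fun p => modelCoord nabla c p (fun k =>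
      coordField x₀ (ε k (bundleCoord x₀ p.val)) p.val.proj) ∘L chartFrame q p) q := by
  refine contMDiffAt_clm_of_apply fun w => ?_
  have h1 := contMDiffAt_sphereBase hcs hq
  have h2 := contMDiffAt_sphereFiber hcs hq
  have d1 := contMDiffAt_mfderiv_chartFrame h1 w
  have d2 := contMDiffAt_mfderiv_chartFrame h2 w
  have hG : ContMDiffAt (𝓡 5) 𝓘(ℝ, E3 →L[ℝ] E3 →L[ℝ] ℝ) ∞
      (fun p : TangentSphere M s => metricCoord x₀ (sphereBase x₀ p)) q :=
    (contDiffAt_metricCoord hq).contMDiffAt.comp q h1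
  have hD : ContMDiffAt (𝓡 5) 𝓘(ℝ, E3 →L[ℝ] E3 →L[ℝ] E3 →L[ℝ] ℝ) ∞
      (fun p : TangentSphere M s => derivMetricCoord x₀ (sphereBase x₀ p)) q := by
    have : ContDiffAt ℝ ∞ (derivMetricCoord x₀) (extChartAt (𝓡 3) x₀ q.val.proj) :=
      (contDiffAt_metricCoord hq).fderiv_right (m := ∞) (by simp)
    exact this.contMDiffAt.comp q h1
  have hE (k : Fin 2) : ContMDiffAt (𝓡 5) 𝓘(ℝ, E3) ∞
      (fun p : TangentSphere M s => ε k (bundleCoord x₀ p.val)) q :=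
    ((hε k).contDiffAt (hΩ.mem_nhds hqΩ)).contMDiffAt.comp q (h1.prodMk_space h2)
  have hr (r : ℝ) : ContMDiffAt (𝓡 5) 𝓘(ℝ, ℝ) ∞ (fun _ : TangentSphere M s => r) q :=
    contMDiffAt_const
  have hth := (hG.clm_apply h2).clm_apply d1
  have hre (k : Fin 2) := (hG.clm_apply (hE k)).clm_apply d1
  -- the summand with the factor `1 / 2` is the Christoffel symbol
  have him (k : Fin 2) := ((hG.clm_apply d2).clm_apply (hE k)).add
    ((hr (1 / 2)).smul
      (((((hD.clm_apply d1).clm_apply h2).clm_apply (hE k)).add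
        (((hD.clm_apply h2).clm_apply d1).clm_apply (hE k))).sub
        (((hD.clm_apply (hE k)).clm_apply d1).clm_apply h2)))
  have key := ((hr c).smul hth).prodMk_space (contMDiffAt_pi_space.2 fun k : Fin 2 =>
    (Complex.equivRealProdCLM.symm.contDiff (n := ∞)).contMDiff.contMDiffAt.comp q
      ((hre k).prodMk_space (him k)))
  refine key.congr_of_eventuallyEq ?_
  have hcont : Continuous (fun p : TangentSphere M s => p.val.proj) :=
    (FiberBundle.continuous_proj E3 (TangentSpace (𝓡 3) : M → Type _)).comp continuous_subtype_val
  filter_upwards [hcont.continuousAt.preimage_mem_nhds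
    ((chartAt E3 x₀).open_source.mem_nhds hq)] with p hp
  refine Prod.ext ?_ (funext fun k => Complex.ext ?_ ?_)
  · exact congrArg (c * ·) (theta_eq_metricCoord hcs hp _)
  · exact inner_coordField_projDeriv hcs hp _ _
  · refine (inner_coordField_connMap hcs hp hn _ _).trans (congrArg₂ (· + ·) rfl ?_)
    refine (div_eq_inv_mul _ _).trans ?_
    rw [← one_div]
    rfl

end Smooth

/-! ### The smooth reduction to `SU(2)` -/

section Reduction

theorem contMDiffAt_stdTwoForm {N : Type*} [TopologicalSpace N] [ChartedSpace E5 N] {q₀ : N}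
    {z w : N → Fin 2 → ℂ} (hz : ContMDiffAt (𝓡 5) 𝓘(ℝ, Fin 2 → ℂ) ∞ z q₀)
    (hw : ContMDiffAt (𝓡 5) 𝓘(ℝ, Fin 2 → ℂ) ∞ w q₀) (k : Fin 3) :
    ContMDiffAt (𝓡 5) 𝓘(ℝ, ℝ) ∞ (fun q => stdTwoForm k (z q) (w q)) q₀ := by
  have hre (i : Fin 2) : ContDiff ℝ ∞ (fun z : Fin 2 → ℂ => (z i).re) :=
    Complex.reCLM.contDiff.comp (contDiff_apply ℝ ℂ i)
  have him (i : Fin 2) : ContDiff ℝ ∞ (fun z : Fin 2 → ℂ => (z i).im) :=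
    Complex.imCLM.contDiff.comp (contDiff_apply ℝ ℂ i)
  have h : ContDiff ℝ ∞ (fun zw : (Fin 2 → ℂ) × (Fin 2 → ℂ) => stdTwoForm k zw.1 zw.2) := by
    have hre1 (i : Fin 2) := (hre i).comp (contDiff_fst (E := Fin 2 → ℂ) (F := Fin 2 → ℂ))
    have hre2 (i : Fin 2) := (hre i).comp (contDiff_snd (E := Fin 2 → ℂ) (F := Fin 2 → ℂ))
    have him1 (i : Fin 2) := (him i).comp (contDiff_fst (E := Fin 2 → ℂ) (F := Fin 2 → ℂ))
    have him2 (i : Fin 2) := (him i).comp (contDiff_snd (E := Fin 2 → ℂ) (F := Fin 2 → ℂ))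
    fin_cases k
    · simp only [Fin.zero_eta, stdTwoForm_zero_eq]
      exact ((((hre1 0).mul (him2 0)).sub ((him1 0).mul (hre2 0))).add
        (((hre1 1).mul (him2 1)).sub ((him1 1).mul (hre2 1))))
    · simp only [Fin.mk_one, stdTwoForm_one_eq]
      exact ((((hre1 0).mul (hre2 1)).sub ((hre1 1).mul (hre2 0))).add
        (((him1 1).mul (him2 0)).sub ((him1 0).mul (him2 1))))
    · simp only [Fin.reduceFinMk, stdTwoForm_two_eq]
      exact ((((hre1 0).mul (him2 1)).sub ((him1 1).mul (hre2 0))).add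
        (((him1 0).mul (hre2 1)).sub ((hre1 1).mul (him2 0))))
  exact h.contMDiff.contMDiffAt.comp q₀ (hz.prodMk_space hw)

variable {M : Type*} [TopologicalSpace M] [ChartedSpace E3 M] [IsManifold (𝓡 3) ∞ M]
  [RiemannianBundle (fun x : M => TangentSpace (𝓡 3) x)]
  [IsContMDiffRiemannianBundle (𝓡 3) ∞ E3 (fun x : M => TangentSpace (𝓡 3) x)]
  {nabla : CovariantDerivative (𝓡 3) E3 (TangentSpace (𝓡 3) : M → Type _)}
  {o : ∀ x : M, Orientation ℝ (TangentSpace (𝓡 3) x) (Fin 3)} {s c : ℝ}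
  [ChartedSpace E5 (TangentSphere M s)] [IsManifold (𝓡 5) ∞ (TangentSphere M s)]
  (hcs : IsSubmanifoldStructure (M := M) (s := s) inferInstance)
  (hn : IsLeviCivita nabla) (ho : IsManifoldOrientation o) (hs : 0 < s)
include hcs hn ho hs

/-- Adapted pairs whose components are smooth near `p₀`. Outside of the neighbourhood the pairs are
arbitrary. -/
theorem exists_local_modelCoord (c : ℝ) (p₀ : TangentSphere M s) :
    ∃ U : Set (TangentSphere M s), IsOpen U ∧ p₀ ∈ U ∧
      ∃ e : ∀ p : TangentSphere M s, Fin 2 → TangentSpace (𝓡 3) p.val.proj,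
        (∀ p, IsAdaptedPair o p (e p)) ∧
        ∀ q ∈ U, ContMDiffAt (𝓡 5) 𝓘(ℝ, E5 →L[ℝ] W5) ∞
          (fun p => modelCoord nabla c p (e p) ∘L chartFrame q p) q := by
  classical
  obtain ⟨Ω, hΩ, hz, ε, hε, h⟩ := exists_local_isAdaptedPair ho hs p₀
  have hx₀ : p₀.val.proj ∈ (chartAt E3 p₀.val.proj).source := mem_chart_source E3 _
  have hcont : Continuous (fun p : TangentSphere M s => p.val.proj) :=
    (FiberBundle.continuous_proj E3 (TangentSpace (𝓡 3) : M → Type _)).comp continuous_subtype_val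
  have hΩ' : ∀ᶠ p : TangentSphere M s in 𝓝 p₀, bundleCoord p₀.val.proj p.val ∈ Ω :=
    ((contMDiffAt_sphereBase hcs hx₀).continuousAt.prodMk
      (contMDiffAt_sphereFiber hcs hx₀).continuousAt).preimage_mem_nhds (hΩ.mem_nhds hz)
  obtain ⟨U, hU, hUo, hpU⟩ := mem_nhds_iff.1 (Filter.inter_mem (Filter.inter_mem h hΩ')
    (hcont.continuousAt.preimage_mem_nhds ((chartAt E3 p₀.val.proj).open_source.mem_nhds hx₀)))
  choose e₀ he₀ using fun p : TangentSphere M s => exists_isAdaptedPair o p hs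
  refine ⟨U, hUo, hpU, fun p => if p ∈ U then fun k =>
    coordField p₀.val.proj (ε k (bundleCoord p₀.val.proj p.val)) p.val.proj else e₀ p,
    fun p => ?_, fun q hq => ?_⟩
  · by_cases hp : p ∈ U
    · simp only [if_pos hp]
      exact (hU hp).1.1 (hU hp).1.2
    · simp only [if_neg hp]
      exact he₀ p
  · refine (contMDiffAt_modelCoord hcs hn c hΩ hε (hU hq).2 (hU hq).1.2).congr_of_eventuallyEq ?_
    filter_upwards [hUo.mem_nhds hq] with p hp
    rw [if_pos hp]

theorem isSmoothOneForm_smul_theta (c : ℝ) :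
    IsSmoothOneForm (fun p : TangentSphere M s => c • theta p) :=
  isSmoothOneForm_of_apply fun q₀ w => by
  obtain ⟨U, -, hq, e, -, he⟩ := exists_local_modelCoord hcs hn ho hs c q₀
  exact contDiff_fst.contMDiff.contMDiffAt.comp q₀
    ((he q₀ hq).clm_apply (contMDiffAt_const (c := w)))

theorem isSmoothTwoForm_sphereTwoForm (k : Fin 3) :
    IsSmoothTwoForm (sphereTwoForm (s := s) nabla o k) where
  alternating := sphereTwoForm_self hcs hn hs o k
  contMDiff := contMDiff_twoForm_of_apply fun q₀ w w' => by
    obtain ⟨U, -, hq, e, he', he⟩ := exists_local_modelCoord hcs hn ho hs 1 q₀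
    have h (w : E5) := contDiff_snd.contMDiff.contMDiffAt.comp q₀
      ((he q₀ hq).clm_apply (contMDiffAt_const (c := w)))
    exact (contMDiffAt_stdTwoForm (h w) (h w') k).congr_of_eventuallyEq
      (Filter.Eventually.of_forall fun p => (he' p).sphereTwoForm_eq hcs hn hs one_ne_zero k _ _)

theorem isSU2Structure_quadrupletFrames (hc : c ≠ 0) :
    IsSU2Structure (quadrupletFrames (fun p : TangentSphere M s => c • theta p)
      (sphereTwoForm nabla o)) where
  orbit := quadrupletFrames_orbit hcs hn hs hc
  local_section p₀ := by
    obtain ⟨U, hU, hpU, e, he', he⟩ := exists_local_modelCoord hcs hn ho hs c p₀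
    choose A hA using fun p => (he' p).exists_equiv hcs hn hs hc
    refine ⟨U, hU, hpU, fun p => (A p).symm, fun p hp => ?_, fun w q hq => ?_⟩
    · rw [(he' p).mem_quadrupletFrames_iff hcs hn hs hc]
      simp only [← hA, ContinuousLinearEquiv.apply_symm_apply]
      exact isSU2Map_id
    · refine (contMDiffAt_section_of_chartFrame_comp (A := A) ?_ w).contMDiffWithinAt
      have : (fun p => (A p).toContinuousLinearMap ∘L chartFrame q p) =
          fun p => modelCoord nabla c p (e p) ∘L chartFrame q p :=
        funext fun p => ContinuousLinearMap.ext fun w => hA p _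
      rw [this]
      exact he q hq

theorem isContiSalamonQuadruplet_sphere (hc : c ≠ 0) :
    IsContiSalamonQuadruplet (fun p : TangentSphere M s => c • theta p)
      (sphereTwoForm nabla o) where
  smooth_one := isSmoothOneForm_smul_theta hcs hn ho hs c
  smooth_two := isSmoothTwoForm_sphereTwoForm hcs hn ho hs
  wedge p := ⟨_, (sphereTwoForm_wedge hcs hn hs hc o p).1, (sphereTwoForm_wedge hcs hn hs hc o p).2⟩
  nonneg := sphereTwoForm_nonneg hcs hn hs o

end Reduction

/-! ### The exterior derivative of `θ` -/

section ExteriorDerivative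

/-- The exterior derivative of the 1-form `y ↦ G(F₁ y)(F₂ y, dF₁ ·)`. The second derivative of `F₁`
drops out by symmetry. -/
theorem fderiv_pullback_antisymm {G : E3 → E3 →L[ℝ] E3 →L[ℝ] ℝ} {F₁ F₂ : E5 → E3} {y : E5}
    (hG : DifferentiableAt ℝ G (F₁ y)) (h₁ : ContDiffAt ℝ ∞ F₁ y) (h₂ : DifferentiableAt ℝ F₂ y)
    (v w : E5) :
    fderiv ℝ (fun y => G (F₁ y) (F₂ y) ∘L fderiv ℝ F₁ y) y v w -
      fderiv ℝ (fun y => G (F₁ y) (F₂ y) ∘L fderiv ℝ F₁ y) y w v =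
    (fderiv ℝ G (F₁ y) (fderiv ℝ F₁ y v) (F₂ y) (fderiv ℝ F₁ y w) +
      G (F₁ y) (fderiv ℝ F₂ y v) (fderiv ℝ F₁ y w)) -
    (fderiv ℝ G (F₁ y) (fderiv ℝ F₁ y w) (F₂ y) (fderiv ℝ F₁ y v) +
      G (F₁ y) (fderiv ℝ F₂ y w) (fderiv ℝ F₁ y v)) := by
  have hs : IsSymmSndFDerivAt ℝ F₁ y := h₁.isSymmSndFDerivAt (by
    rw [minSmoothness_of_isRCLikeNormedField]; exact WithTop.coe_le_coe.2 (le_top : (2 : ℕ∞) ≤ ⊤))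
  have hd₁ := (h₁.differentiableAt (by simp)).hasFDerivAt
  have hdd := ((h₁.fderiv_right (m := ∞) (by simp)).differentiableAt (by simp)).hasFDerivAt
  have hGF : HasFDerivAt (fun y => G (F₁ y)) (fderiv ℝ G (F₁ y) ∘L fderiv ℝ F₁ y) y :=
    hG.hasFDerivAt.comp y hd₁
  have h := (hGF.clm_apply h₂.hasFDerivAt).clm_comp hdd
  have e (v w : E5) : fderiv ℝ (fun y => G (F₁ y) (F₂ y) ∘L fderiv ℝ F₁ y) y v w =
      G (F₁ y) (F₂ y) (fderiv ℝ (fderiv ℝ F₁) y v w) +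
      (G (F₁ y) (fderiv ℝ F₂ y v) (fderiv ℝ F₁ y w) +
        fderiv ℝ G (F₁ y) (fderiv ℝ F₁ y v) (F₂ y) (fderiv ℝ F₁ y w)) :=
    DFunLike.congr_fun (DFunLike.congr_fun h.fderiv v) w
  rw [e v w, e w v, hs.eq v w]
  ring

section Chart

variable {N : Type*} [TopologicalSpace N] [ChartedSpace E5 N] [IsManifold (𝓡 5) ∞ N] {p : N}

theorem contMDiffAt_extChartAt_symm_of_mem_target {y : E5} (hy : y ∈ (extChartAt (𝓡 5) p).target) :
    ContMDiffAt 𝓘(ℝ, E5) (𝓡 5) ∞ (extChartAt (𝓡 5) p).symm y :=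
  (contMDiffOn_extChartAt_symm p).contMDiffAt ((isOpen_extChartAt_target p).mem_nhds hy)

theorem contDiffAt_comp_extChartAt_symm {f : N → E3} (hf : ContMDiffAt (𝓡 5) 𝓘(ℝ, E3) ∞ f p) :
    ContDiffAt ℝ ∞ (fun y => f ((extChartAt (𝓡 5) p).symm y)) (extChartAt (𝓡 5) p p) :=
  contMDiffAt_iff_contDiffAt.1 (ContMDiffAt.comp (extChartAt (𝓡 5) p p) (g := f)
    (by rw [extChartAt_to_inv]; exact hf)
    (contMDiffAt_extChartAt_symm_of_mem_target (mem_extChartAt_target p)))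

theorem fderiv_comp_extChartAt_symm {f : N → E3} (hf : ContMDiffAt (𝓡 5) 𝓘(ℝ, E3) ∞ f p)
    (X : TangentSpace (𝓡 5) p) :
    fderiv ℝ (fun y => f ((extChartAt (𝓡 5) p).symm y)) (extChartAt (𝓡 5) p p)
      (mvfderiv (𝓡 5) (extChartAt (𝓡 5) p) p X) = mvfderiv (𝓡 5) f p X := by
  have h1 := HasMFDerivAt.comp p (g := fun y => f ((extChartAt (𝓡 5) p).symm y))
    ((contDiffAt_comp_extChartAt_symm hf).differentiableAt (by simp)).hasFDerivAt.hasMFDerivAt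
    (mdifferentiableAt_extChartAt (I := 𝓡 5) (mem_chart_source E5 p)).hasMFDerivAt
  have h2 := h1.congr_of_eventuallyEq (f₁ := f) (by
    filter_upwards [extChartAt_source_mem_nhds (I := 𝓡 5) p] with q hq
    exact (congrArg f ((extChartAt (𝓡 5) p).left_inv hq)).symm)
  exact (DFunLike.congr_fun h2.mfderiv X).symm

end Chart

variable {M : Type*} [TopologicalSpace M] [ChartedSpace E3 M] [IsManifold (𝓡 3) ∞ M]
  [RiemannianBundle (fun x : M => TangentSpace (𝓡 3) x)]
  [IsContMDiffRiemannianBundle (𝓡 3) ∞ E3 (fun x : M => TangentSpace (𝓡 3) x)]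
  {nabla : CovariantDerivative (𝓡 3) E3 (TangentSpace (𝓡 3) : M → Type _)} {s : ℝ}
  [ChartedSpace E5 (TangentSphere M s)] {x₀ : M} {p : TangentSphere M s}

/-- The part of the Christoffel symbol `Γ(a, v, b)` which is antisymmetric in `a` and `b` is that of
`(D_a g)(v, b)`. -/
theorem christoffel_sub_christoffel {x : M} (hx : x ∈ (chartAt E3 x₀).source) (a v b : E3) :
    christoffel x₀ (extChartAt (𝓡 3) x₀ x) a v b - christoffel x₀ (extChartAt (𝓡 3) x₀ x) b v a =
      derivMetricCoord x₀ (extChartAt (𝓡 3) x₀ x) a v b -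
        derivMetricCoord x₀ (extChartAt (𝓡 3) x₀ x) b v a := by
  rw [christoffel, christoffel, derivMetricCoord_symm hx v b a, derivMetricCoord_symm hx a b v,
    derivMetricCoord_symm hx b a v]
  ring

theorem inner_projDeriv_connMap (hcs : IsSubmanifoldStructure (M := M) (s := s) inferInstance)
    (hn : IsLeviCivita nabla) (hp : p.val.proj ∈ (chartAt E3 x₀).source)
    (X Y : TangentSpace (𝓡 5) p) :
    inner ℝ (projDeriv p.val (inclDeriv p X)) (connMap nabla p.val (inclDeriv p Y)) =
      metricCoord x₀ (sphereBase x₀ p) (mvfderiv (𝓡 5) (sphereFiber (s := s) x₀) p Y)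
        (mvfderiv (𝓡 5) (sphereBase (s := s) x₀) p X) +
      christoffel x₀ (sphereBase x₀ p) (mvfderiv (𝓡 5) (sphereBase (s := s) x₀) p Y)
        (sphereFiber x₀ p) (mvfderiv (𝓡 5) (sphereBase (s := s) x₀) p X) := by
  have h : coordField x₀ (mvfderiv (𝓡 5) (sphereBase (s := s) x₀) p X) p.val.proj =
      projDeriv p.val (inclDeriv p X) :=
    (congrArg (fun b => coordField x₀ b p.val.proj) (mfderiv_sphereBase hcs hp X)).trans
      (coordField_tangentTriv hp _)
  rw [← h]
  exact inner_coordField_connMap hcs hp hn _ Y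

variable [IsManifold (𝓡 5) ∞ (TangentSphere M s)]

/-- `θ` in the chart at `p`. -/
theorem theta_comp_eventuallyEq (hcs : IsSubmanifoldStructure (M := M) (s := s) inferInstance)
    (hx₀ : p.val.proj ∈ (chartAt E3 x₀).source) :
    (fun y => theta ((extChartAt (𝓡 5) p).symm y) ∘L
      (mfderiv 𝓘(ℝ, E5) (𝓡 5) (extChartAt (𝓡 5) p).symm y ∘L
        (NormedSpace.fromTangentSpace y).symm.toContinuousLinearMap)) =ᶠ[𝓝 (extChartAt (𝓡 5) p p)]
      fun y => metricCoord x₀ (sphereBase x₀ ((extChartAt (𝓡 5) p).symm y))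
        (sphereFiber x₀ ((extChartAt (𝓡 5) p).symm y)) ∘L
        fderiv ℝ (fun y => sphereBase (s := s) x₀ ((extChartAt (𝓡 5) p).symm y)) y := by
  have hcont : Continuous (fun q : TangentSphere M s => q.val.proj) :=
    (FiberBundle.continuous_proj E3 (TangentSpace (𝓡 3) : M → Type _)).comp
      continuous_subtype_val
  have hc : ContinuousAt (fun y => ((extChartAt (𝓡 5) p).symm y).val.proj)
      (extChartAt (𝓡 5) p p) := hcont.continuousAt.comp
    (contMDiffAt_extChartAt_symm_of_mem_target (mem_extChartAt_target p)).continuousAt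
  filter_upwards [(isOpen_extChartAt_target p).mem_nhds (mem_extChartAt_target (I := 𝓡 5) p),
    hc.preimage_mem_nhds ((chartAt E3 x₀).open_source.mem_nhds
      (by rw [extChartAt_to_inv]; exact hx₀))] with y hy hyx
  ext w
  have h1 := mfderiv_comp y ((contMDiffAt_sphereBase hcs hyx).mdifferentiableAt (by simp))
    ((contMDiffAt_extChartAt_symm_of_mem_target hy).mdifferentiableAt (by simp))
  have h2 : fderiv ℝ (fun y => sphereBase (s := s) x₀ ((extChartAt (𝓡 5) p).symm y)) y w =
      mfderiv (𝓡 5) 𝓘(ℝ, E3) (sphereBase (s := s) x₀) ((extChartAt (𝓡 5) p).symm y)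
        (mfderiv 𝓘(ℝ, E5) (𝓡 5) (extChartAt (𝓡 5) p).symm y w) := by
    rw [← mfderiv_eq_fderiv]
    exact DFunLike.congr_fun h1 w
  refine (theta_eq_metricCoord hcs hyx _).trans ?_
  exact (congrArg (metricCoord x₀ (sphereBase x₀ ((extChartAt (𝓡 5) p).symm y))
        (sphereFiber x₀ ((extChartAt (𝓡 5) p).symm y))) h2).symm

/-- `dθ` in coordinates, from `θ = g(v, dx)`. -/
theorem extDerivOneForm_theta_eq (hcs : IsSubmanifoldStructure (M := M) (s := s) inferInstance)
    (hx₀ : p.val.proj ∈ (chartAt E3 x₀).source) (X Y : TangentSpace (𝓡 5) p) :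
    extDerivOneForm (fun q : TangentSphere M s => theta q) p X Y =
      (derivMetricCoord x₀ (sphereBase x₀ p) (mvfderiv (𝓡 5) (sphereBase (s := s) x₀) p X)
          (sphereFiber x₀ p) (mvfderiv (𝓡 5) (sphereBase (s := s) x₀) p Y) +
        metricCoord x₀ (sphereBase x₀ p) (mvfderiv (𝓡 5) (sphereFiber (s := s) x₀) p X)
          (mvfderiv (𝓡 5) (sphereBase (s := s) x₀) p Y)) -
      (derivMetricCoord x₀ (sphereBase x₀ p) (mvfderiv (𝓡 5) (sphereBase (s := s) x₀) p Y)
          (sphereFiber x₀ p) (mvfderiv (𝓡 5) (sphereBase (s := s) x₀) p X) +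
        metricCoord x₀ (sphereBase x₀ p) (mvfderiv (𝓡 5) (sphereFiber (s := s) x₀) p Y)
          (mvfderiv (𝓡 5) (sphereBase (s := s) x₀) p X)) := by
  have hdef : extDerivOneForm (fun q : TangentSphere M s => theta q) p X Y =
    fderiv ℝ (fun y => theta ((extChartAt (𝓡 5) p).symm y) ∘L
      (mfderiv 𝓘(ℝ, E5) (𝓡 5) (extChartAt (𝓡 5) p).symm y ∘L
        (NormedSpace.fromTangentSpace y).symm.toContinuousLinearMap)) (extChartAt (𝓡 5) p p)
        (mvfderiv (𝓡 5) (extChartAt (𝓡 5) p) p X) (mvfderiv (𝓡 5) (extChartAt (𝓡 5) p) p Y) -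
    fderiv ℝ (fun y => theta ((extChartAt (𝓡 5) p).symm y) ∘L
      (mfderiv 𝓘(ℝ, E5) (𝓡 5) (extChartAt (𝓡 5) p).symm y ∘L
        (NormedSpace.fromTangentSpace y).symm.toContinuousLinearMap)) (extChartAt (𝓡 5) p p)
        (mvfderiv (𝓡 5) (extChartAt (𝓡 5) p) p Y) (mvfderiv (𝓡 5) (extChartAt (𝓡 5) p) p X) := rfl
  have h₁ := contMDiffAt_sphereBase hcs hx₀
  have h₂ := contMDiffAt_sphereFiber hcs hx₀
  have hG : DifferentiableAt ℝ (metricCoord x₀)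
      (sphereBase x₀ ((extChartAt (𝓡 5) p).symm (extChartAt (𝓡 5) p p))) := by
    rw [extChartAt_to_inv]
    exact (contDiffAt_metricCoord hx₀).differentiableAt (by simp)
  have key := fderiv_pullback_antisymm hG (contDiffAt_comp_extChartAt_symm h₁)
    ((contDiffAt_comp_extChartAt_symm h₂).differentiableAt (by simp))
    (mvfderiv (𝓡 5) (extChartAt (𝓡 5) p) p X) (mvfderiv (𝓡 5) (extChartAt (𝓡 5) p) p Y)
  rw [fderiv_comp_extChartAt_symm h₁, fderiv_comp_extChartAt_symm h₁,
    fderiv_comp_extChartAt_symm h₂, fderiv_comp_extChartAt_symm h₂, extChartAt_to_inv] at key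
  rw [hdef, (theta_comp_eventuallyEq hcs hx₀).fderiv_eq]
  exact key

/-- `dθ(X, Y) = ⟪K X, dπ Y⟫ - ⟪dπ X, K Y⟫`: the difference of the Christoffel terms of the right
hand side is the contribution to `dθ` of the derivatives of the metric. -/
theorem extDerivOneForm_theta (hcs : IsSubmanifoldStructure (M := M) (s := s) inferInstance)
    (hn : IsLeviCivita nabla) (p : TangentSphere M s) (X Y : TangentSpace (𝓡 5) p) :
    extDerivOneForm (fun q : TangentSphere M s => theta q) p X Y =
      sasakiMetric nabla p.val (inclDeriv p X) (sasakiJ nabla p.val (inclDeriv p Y)) := by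
  have hx₀ : p.val.proj ∈ (chartAt E3 p.val.proj).source := mem_chart_source E3 _
  rw [extDerivOneForm_theta_eq hcs hx₀, sasakiMetric_apply, projDeriv_sasakiJ, connMap_sasakiJ,
    inner_neg_right, real_inner_comm _ (connMap nabla p.val (inclDeriv p X)),
    inner_projDeriv_connMap hcs hn hx₀ X Y, inner_projDeriv_connMap hcs hn hx₀ Y X]
  have h := christoffel_sub_christoffel hx₀ (mvfderiv (𝓡 5) (sphereBase (s := s) p.val.proj) p X)
    (sphereFiber p.val.proj p) (mvfderiv (𝓡 5) (sphereBase (s := s) p.val.proj) p Y)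
  change christoffel p.val.proj (sphereBase p.val.proj p) _ _ _ -
    christoffel p.val.proj (sphereBase p.val.proj p) _ _ _ =
    derivMetricCoord p.val.proj (sphereBase p.val.proj p) _ _ _ -
    derivMetricCoord p.val.proj (sphereBase p.val.proj p) _ _ _ at h
  linarith

end ExteriorDerivative

/-! ### The contact form -/

section Contact

variable {M : Type*} [TopologicalSpace M] [ChartedSpace E3 M] [IsManifold (𝓡 3) ∞ M]
  [RiemannianBundle (fun x : M => TangentSpace (𝓡 3) x)]
  [IsContMDiffRiemannianBundle (𝓡 3) ∞ E3 (fun x : M => TangentSpace (𝓡 3) x)]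
  {nabla : CovariantDerivative (𝓡 3) E3 (TangentSpace (𝓡 3) : M → Type _)}
  {o : ∀ x : M, Orientation ℝ (TangentSpace (𝓡 3) x) (Fin 3)} {s : ℝ}
  [ChartedSpace E5 (TangentSphere M s)] [IsManifold (𝓡 5) ∞ (TangentSphere M s)]

theorem sasakiMetric_sasakiJ_right (u : TangentBundle (𝓡 3) M)
    (X Y : TangentSpace (𝓡 3).tangent u) :
    sasakiMetric nabla u X (sasakiJ nabla u Y) = -sasakiMetric nabla u (sasakiJ nabla u X) Y := by
  rw [sasakiMetric_apply, sasakiMetric_apply, projDeriv_sasakiJ, projDeriv_sasakiJ,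
    connMap_sasakiJ, connMap_sasakiJ, inner_neg_right, inner_neg_left]
  ring

/-- `θ` is a contact form: `dθ` is the opposite of the 2-form of `J`. -/
theorem isContactForm_theta (hcs : IsSubmanifoldStructure (M := M) (s := s) inferInstance)
    (hn : IsLeviCivita nabla) (ho : IsManifoldOrientation o) (hs : 0 < s) :
    IsContactForm (fun p : TangentSphere M s => theta p) where
  smooth := by
    have h := isSmoothOneForm_smul_theta hcs hn ho hs 1
    simpa only [one_smul] using h
  nondegenerate p := by
    obtain ⟨x, hx⟩ := (sphereTwoForm_wedge hcs hn hs one_ne_zero o p).2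
    refine ⟨x, ?_⟩
    have h (X Y : TangentSpace (𝓡 5) p) :
        extDerivOneForm (fun q : TangentSphere M s => theta q) p X Y =
          -sphereTwoForm nabla o 0 p X Y :=
      (extDerivOneForm_theta hcs hn p X Y).trans (sasakiMetric_sasakiJ_right p.val _ _)
    simp only [wedgeOneFour, wedgeTwoTwo, h, neg_mul_neg, one_smul] at hx ⊢
    exact hx

end Contact

end

theorem mainTheorem3 {M : Type*} [TopologicalSpace M] [ChartedSpace E3 M]
    [IsManifold (𝓡 3) ∞ M]
    [RiemannianBundle (fun x : M => TangentSpace (𝓡 3) x)]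
    [IsContMDiffRiemannianBundle (𝓡 3) ∞ E3 (fun x : M => TangentSpace (𝓡 3) x)]
    (o : ∀ x : M, Orientation ℝ (TangentSpace (𝓡 3) x) (Fin 3))
    (ho : IsManifoldOrientation o) (s : ℝ) (hs : 0 < s) :
    -- the Levi-Civita connection and the submanifold structure of the sphere bundle exist
    (∃ nabla : CovariantDerivative (𝓡 3) E3 (TangentSpace (𝓡 3) : M → Type _),
      IsLeviCivita nabla) ∧
    (∃ cs : ChartedSpace E5 (TangentSphere M s), IsSubmanifoldStructure cs) ∧
    ∀ nabla : CovariantDerivative (𝓡 3) E3 (TangentSpace (𝓡 3) : M → Type _),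
      IsLeviCivita nabla →
    ∀ (cs : ChartedSpace E5 (TangentSphere M s)) (hcs : IsSubmanifoldStructure cs),
      haveI : IsManifold (𝓡 5) ∞ (TangentSphere M s) := hcs.isManifold
      -- `θ` is a contact form, and `dθ (X, Y) = ⟨X, J Y⟩`
      IsContactForm (fun p : TangentSphere M s => theta p) ∧
      (∀ (p : TangentSphere M s) (X Y : TangentSpace (𝓡 5) p),
        extDerivOneForm (fun q : TangentSphere M s => theta q) p X Y =
          sasakiMetric nabla p.val (inclDeriv p X) (sasakiJ nabla p.val (inclDeriv p Y))) ∧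
      -- `J` and `I₋` are anticommuting complex structures on the contact distribution
      (∀ p : TangentSphere M s,
        (∀ X ∈ contactDistribution p,
          sasakiJ nabla p.val X ∈ contactDistribution p ∧
          endoIMinus nabla o s p.val X ∈ contactDistribution p ∧
          sasakiJ nabla p.val (sasakiJ nabla p.val X) = -X ∧
          endoIMinus nabla o s p.val (endoIMinus nabla o s p.val X) = -X) ∧
        ∀ X, sasakiJ nabla p.val (endoIMinus nabla o s p.val X) =
          -endoIMinus nabla o s p.val (sasakiJ nabla p.val X)) ∧
      -- in every oriented frame with `u = s a₀`, `I₋` is given by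
      -- `e₀ ↦ 0`, `e₁ ↦ e₂ ↦ -e₁`, `e₃ ↦ -e₄ ↦ -e₃`, where `eᵢ = aᵢ^h` and `e₂₊ᵢ = aᵢ^v`
      (∀ (p : TangentSphere M s)
        (a : OrthonormalBasis (Fin 3) ℝ (TangentSpace (𝓡 3) p.val.proj)),
        a.toBasis.orientation = o p.val.proj → p.val.snd = s • a 0 →
          endoIMinus nabla o s p.val (lift nabla p.val (a 0, 0)) = 0 ∧
          endoIMinus nabla o s p.val (lift nabla p.val (a 1, 0)) = lift nabla p.val (a 2, 0) ∧
          endoIMinus nabla o s p.val (lift nabla p.val (a 2, 0)) = -lift nabla p.val (a 1, 0) ∧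
          endoIMinus nabla o s p.val (lift nabla p.val (0, a 1)) = -lift nabla p.val (0, a 2) ∧
          endoIMinus nabla o s p.val (lift nabla p.val (0, a 2)) = lift nabla p.val (0, a 1)) ∧
      -- the frames adapted to `(θ, J, I₋)` and the metric form an `SU(2)`-structure
      IsSU2Structure (fun p : TangentSphere M s => adaptedFrames nabla o p) ∧
      -- it is the one of the quadruplet with unit contact form `s⁻¹ θ`
      (∀ p : TangentSphere M s, adaptedFrames nabla o p =
        quadrupletFrames (fun q : TangentSphere M s => s⁻¹ • theta q)
          (sphereTwoForm nabla o) p) ∧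
      -- `θ` (or any positive multiple, as `s⁻¹ θ`) and the 2-forms of `J`, `I₋`, `J I₋` satisfy
      -- the conditions of Conti and Salamon and define an `SU(2)`-structure
      ∀ c : ℝ, 0 < c →
        IsContiSalamonQuadruplet (fun p : TangentSphere M s => c • theta p)
          (sphereTwoForm nabla o) ∧
        IsSU2Structure (quadrupletFrames (fun p : TangentSphere M s => c • theta p)
          (sphereTwoForm nabla o)) := by
  refine ⟨exists_isLeviCivita, exists_isSubmanifoldStructure hs, fun nabla hn cs hcs => ?_⟩
  have hm : IsManifold (𝓡 5) ∞ (TangentSphere M s) := hcs.isManifold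
  refine ⟨isContactForm_theta hcs hn ho hs, extDerivOneForm_theta hcs hn,
    fun p => ⟨fun X hX => ?_, sasakiJ_endoIMinus⟩, endoIMinus_lift hs, ?_,
    fun p => adaptedFrames_eq_quadrupletFrames o p hcs hn hs,
    fun c hc => ⟨isContiSalamonQuadruplet_sphere hcs hn ho hs hc.ne',
      isSU2Structure_quadrupletFrames hcs hn ho hs hc.ne'⟩⟩
  · obtain ⟨h1, h2, h3⟩ := contactDistribution_invariant hcs hn hs o X hX
    exact ⟨h1, h2, sasakiJ_sasakiJ X, h3⟩
  · rw [funext fun p => adaptedFrames_eq_quadrupletFrames o p hcs hn hs]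
    exact isSU2Structure_quadrupletFrames hcs hn ho hs (inv_ne_zero hs.ne')
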